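/- Let $G$ be a second countable, locally compact, Hausdorff topological group with a (left) Haar measure $\mu_G$, and let $E$ be a locally compact, metrizable, proper $G$-space with compact quotient $E/G$ (for example a co-compact model of the universal proper $G$-space $\underline{E}G$). $G$ acts on functions on $E$ by $g(\phi)(x)=\phi(g^{-1}x)$. All $C^*$-algebras are complex and $\mathbb{Z}/2$-graded by a $*$-automorphism of order at most two (which extends to multiplier algebras); all commutators are graded commutators, extended bilinearly to non-homogeneous elements. A $G$-$C^*$-algebra is a graded $C^*$-algebra on which $G$ acts by degree-preserving $*$-automorphisms such that $g\mapsto g(a)$ is norm continuous for every element $a$; the action extends to the multiplier algebra. Let $J$ be a $\sigma$-unital $G$-$C^*$-algebra. Let $P$ be a proper $G$-$C^*$-algebra, i.e. a $G$-$C^*$-algebra equipped with a $G$-equivariant $*$-homomorphism from $C_0(E)$ (trivially graded) to the degree-$0$ part of the center $Z(M(P))$ such that $C_0(E)P$ is dense in $P$; and let $P$ be represented on $J$ by a $G$-equivariant, degree-preserving $*$-homomorphism $P\to M(J)$ such that $PJ$ is dense in $J$. This representation extends canonically to $M(P)\to M(J)$, so that $C_0(E)$ is represented in $M(J)$; we write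 $\phi$ also for the image of $\phi\in C_0(E)$ in $M(J)$. Let $A_1,A_2\subset M(J)$ be $\sigma$-unital $C^*$-subalgebras such that $A_1$ is $G$-invariant, contains (the image of) $P$, and $PA_1$ is dense in $A_1$. Let $\Delta,\Delta'\subset M(J)$ be norm-separable subsets with $[\Delta,A_1]\subset A_1$ and $[\Delta',A_1]\subset J$. Assume $A_1\cdot A_2\subset J$. Let $c$ be a cut-off function on $E$, i.e. a continuous, compactly supported function $c\colon E\to[0,\infty)$ with $\int_G g(c)^2\,d\mu_G(g)=1$ pointwise on $E$. Then there are positive elements $M_1,M_2$ of degree $0$ in $M(J)$ such that $M_1+M_2=1$ and, for $i=1,2$: 1. $g(M_i)-M_i\in J$ for every $g\in G$; 2. $M_1x\in J$ for every $x\in A_1$; 3. $M_2x\in J$ for every $x\in A_2$; 4. $[M_i,x]\in J$ for every $x\in\Delta$; 5. the function $g\mapsto[M_i,g(\phi)]$ belongs to $C_0(G,J)$ for every $\phi\in C_0(E)$; 6. the function $g\mapsto M_2[x,g(\phi)]$ belongs to $C_0(G,J)$ for every $x\in\Delta'$ and $\phi\in C_0(E)$; 7. the integral $\int_G g(c)M_ig(c)\,d\mu_G(g)$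 exists in $M(J)$, as the limit in the strict topology of the norm integrals over the compact subsets of $G$ directed by inclusion, and $\int_G g(c)M_ig(c)\,d\mu_G(g)-M_i\in J$. -/

import Mathlib

open Filter Topology MeasureTheory
open scoped MultiplierAlgebra ZeroAtInfty CStarAlgebra

namespace TechThm

noncomputable section

/-! ### Multiplier algebras -/

section Multiplier

variable {A : Type*} [NonUnitalCStarAlgebra A]

/-- A `*`-automorphism of a `C*`-algebra as a (bounded) linear operator. -/
def autCLM (α : A ≃⋆ₐ[ℂ] A) : A →L[ℂ] A where
  toFun := α
  map_add' := map_add α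
  map_smul' := map_smul α
  cont := AddMonoidHomClass.continuous_of_bound α 1 fun a => by
    rw [one_mul, StarAlgEquiv.norm_map]

/-- The canonical extension of a `*`-automorphism `α` of `A` to the multiplier algebra `M(A)`:
the multiplier `T` is sent to `α ∘ T ∘ α⁻¹`. -/
def mulExt (α : A ≃⋆ₐ[ℂ] A) (T : 𝓜(ℂ, A)) : 𝓜(ℂ, A) where
  fst := autCLM α ∘L T.fst ∘L autCLM α.symm
  snd := autCLM α ∘L T.snd ∘L autCLM α.symm
  central x y := by
    have h := congrArg α (T.central (α.symm x) (α.symm y))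
    simpa [autCLM] using h

/-- The copy of `A` inside its multiplier algebra. -/
def inIdeal (A : Type*) [NonUnitalCStarAlgebra A] : Set 𝓜(ℂ, A) :=
  Set.range (fun a : A => (a : 𝓜(ℂ, A)))

/-- A `C*`-algebra is `σ`-unital if it has a countable (sequential) approximate unit of positive
contractions. -/
def IsSigmaUnital (B : Type*) [NonUnitalNormedRing B] [StarRing B] : Prop :=
  ∃ u : ℕ → B, (∀ n, (∃ b, u n = star b * b) ∧ ‖u n‖ ≤ 1) ∧
    ∀ b, Tendsto (fun n => u n * b) atTop (𝓝 b) ∧ Tendsto (fun n => b * u n) atTop (𝓝 b)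

/-- A `*`-homomorphism `B → M(A)` is non-degenerate if (the span of) `B A` is dense in `A`. -/
def IsNondegenerate {B : Type*} [NonUnitalCStarAlgebra B] (π : B →⋆ₙₐ[ℂ] 𝓜(ℂ, A)) : Prop :=
  Dense (Submodule.span ℂ {a : A | ∃ b a', a = (π b).fst a'} : Set A)

end Multiplier

/-! ### The extension of a non-degenerate representation to the multiplier algebra -/

section Extension

variable {P J : Type*} [NonUnitalCStarAlgebra P] [NonUnitalCStarAlgebra J]

theorem fst_mul (T : 𝓜(ℂ, P)) (a b : P) : T.fst a * b = T.fst (a * b) := by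
  refine sub_eq_zero.1 ((CStarRing.star_mul_self_eq_zero_iff _).1 ?_)
  rw [mul_sub, ← T.central, ← mul_assoc, ← T.central, mul_assoc, sub_self]

theorem eq_of_fst_eq {S T : 𝓜(ℂ, P)} (h : S.fst = T.fst) : S = T := by
  rw [← sub_eq_zero, ← norm_eq_zero, ← DoubleCentralizer.norm_fst, DoubleCentralizer.sub_fst, h,
    sub_self, norm_zero]

theorem star_fst_mul (T : 𝓜(ℂ, P)) (a b : P) : star (T.fst a) * b = star a * (star T).fst b := by
  rw [← DoubleCentralizer.central, DoubleCentralizer.star_snd, star_star]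

theorem exists_extension_fst (π : P →⋆ₙₐ[ℂ] 𝓜(ℂ, J)) (hπ : IsNondegenerate π) (T : 𝓜(ℂ, P)) :
    ∃ L : J →L[ℂ] J, ∀ p, L ∘L (π p).fst = (π (T.fst p)).fst := by
  let _ := CStarAlgebra.spectralOrder P
  have _ := CStarAlgebra.spectralOrderedRing P
  have hl := CStarAlgebra.increasingApproximateUnit P
  set l := CStarAlgebra.approximateUnit P
  have hb : ∀ᶠ e in l, ∀ j : J, ‖(π (T.fst e)).fst j‖ ≤ ‖T‖ * ‖j‖ := by
    filter_upwards [hl.eventually_norm] with e he j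
    calc ‖(π (T.fst e)).fst j‖ ≤ ‖(π (T.fst e)).fst‖ * ‖j‖ := ContinuousLinearMap.le_opNorm _ _
      _ ≤ ‖T‖ * ‖j‖ := by
        gcongr
        rw [DoubleCentralizer.norm_fst]
        calc ‖π (T.fst e)‖ ≤ ‖T.fst e‖ := NonUnitalStarAlgHom.norm_apply_le π _
          _ ≤ ‖T.fst‖ * ‖e‖ := ContinuousLinearMap.le_opNorm _ _
          _ ≤ ‖T.fst‖ * 1 := by gcongr
          _ = ‖T‖ := by rw [mul_one, DoubleCentralizer.norm_fst]
  have hTmul : ∀ e p : P, T.fst e * p = T.fst (e * p) := by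
    intro e p
    exact fst_mul T e p
  have hgen : ∀ p j, Tendsto (fun e => (π (T.fst e)).fst ((π p).fst j)) l
      (𝓝 ((π (T.fst p)).fst j)) := by
    intro p j
    have hc : Continuous fun q : P => (π (T.fst q)).fst j := by
      have h1 : Continuous fun q : P => π (T.fst q) :=
        (map_continuous π).comp T.fst.continuous
      have h2 : (fun q : P => (π (T.fst q)).fst j)
          = fun q : P => (DoubleCentralizer.toProdHom (π (T.fst q))).1 j := rfl
      have h3 : Continuous (DoubleCentralizer.toProdHom : 𝓜(ℂ, J) →+ _) :=
        AddMonoidHomClass.continuous_of_bound _ 1 (fun x => by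
          rw [one_mul, ← DoubleCentralizer.norm_def])
      rw [h2]
      exact (h3.comp h1).fst.clm_apply continuous_const
    have h := (hc.tendsto p).comp (hl.tendsto_mul_right p)
    refine h.congr fun e => ?_
    simp only [Function.comp]
    rw [← hTmul, map_mul]
    rfl
  have hspan : ∀ j ∈ Submodule.span ℂ {a : J | ∃ b a', a = (π b).fst a'},
      ∃ y, Tendsto (fun e => (π (T.fst e)).fst j) l (𝓝 y) := by
    intro j hj
    induction hj using Submodule.span_induction with
    | mem x hx =>
      obtain ⟨b, a', rfl⟩ := hx
      exact ⟨_, hgen b a'⟩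
    | zero => exact ⟨0, by simp⟩
    | add x y _ _ hx hy =>
      obtain ⟨x', hx⟩ := hx
      obtain ⟨y', hy⟩ := hy
      exact ⟨x' + y', by simpa using hx.add hy⟩
    | smul a x _ hx =>
      obtain ⟨x', hx⟩ := hx
      exact ⟨a • x', by simpa using hx.const_smul a⟩
  have hall : ∀ j, ∃ y, Tendsto (fun e => (π (T.fst e)).fst j) l (𝓝 y) := by
    intro j
    refine CompleteSpace.complete (Metric.cauchy_iff.2 ⟨inferInstance, fun ε hε => ?_⟩)
    have hδ : 0 < ε / (3 * (‖T‖ + 1)) := by positivity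
    obtain ⟨j', hj', hd⟩ := Metric.mem_closure_iff.1 (hπ j) _ hδ
    obtain ⟨y, hy⟩ := hspan j' hj'
    have hs := hb.and (hy (Metric.ball_mem_nhds y (show 0 < ε / 6 by positivity)))
    refine ⟨_, image_mem_map hs, ?_⟩
    have key : ∀ e, (∀ j : J, ‖(π (T.fst e)).fst j‖ ≤ ‖T‖ * ‖j‖) →
        (π (T.fst e)).fst j' ∈ Metric.ball y (ε / 6) →
        dist ((π (T.fst e)).fst j) y < ε / 2 := by
      intro e h1 h2
      have h3 : dist ((π (T.fst e)).fst j) ((π (T.fst e)).fst j') ≤ ε / 3 := by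
        rw [dist_eq_norm, ← map_sub]
        refine (h1 _).trans ?_
        rw [dist_eq_norm] at hd
        calc ‖T‖ * ‖j - j'‖ ≤ (‖T‖ + 1) * (ε / (3 * (‖T‖ + 1))) := by gcongr; linarith
          _ = ε / 3 := by field_simp
      have := dist_triangle ((π (T.fst e)).fst j) ((π (T.fst e)).fst j') y
      rw [Metric.mem_ball] at h2
      linarith
    rintro _ ⟨e, ⟨h1, h2⟩, rfl⟩ _ ⟨e', ⟨h1', h2'⟩, rfl⟩
    have a := key e h1 h2
    have b := key e' h1' h2'
    have := dist_triangle_right ((π (T.fst e)).fst j) ((π (T.fst e')).fst j) y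
    linarith
  choose L hL using hall
  let L' : J →ₗ[ℂ] J :=
    { toFun := L
      map_add' := fun x y => tendsto_nhds_unique (hL (x + y)) (by simpa using (hL x).add (hL y))
      map_smul' := fun a x =>
        tendsto_nhds_unique (hL (a • x)) (by simpa using (hL x).const_smul a) }
  refine ⟨L'.mkContinuous ‖T‖ fun j => ?_, fun p => ?_⟩
  · exact le_of_tendsto (hL j).norm (hb.mono fun e he => he j)
  · ext j
    exact tendsto_nhds_unique (hL _) (hgen p j)

/-- A non-degenerate representation of `P` by multipliers of `J` extends to multipliers of `P`. -/
theorem exists_extension (π : P →⋆ₙₐ[ℂ] 𝓜(ℂ, J)) (hπ : IsNondegenerate π) (T : 𝓜(ℂ, P)) :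
    ∃ S : 𝓜(ℂ, J), ∀ p, S * π p = π (T.fst p) := by
  obtain ⟨L, hL⟩ := exists_extension_fst π hπ T
  obtain ⟨R, hR⟩ := exists_extension_fst π hπ (star T)
  have hL' : ∀ p a, L ((π p).fst a) = (π (T.fst p)).fst a := fun p a =>
    congrArg (fun F : J →L[ℂ] J => F a) (hL p)
  have hR' : ∀ p a, R ((π p).fst a) = (π ((star T).fst p)).fst a := fun p a =>
    congrArg (fun F : J →L[ℂ] J => F a) (hR p)
  let sc : J →L⋆[ℂ] J := (starL ℂ : J ≃L⋆[ℂ] J).toContinuousLinearMap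
  have hgen : ∀ p q a b, star (R ((π q).fst b)) * (π p).fst a
      = star ((π q).fst b) * L ((π p).fst a) := by
    intro p q a b
    rw [hL', hR', star_fst_mul, star_fst_mul]
    have h1 : ∀ u v : P, (star (π u)).fst ((π v).fst a) = (π (star u * v)).fst a := by
      intro u v
      rw [map_mul, map_star]
      rfl
    rw [h1, h1, star_fst_mul, star_star]
  have hcen : ∀ x y, star (R x) * y = star x * L y := by
    intro x y
    have e1 : ∀ q b, ∀ y, star (R ((π q).fst b)) * y = star ((π q).fst b) * L y := by
      intro q b y
      have := ContinuousLinearMap.ext_on (R₁ := ℂ) hπ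
        (f := ContinuousLinearMap.mul ℂ J (star (R ((π q).fst b))))
        (g := (ContinuousLinearMap.mul ℂ J (star ((π q).fst b))) ∘L L)
        (by rintro _ ⟨p, a, rfl⟩; exact hgen p q a b)
      exact congrArg (fun F : J →L[ℂ] J => F y) this
    have e2 : ∀ x, star y * R x = star (L y) * x := by
      intro x
      have := ContinuousLinearMap.ext_on (R₁ := ℂ) hπ
        (f := (ContinuousLinearMap.mul ℂ J (star y)) ∘L R)
        (g := ContinuousLinearMap.mul ℂ J (star (L y)))
        (by
          rintro _ ⟨q, b, rfl⟩
          have := congrArg star (e1 q b y)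
          simpa using this)
      exact congrArg (fun F : J →L[ℂ] J => F x) this
    have := congrArg star (e2 x)
    simpa using this
  refine ⟨⟨(L, (sc.comp R).comp sc), fun x y => ?_⟩, fun p => ?_⟩
  · have := hcen (star x) y
    simpa [sc] using this
  · exact eq_of_fst_eq (hL p)

theorem extension_unique (π : P →⋆ₙₐ[ℂ] 𝓜(ℂ, J)) (hπ : IsNondegenerate π) {S S' : 𝓜(ℂ, J)}
    (h : ∀ p, S * π p = S' * π p) : S = S' := by
  refine eq_of_fst_eq (ContinuousLinearMap.ext_on hπ ?_)
  rintro _ ⟨b, a, rfl⟩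
  exact congrArg (fun F : 𝓜(ℂ, J) => F.fst a) (h b)

/-- The canonical extension `M(P) → M(J)` of a non-degenerate representation `π : P → M(J)`:
the image `S` of a multiplier `T` of `P` is the only multiplier of `J` such that
`S π(p) = π(T p)` for all `p` in `P`. -/
def extend (π : P →⋆ₙₐ[ℂ] 𝓜(ℂ, J)) (hπ : IsNondegenerate π) (T : 𝓜(ℂ, P)) : 𝓜(ℂ, J) :=
  (exists_extension π hπ T).choose

theorem extend_mul (π : P →⋆ₙₐ[ℂ] 𝓜(ℂ, J)) (hπ : IsNondegenerate π) (T : 𝓜(ℂ, P)) (p : P) :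
    extend π hπ T * π p = π (T.fst p) :=
  (exists_extension π hπ T).choose_spec p

end Extension

/-! ### Graded `G`-algebras -/

section Graded

/-- The structure of a graded `G`-`C*`-algebra on a `C*`-algebra `A`: a `ℤ/2`-grading, given by a
`*`-automorphism of order two (`a` has degree `0` if it is fixed and degree `1` if it is sent to
`-a`), and an action of `G` by `*`-automorphisms of degree `0`, continuous in the sense that
`g ↦ g(a)` is norm continuous for every `a`. -/
class GradedGAlgebra (G A : Type*) [Group G] [TopologicalSpace G] [NonUnitalCStarAlgebra A] where
  grading : A ≃⋆ₐ[ℂ] A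
  grading_grading : ∀ a, grading (grading a) = a
  act : G →* (A ≃⋆ₐ[ℂ] A)
  act_grading : ∀ g a, act g (grading a) = grading (act g a)
  continuous_act : ∀ a, Continuous fun g => act g a

variable (G : Type*) {A : Type*} [Group G] [TopologicalSpace G] [NonUnitalCStarAlgebra A]
  [GradedGAlgebra G A]

/-- The grading automorphism of the multiplier algebra. -/
def mGrading (T : 𝓜(ℂ, A)) : 𝓜(ℂ, A) := mulExt (GradedGAlgebra.grading G) T

/-- The component of degree `0` of a multiplier. -/
def evenPart (T : 𝓜(ℂ, A)) : 𝓜(ℂ, A) := (1 / 2 : ℂ) • (T + mGrading G T)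

/-- The component of degree `1` of a multiplier. -/
def oddPart (T : 𝓜(ℂ, A)) : 𝓜(ℂ, A) := (1 / 2 : ℂ) • (T - mGrading G T)

/-- The graded commutator: the bilinear extension of `[x, y] = x y - (-1) ^ (deg x * deg y) y x`
from homogeneous elements. -/
def gComm (x y : 𝓜(ℂ, A)) : 𝓜(ℂ, A) :=
  x * y - (evenPart G y * evenPart G x + evenPart G y * oddPart G x + oddPart G y * evenPart G x
    - oddPart G y * oddPart G x)

variable {G}

/-- The action of `G` on the multiplier algebra. -/
def mAct (g : G) (T : 𝓜(ℂ, A)) : 𝓜(ℂ, A) := mulExt (GradedGAlgebra.act g) T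

variable (G) in
/-- A non-degenerate `G`-equivariant (degree-preserving) representation of the graded
`G`-`C*`-algebra `P` on `J`. -/
structure GRep (P J : Type*) [NonUnitalCStarAlgebra P] [NonUnitalCStarAlgebra J]
    [GradedGAlgebra G P] [GradedGAlgebra G J] where
  hom : P →⋆ₙₐ[ℂ] 𝓜(ℂ, J)
  nondegenerate : IsNondegenerate hom
  equivariant : ∀ (g : G) (p : P), hom (GradedGAlgebra.act g p) = mAct g (hom p)
  graded : ∀ p : P, hom (GradedGAlgebra.grading G p) = mGrading G (hom p)

end Graded

/-! ### Functions on the `G`-space `E` and proper algebras -/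

section Proper

variable {G E : Type*} [Group G] [TopologicalSpace G] [TopologicalSpace E] [MulAction G E]
  [ContinuousConstSMul G E]

/-- The translate `g(φ)` of `φ ∈ C₀(E)`, with `g(φ)(x) = φ(g⁻¹ x)`. -/
def translate (g : G) (φ : C₀(E, ℂ)) : C₀(E, ℂ) :=
  φ.comp (Homeomorph.smul g⁻¹).toCocompactMap

variable (G E) in
/-- The structure of a proper `G`-`C*`-algebra (over the proper `G`-space `E`) on `P`: a
non-degenerate `G`-equivariant `*`-homomorphism from `C₀(E)` (with the trivial grading) to the
center of `M(P)`. -/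
structure ProperAlgebra (P : Type*) [NonUnitalCStarAlgebra P] [GradedGAlgebra G P] where
  hom : C₀(E, ℂ) →⋆ₙₐ[ℂ] 𝓜(ℂ, P)
  central : ∀ φ, hom φ ∈ Set.center 𝓜(ℂ, P)
  nondegenerate : IsNondegenerate hom
  equivariant : ∀ (g : G) φ, hom (translate g φ) = mAct g (hom φ)
  graded : ∀ φ, mGrading G (hom φ) = hom φ

/-- A real-valued continuous function with compact support, as an element of `C₀(E)`. -/
def toC₀ (c : C(E, ℝ)) (hc : HasCompactSupport c) : C₀(E, ℂ) where
  toFun x := (c x : ℂ)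
  continuous_toFun := Complex.continuous_ofReal.comp c.continuous
  zero_at_infty' := by
    have h : HasCompactSupport fun x => (c x : ℂ) :=
      hc.comp_left (g := fun r : ℝ => (r : ℂ)) Complex.ofReal_zero
    exact h.is_zero_at_infty

/-- A cut-off function on the `G`-space `E`, with respect to the Haar measure `μ`: a continuous,
non-negative, compactly supported function `c` with `∫ g(c)² dμ(g) = 1`. -/
structure IsCutoff [MeasurableSpace G] (μ : Measure G) (c : C(E, ℝ)) : Prop where
  compactSupport : HasCompactSupport c
  nonneg : ∀ x, 0 ≤ c x
  integral_eq_one : ∀ x, ∫ g : G, c (g⁻¹ • x) ^ 2 ∂μ = 1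

/-- The representation of `C₀(E)` on `J` coming from a representation of the proper algebra `P`:
the composition `C₀(E) → M(P) → M(J)`. -/
def funRep {P J : Type*} [NonUnitalCStarAlgebra P] [NonUnitalCStarAlgebra J]
    [GradedGAlgebra G P] [GradedGAlgebra G J] (Φ : ProperAlgebra G E P) (π : GRep G P J)
    (φ : C₀(E, ℂ)) : 𝓜(ℂ, J) :=
  extend π.hom π.nondegenerate (Φ.hom φ)

end Proper

/-! ### Functions on `G` with values in the multiplier algebra -/

section Functions

variable {G J : Type*} [TopologicalSpace G] [NonUnitalCStarAlgebra J]

/-- The multiplier-valued function `f` on `G` belongs to `C₀(G, J)`. -/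
def MemC₀ (f : G → 𝓜(ℂ, J)) : Prop :=
  ∃ F : C₀(G, J), ∀ g, f g = (F g : 𝓜(ℂ, J))

/-- `∫ f dμ = I` in the strict topology of `M(J)`: the (norm convergent) integrals of `f` over the
compact subsets of `G`, ordered by inclusion, converge strictly to `I`. -/
def HasStrictIntegral [MeasurableSpace G] (μ : Measure G) (f : G → 𝓜(ℂ, J)) (I : 𝓜(ℂ, J)) :
    Prop :=
  (∀ K : TopologicalSpace.Compacts G, IntegrableOn f K μ) ∧
  ∀ j : J,
    Tendsto (fun K : TopologicalSpace.Compacts G => (∫ g in K, f g ∂μ).fst j) atTop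
      (𝓝 (I.fst j)) ∧
    Tendsto (fun K : TopologicalSpace.Compacts G => (∫ g in K, f g ∂μ).snd j) atTop
      (𝓝 (I.snd j))

end Functions

end

end TechThm

open TechThm

namespace TechThm

/-! ### Averages of almost orthogonal sequences -/

/-! Only `M₂` has to be built; call it M and put `M₁ = 1 - M`. It is a strict sum M = ∑ Dₙ* aₙ Dₙ.
The aₙ are even positive contractions in the image of P that form an approximate unit of A₁, almost
G-invariant on compact sets and almost commuting with a sequence dense in Δ
(`exists_quasicentral_properUnit`). The Dₙ are even elements of J with ∑ Dₙ* Dₙ = 1 strictly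
(`exists_strict_partition`, `hasStrictSum_star_mul_self`), so 1 - M = ∑ Dₙ* (1 - aₙ) Dₙ. In each of
the properties 1 to 6 the expression in question is a strict sum whose terms lie in J, or in C₀(G,
J), because Dₙ does. It therefore suffices that the n-th term is O(2⁻ⁿ), uniformly in g where g
varies: the sum then converges in norm (`HasStrictSum.mem_inIdeal_of_eventually_le`,
`MemC₀.of_hasStrictSum`). For example M b ∈ J for b ∈ A₂, because Dₙ almost commutes with aₙ and
almost annihilates aₙ b ∈ J; and (1 - M) x ∈ J for x ∈ A₁, because Dₙ almost commutes with x while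
aₙ x is close to x. `exists_quasicentral_multiplier` collects these estimates.

The partition of unity is Dₙ = sin(π uₙ/2) rₙ with rₙ₊₁ = cos(π uₙ/2) rₙ, so |Dₙ|² = |rₙ|² - |rₙ₊₁|²
telescopes. Sine and cosine are entire, hence a commutator with sin(π u/2) or cos(π u/2) is bounded
by a constant times the commutator with u. No square roots of differences occur.

Almost invariance and almost commutation come from averaging. If yᵢ yⱼ* is small for j much larger
than i, then a sum of m suitably chosen terms has norm of order √m, so their mean is small,
uniformly over a parameter set. Applied to the twisted commutators α(wᵢ) y - y wᵢ of an approximate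
unit, this handles invariance (y = 1) and commutators (α = id) together.

Since G need not be compact, commutators with all translates g(φ) must be controlled at once. The
approximate unit of J is compressed by compactly supported functions on E; by properness it then
commutes exactly with g(φ) for g outside a compact set, and averaging takes care of the compact set
(`exists_localized_unit`). Thus the commutators are bounded by 2⁻ⁿ l(g) with an integrable weight l.
This also gives property 7: g(c) M g(c) = g(c)² M + g(c) [M, g(c)], where the first summand
integrates strictly to M and the second is norm integrable with values in J
(`exists_hasStrictIntegral`). -/

theorem exists_average_norm_le {B S : Type*} [NonUnitalNormedRing B] [StarRing B] [CStarRing B]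
    (y : ℕ → S → B) (C : ℝ) (hC : ∀ i s, ‖y i s‖ ≤ C)
    (h : ∀ i, ∀ ε > 0, ∃ N, ∀ j ≥ N, ∀ s, ‖y i s * star (y j s)‖ ≤ ε) (n₀ : ℕ) {ε : ℝ}
    (hε : 0 < ε) :
    ∃ m : ℕ, 0 < m ∧ ∃ k : ℕ → ℕ, (∀ i, n₀ ≤ k i) ∧
      ∀ s, ‖∑ i ∈ Finset.range m, y (k i) s‖ ≤ ε * m := by
  have hδ : 0 < ε ^ 2 / 2 := by positivity
  -- Each new index is taken beyond the thresholds of all the earlier ones.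
  obtain ⟨k, hk₀, hk⟩ := exists_seq_of_forall_finset_exists (fun i => n₀ ≤ i)
    (fun i j => ∀ s, ‖y i s * star (y j s)‖ ≤ ε ^ 2 / 2) (fun F _ => by
      choose N hN using fun i => h i _ hδ
      refine ⟨max n₀ (F.sup N), le_max_left _ _, fun i hi s => hN i _ ?_ s⟩
      exact (Finset.le_sup hi).trans (le_max_right _ _))
  obtain ⟨m, hm⟩ := exists_nat_gt (C ^ 2 / (ε ^ 2 / 2))
  have hm0 : 0 < m := by
    have : (0 : ℝ) < m := lt_of_le_of_lt (by positivity) hm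
    exact_mod_cast this
  refine ⟨m, hm0, k, hk₀, fun s => ?_⟩
  have hC2 : C ^ 2 ≤ m * (ε ^ 2 / 2) := by
    rw [div_lt_iff₀ hδ] at hm
    exact hm.le
  have hentry : ∀ i j, ‖y (k i) s * star (y (k j) s)‖ ≤
      ε ^ 2 / 2 + if i = j then C ^ 2 else 0 := by
    intro i j
    rcases lt_trichotomy i j with hij | hij | hij
    · simpa [hij.ne] using hk i j hij s
    · subst hij
      rw [CStarRing.norm_self_mul_star, if_pos rfl]
      nlinarith [norm_nonneg (y (k i) s), hC (k i) s]
    · have := hk j i hij s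
      rw [← norm_star, star_mul, star_star]
      simpa [hij.ne'] using this
  -- By the C*-identity this is the norm of a double sum: the off-diagonal terms contribute at most
  -- m² ε²/2, and the m diagonal ones at most m C², which the choice of m bounds by the same number.
  have h2 : ‖∑ i ∈ Finset.range m, y (k i) s‖ ^ 2 ≤ (ε * m) ^ 2 := by
    rw [sq, ← CStarRing.norm_self_mul_star, star_sum, Finset.sum_mul_sum]
    calc _ ≤ ∑ i ∈ Finset.range m, ∑ j ∈ Finset.range m,
          (ε ^ 2 / 2 + if i = j then C ^ 2 else 0) :=
        (norm_sum_le _ _).trans (Finset.sum_le_sum fun i _ =>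
          (norm_sum_le _ _).trans (Finset.sum_le_sum fun j _ => hentry i j))
      _ = m * (m * (ε ^ 2 / 2)) + m * C ^ 2 := by
        have : ∀ i ∈ Finset.range m, ∑ j ∈ Finset.range m,
            (ε ^ 2 / 2 + if i = j then C ^ 2 else 0) = m * (ε ^ 2 / 2) + C ^ 2 := by
          intro i hi
          rw [Finset.sum_add_distrib, Finset.sum_ite_eq, if_pos hi]
          simp
        rw [Finset.sum_congr rfl this]
        simp
      _ ≤ m * (m * (ε ^ 2 / 2)) + m * (m * (ε ^ 2 / 2)) := by gcongr
      _ = (ε * m) ^ 2 := by ring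
  exact le_of_sq_le_sq h2 (by positivity)

/-! ### The sine and the cosine of a self-adjoint contraction -/

section Trig

variable {M : Type*} [CStarAlgebra M]

/-- The factor `(2 * R) ^ n` is crude, but it closes the induction and still sums to an exponential.
Two elements `a` and `b` are needed because later `a` is the image of `b` under an automorphism, or
`b` is 1. -/
theorem norm_pow_mul_sub_mul_pow_le (a b y : M) {R : ℝ} (hR : 1 ≤ R) (ha : ‖a‖ ≤ R)
    (hb : ‖b‖ ≤ R) (n : ℕ) :
    ‖a ^ n * y - y * b ^ n‖ ≤ (2 * R) ^ n * ‖a * y - y * b‖ := by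
  rcases subsingleton_or_nontrivial M with hM | hM
  · simp [Subsingleton.elim (a ^ n * y - y * b ^ n) 0, Subsingleton.elim (a * y - y * b) 0]
  have := CStarRing.norm_one (E := M)
  induction n with
  | zero => simp
  | succ n ih =>
    have h : a ^ (n + 1) * y - y * b ^ (n + 1)
        = a * (a ^ n * y - y * b ^ n) + (a * y - y * b) * b ^ n := by
      rw [pow_succ' a, pow_succ' b]; noncomm_ring
    have hbn : ‖b ^ n‖ ≤ R ^ n := (norm_pow_le _ _).trans (pow_le_pow_left₀ (norm_nonneg _) hb _)
    have hR2 : R ^ n ≤ R * (2 * R) ^ n := by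
      rw [mul_pow]
      have h1 : (1 : ℝ) ≤ 2 ^ n := one_le_pow₀ (by norm_num)
      have h2 : 0 < R ^ n := by positivity
      nlinarith [mul_le_mul hR h1 zero_le_one (by linarith)]
    calc _ ≤ ‖a‖ * ‖a ^ n * y - y * b ^ n‖ + ‖a * y - y * b‖ * ‖b ^ n‖ := by
          rw [h]
          exact (norm_add_le _ _).trans (add_le_add (norm_mul_le _ _) (norm_mul_le _ _))
      _ ≤ R * ((2 * R) ^ n * ‖a * y - y * b‖) + ‖a * y - y * b‖ * (R * (2 * R) ^ n) := by
          gcongr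
          exact hbn.trans hR2
      _ = _ := by ring

theorem norm_exp_mul_sub_mul_exp_le (a b y : M) {R : ℝ} (hR : 1 ≤ R) (ha : ‖a‖ ≤ R)
    (hb : ‖b‖ ≤ R) :
    ‖NormedSpace.exp a * y - y * NormedSpace.exp b‖
      ≤ Real.exp (2 * R) * ‖a * y - y * b‖ := by
  have h1 := ((NormedSpace.exp_series_hasSum_exp' (𝕂 := ℂ) a).mul_right y).sub
    ((NormedSpace.exp_series_hasSum_exp' (𝕂 := ℂ) b).mul_left y)
  have h2 := (NormedSpace.exp_series_hasSum_exp' (𝕂 := ℝ) (2 * R)).mul_right ‖a * y - y * b‖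
  rw [← Real.exp_eq_exp_ℝ] at h2
  rw [← h1.tsum_eq]
  refine tsum_of_norm_bounded h2 fun n => ?_
  rw [smul_mul_assoc, mul_smul_comm, ← smul_sub, norm_smul, smul_eq_mul, mul_assoc]
  simp only [norm_inv, Complex.norm_natCast]
  gcongr
  exact norm_pow_mul_sub_mul_pow_le a b y hR ha hb n

/-- Without its constant term, every term of the exponential series has a factor `a` on the right.
-/
theorem exp_sub_one_mem {V : Submodule ℂ M} (hV : IsClosed (V : Set M))
    (hmul : ∀ x, ∀ v ∈ V, x * v ∈ V) {a : M} (ha : a ∈ V) : NormedSpace.exp a - 1 ∈ V := by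
  have h := NormedSpace.exp_series_hasSum_exp' (𝕂 := ℂ) a
  rw [hasSum_nat_add_iff' 1 |>.symm] at h
  simp only [Finset.range_one, Finset.sum_singleton, Nat.factorial_zero, pow_zero] at h
  norm_num at h
  refine hV.mem_of_tendsto h (Eventually.of_forall fun F => V.sum_mem fun n _ => ?_)
  rw [pow_succ]
  exact V.smul_mem _ (hmul _ _ ha)

/-- `exp (i π u / 2)`. -/
noncomputable def quarterExp (u : M) : M := NormedSpace.exp ((Real.pi / 2 * Complex.I : ℂ) • u)

/-- `cos (π u / 2)`. -/
noncomputable def quarterCos (u : M) : M := (1 / 2 : ℂ) • (quarterExp u + quarterExp (-u))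

/-- `sin (π u / 2)`. -/
noncomputable def quarterSin (u : M) : M :=
  (-Complex.I / 2 : ℂ) • (quarterExp u - quarterExp (-u))

theorem star_quarterExp {u : M} (hu : IsSelfAdjoint u) : star (quarterExp u) = quarterExp (-u) := by
  rw [quarterExp, NormedSpace.star_exp, star_smul, hu.star_eq, quarterExp]
  congr 1
  simp

theorem quarterExp_mul_neg (u : M) : quarterExp u * quarterExp (-u) = 1 := by
  let _ : NormedAlgebra ℚ M := NormedAlgebra.restrictScalars ℚ ℂ M
  rw [quarterExp, quarterExp, ← NormedSpace.exp_add_of_commute, smul_neg, add_neg_cancel,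
    NormedSpace.exp_zero]
  rw [smul_neg]
  exact (Commute.refl _).neg_right

theorem isSelfAdjoint_quarterCos {u : M} (hu : IsSelfAdjoint u) :
    IsSelfAdjoint (quarterCos u) := by
  rw [IsSelfAdjoint, quarterCos, star_smul, star_add, star_quarterExp hu, star_quarterExp hu.neg,
    neg_neg, add_comm]
  simp

theorem isSelfAdjoint_quarterSin {u : M} (hu : IsSelfAdjoint u) :
    IsSelfAdjoint (quarterSin u) := by
  rw [IsSelfAdjoint, quarterSin, star_smul, star_sub, star_quarterExp hu, star_quarterExp hu.neg,
    neg_neg, ← neg_sub, smul_neg, ← neg_smul]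
  congr 1
  simp [neg_div]

theorem quarterSin_sq_add_quarterCos_sq (u : M) :
    quarterSin u * quarterSin u + quarterCos u * quarterCos u = 1 := by
  have h1 := quarterExp_mul_neg u
  have h2 := quarterExp_mul_neg (-u)
  rw [neg_neg] at h2
  simp only [quarterSin, quarterCos, smul_mul_smul_comm, mul_add, mul_sub, add_mul, sub_mul, h1, h2]
  have h3 : (-Complex.I / 2 * (-Complex.I / 2) : ℂ) = -(1 / 2 * (1 / 2)) := by
    ring_nf; norm_num
  rw [h3, neg_smul, ← smul_neg, ← smul_add]
  rw [show -(quarterExp u * quarterExp u - 1 - (1 - quarterExp (-u) * quarterExp (-u))) +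
    (quarterExp u * quarterExp u + 1 + (1 + quarterExp (-u) * quarterExp (-u))) = (4 : ℂ) • 1 by
      rw [show (4 : ℂ) = 1 + 1 + 1 + 1 by norm_num]; simp only [add_smul, one_smul]; abel]
  rw [smul_smul]
  norm_num

theorem map_quarterExp (α : M →⋆ₐ[ℂ] M) (u : M) : α (quarterExp u) = quarterExp (α u) := by
  let _ : NormedAlgebra ℚ M := NormedAlgebra.restrictScalars ℚ ℂ M
  rw [quarterExp, NormedSpace.map_exp α (map_continuous α), map_smul, quarterExp]

theorem map_quarterCos (α : M →⋆ₐ[ℂ] M) (u : M) : α (quarterCos u) = quarterCos (α u) := by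
  simp only [quarterCos, map_smul, map_add, map_quarterExp, map_neg]

theorem map_quarterSin (α : M →⋆ₐ[ℂ] M) (u : M) : α (quarterSin u) = quarterSin (α u) := by
  simp only [quarterSin, map_smul, map_sub, map_quarterExp, map_neg]

theorem norm_quarter_smul_le {u : M} (hu : ‖u‖ ≤ 1) :
    ‖(Real.pi / 2 * Complex.I : ℂ) • u‖ ≤ 2 := by
  rw [norm_smul]
  have : ‖(Real.pi / 2 * Complex.I : ℂ)‖ = Real.pi / 2 := by
    simp [abs_of_pos Real.pi_pos]
  rw [this]
  nlinarith [Real.pi_le_four, norm_nonneg u, Real.pi_pos]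

/-- A bound for the commutators of `sin` and `cos`. -/
noncomputable def trigConst : ℝ := Real.exp 4 * 2

theorem trigConst_pos : 0 < trigConst := by unfold trigConst; positivity

/-- The constant is `exp (2 * R)` with R = 2, which bounds the norm of the exponents, times 2, which
bounds the scalar π/2. -/
theorem norm_quarterExp_mul_sub_le {a b : M} (y : M) (ha : ‖a‖ ≤ 1) (hb : ‖b‖ ≤ 1) :
    ‖quarterExp a * y - y * quarterExp b‖ ≤ trigConst * ‖a * y - y * b‖ := by
  have h := norm_exp_mul_sub_mul_exp_le _ _ y (one_le_two) (norm_quarter_smul_le ha)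
    (norm_quarter_smul_le hb)
  refine h.trans ?_
  rw [smul_mul_assoc, mul_smul_comm, ← smul_sub, norm_smul, trigConst, mul_assoc]
  have : ‖(Real.pi / 2 * Complex.I : ℂ)‖ = Real.pi / 2 := by
    simp [abs_of_pos Real.pi_pos]
  rw [this]
  norm_num
  gcongr
  linarith [Real.pi_le_four]

theorem norm_quarterCos_mul_sub_le {a b : M} (y : M) (ha : ‖a‖ ≤ 1) (hb : ‖b‖ ≤ 1) :
    ‖quarterCos a * y - y * quarterCos b‖ ≤ trigConst * ‖a * y - y * b‖ := by
  have h1 := norm_quarterExp_mul_sub_le y ha hb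
  have h2 := norm_quarterExp_mul_sub_le (a := -a) (b := -b) y (by rwa [norm_neg])
    (by rwa [norm_neg])
  rw [show -a * y - y * -b = -(a * y - y * b) by noncomm_ring, norm_neg] at h2
  rw [quarterCos, quarterCos, smul_mul_assoc, mul_smul_comm, ← smul_sub, norm_smul,
    show (quarterExp a + quarterExp (-a)) * y - y * (quarterExp b + quarterExp (-b))
      = (quarterExp a * y - y * quarterExp b) + (quarterExp (-a) * y - y * quarterExp (-b)) by
      noncomm_ring]
  have := norm_add_le (quarterExp a * y - y * quarterExp b)
    (quarterExp (-a) * y - y * quarterExp (-b))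
  norm_num
  linarith

theorem norm_quarterSin_mul_sub_le {a b : M} (y : M) (ha : ‖a‖ ≤ 1) (hb : ‖b‖ ≤ 1) :
    ‖quarterSin a * y - y * quarterSin b‖ ≤ trigConst * ‖a * y - y * b‖ := by
  have h1 := norm_quarterExp_mul_sub_le y ha hb
  have h2 := norm_quarterExp_mul_sub_le (a := -a) (b := -b) y (by rwa [norm_neg])
    (by rwa [norm_neg])
  rw [show -a * y - y * -b = -(a * y - y * b) by noncomm_ring, norm_neg] at h2
  rw [quarterSin, quarterSin, smul_mul_assoc, mul_smul_comm, ← smul_sub, norm_smul,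
    show (quarterExp a - quarterExp (-a)) * y - y * (quarterExp b - quarterExp (-b))
      = (quarterExp a * y - y * quarterExp b) - (quarterExp (-a) * y - y * quarterExp (-b)) by
      noncomm_ring]
  have := norm_sub_le (quarterExp a * y - y * quarterExp b)
    (quarterExp (-a) * y - y * quarterExp (-b))
  norm_num
  linarith

theorem quarterCos_one : quarterCos (1 : M) = 0 := by
  have h : ∀ z : ℂ, NormedSpace.exp (z • (1 : M)) = Complex.exp z • 1 := by
    intro z
    rw [← Algebra.algebraMap_eq_smul_one, ← Algebra.algebraMap_eq_smul_one,
      Complex.exp_eq_exp_ℂ, NormedSpace.algebraMap_exp_comm]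
  rw [quarterCos, quarterExp, quarterExp, smul_neg, ← neg_smul, h, h, ← add_smul,
    ← neg_mul, Complex.exp_pi_div_two_mul_I, show (-(Real.pi / 2 : ℂ) * Complex.I)
      = (-Real.pi / 2 * Complex.I) by ring, Complex.exp_neg_pi_div_two_mul_I]
  simp

/-- Compare `u` with 1 and use cos(π/2) = 0: the cosine almost annihilates whatever `u` almost
fixes. -/
theorem norm_quarterCos_mul_le {u : M} (b : M) (hu : ‖u‖ ≤ 1) :
    ‖quarterCos u * b‖ ≤ trigConst * ‖u * b - b‖ := by
  rcases subsingleton_or_nontrivial M with hM | hM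
  · simp [Subsingleton.elim (quarterCos u * b) 0, Subsingleton.elim (u * b - b) 0]
  simpa [quarterCos_one] using norm_quarterCos_mul_sub_le (b := 1) b hu CStarRing.norm_one.le

theorem norm_le_one_of_star_mul_self_add_eq_one {a b : M} (h : star a * a + star b * b = 1) :
    ‖a‖ ≤ 1 := by
  let _ := CStarAlgebra.spectralOrder M
  have _ := CStarAlgebra.spectralOrderedRing M
  have h1 : star a * a ≤ 1 := by
    rw [← h]
    exact le_add_of_nonneg_right (star_mul_self_nonneg b)
  have h2 := (CStarAlgebra.norm_le_one_iff_of_nonneg _ (star_mul_self_nonneg a)).2 h1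
  rw [CStarRing.norm_star_mul_self] at h2
  nlinarith [norm_nonneg a]

theorem norm_quarterSin_le_one {u : M} (hu : IsSelfAdjoint u) : ‖quarterSin u‖ ≤ 1 := by
  refine norm_le_one_of_star_mul_self_add_eq_one (b := quarterCos u) ?_
  rw [(isSelfAdjoint_quarterSin hu).star_eq, (isSelfAdjoint_quarterCos hu).star_eq,
    quarterSin_sq_add_quarterCos_sq]

theorem norm_quarterCos_le_one {u : M} (hu : IsSelfAdjoint u) : ‖quarterCos u‖ ≤ 1 := by
  refine norm_le_one_of_star_mul_self_add_eq_one (b := quarterSin u) ?_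
  rw [(isSelfAdjoint_quarterSin hu).star_eq, (isSelfAdjoint_quarterCos hu).star_eq, add_comm,
    quarterSin_sq_add_quarterCos_sq]

theorem quarterSin_mem {V : Submodule ℂ M} (hV : IsClosed (V : Set M))
    (hmul : ∀ x, ∀ v ∈ V, x * v ∈ V) {u : M} (hu : u ∈ V) : quarterSin u ∈ V := by
  have h1 := exp_sub_one_mem hV hmul (V.smul_mem (Real.pi / 2 * Complex.I : ℂ) hu)
  have h2 := exp_sub_one_mem hV hmul (V.smul_mem (Real.pi / 2 * Complex.I : ℂ) (V.neg_mem hu))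
  have := V.smul_mem (-Complex.I / 2 : ℂ) (V.sub_mem h1 h2)
  rwa [sub_sub_sub_cancel_right] at this

theorem quarterCos_sub_one_mem {V : Submodule ℂ M} (hV : IsClosed (V : Set M))
    (hmul : ∀ x, ∀ v ∈ V, x * v ∈ V) {u : M} (hu : u ∈ V) : quarterCos u - 1 ∈ V := by
  have h1 := exp_sub_one_mem hV hmul (V.smul_mem (Real.pi / 2 * Complex.I : ℂ) hu)
  have h2 := exp_sub_one_mem hV hmul (V.smul_mem (Real.pi / 2 * Complex.I : ℂ) (V.neg_mem hu))
  have := V.smul_mem (1 / 2 : ℂ) (V.add_mem h1 h2)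
  convert this using 1
  rw [show ∀ x y : M, x - 1 + (y - 1) = (x + y) - (2 : ℂ) • 1 by
    intro x y; rw [two_smul]; abel, smul_sub, smul_smul]
  simp only [quarterCos, quarterExp]
  norm_num

/-- The twisted commutator `α(x) y - y x` with a pair `(α, y)`. -/
def twist (t : (M →⋆ₐ[ℂ] M) × M) (x : M) : M := t.1 x * t.2 - t.2 * x

/-- A twisted Leibniz rule. The pairs (g, 1) measure the failure of invariance and the pairs (id, x)
are commutators, so both are treated at once. -/
theorem twist_mul (t : (M →⋆ₐ[ℂ] M) × M) (x x' : M) :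
    twist t (x * x') = t.1 x * twist t x' + twist t x * x' := by
  simp only [twist, map_mul]
  noncomm_ring

/-- Inductive construction of elements `D n` with `∑ D n* D n = 1` which almost commute with
prescribed elements and almost annihilate other prescribed elements, from a set `U` of
self-adjoint contractions that contains good approximate units. -/
theorem exists_partition_sequence (T : ℕ → Set ((M →⋆ₐ[ℂ] M) × M)) (B : ℕ → Set M) (U R : Set M)
    (hT : Monotone T) (hU : ∀ u ∈ U, IsSelfAdjoint u ∧ ‖u‖ ≤ 1) (hR1 : 1 ∈ R)
    (hR : ∀ u ∈ U, ∀ r ∈ R, quarterCos u * r ∈ R)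
    (H : ∀ n, ∀ r ∈ R, ∀ ε > 0, ∃ u ∈ U,
      (∀ t ∈ T n, ‖twist t u‖ ≤ ε ∧ ‖t.1 u * twist t r - twist t r‖ ≤ ε) ∧
      ∀ b ∈ B n, ‖u * (r * b) - r * b‖ ≤ ε)
    (ε : ℕ → ℝ) (hε : ∀ n, 0 < ε n) :
    ∃ r D u : ℕ → M, (∀ n, r n ∈ R) ∧ (∀ n, u n ∈ U) ∧ (∀ n, D n = quarterSin (u n) * r n) ∧
      r 0 = 1 ∧ (∀ n, ‖r n‖ ≤ 1) ∧ (∀ n, ‖D n‖ ≤ 1) ∧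
      (∀ n, star (D n) * D n = star (r n) * r n - star (r (n + 1)) * r (n + 1)) ∧
      (∀ n, ∀ b ∈ B (n + 1), ‖r (n + 1) * b‖ ≤ ε (n + 1) ∧ ‖D (n + 1) * b‖ ≤ ε (n + 1)) ∧
      ∀ n, ∀ t ∈ T n, ‖twist t (D n)‖ ≤ ε n := by
  set C := trigConst with hC
  have hC0 : 0 < C := trigConst_pos
  -- The twist of D (n+1) is at most 2 C η n + C η (n+1): two units from r (n+1), chosen at stage n,
  -- and one from the sine at stage n+1. Hence the 3, and the minimum of two consecutive tolerances.
  let η : ℕ → ℝ := fun n => min (ε n) (ε (n + 1)) / (3 * C)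
  have hη : ∀ n, 0 < η n := fun n => div_pos (lt_min (hε _) (hε _)) (by positivity)
  have hη1 : ∀ n, 3 * (C * η n) ≤ ε n := fun n => by
    have : 3 * (C * η n) = min (ε n) (ε (n + 1)) := by simp only [η]; field_simp
    exact this.le.trans (min_le_left _ _)
  have hη2 : ∀ n, 3 * (C * η n) ≤ ε (n + 1) := fun n => by
    have : 3 * (C * η n) = min (ε n) (ε (n + 1)) := by simp only [η]; field_simp
    exact this.le.trans (min_le_right _ _)
  choose! f hfU hfT hfB using H
  -- Stage n already works with `T (n + 1)` and `B (n + 1)`, because it produces `r (n + 1)`, which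
  -- enters `D (n + 1)`. So `B 0` is never controlled.
  let u' : ℕ → M → M := fun n r => f (n + 1) r (η n)
  let r : ℕ → M := fun n => Nat.rec 1 (fun n r => quarterCos (u' n r) * r) n
  let u : ℕ → M := fun n => u' n (r n)
  have hrs : ∀ n, r (n + 1) = quarterCos (u n) * r n := fun n => rfl
  have hrR : ∀ n, r n ∈ R := fun n => by
    induction n with
    | zero => exact hR1
    | succ n ih => exact hR _ (hfU _ _ ih _ (hη n)) _ ih
  have huU : ∀ n, u n ∈ U := fun n => hfU _ _ (hrR n) _ (hη n)
  have husa := fun n => (hU _ (huU n)).1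
  have hu1 := fun n => (hU _ (huU n)).2
  have hq1 := fun n => norm_quarterCos_le_one (husa n)
  have hp1 := fun n => norm_quarterSin_le_one (husa n)
  have hr1 : ∀ n, ‖r n‖ ≤ 1 := fun n => by
    induction n with
    | zero =>
      rcases subsingleton_or_nontrivial M with hM | hM
      · simp [Subsingleton.elim (r 0) 0]
      · exact CStarRing.norm_one.le
    | succ n ih => exact (norm_mul_le _ _).trans (mul_le_one₀ (hq1 n) (norm_nonneg _) ih)
  have huT : ∀ n, ∀ t ∈ T (n + 1), ‖twist t (u n)‖ ≤ η n := fun n t ht =>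
    (hfT (n + 1) (r n) (hrR n) _ (hη n) t ht).1
  have hurT : ∀ n, ∀ t ∈ T (n + 1), ‖t.1 (u n) * twist t (r n) - twist t (r n)‖ ≤ η n :=
    fun n t ht => (hfT (n + 1) (r n) (hrR n) _ (hη n) t ht).2
  have hα1 : ∀ n, ∀ t : (M →⋆ₐ[ℂ] M) × M, ‖t.1 (u n)‖ ≤ 1 := fun n t =>
    (NonUnitalStarAlgHom.norm_apply_le t.1 _).trans (hu1 n)
  have hpT : ∀ n, ∀ t ∈ T (n + 1), ‖twist t (quarterSin (u n))‖ ≤ C * η n := fun n t ht => by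
    rw [twist, map_quarterSin]
    exact (norm_quarterSin_mul_sub_le _ (hα1 n t) (hu1 n)).trans
      (mul_le_mul_of_nonneg_left (huT n t ht) hC0.le)
  have hqT : ∀ n, ∀ t ∈ T (n + 1), ‖twist t (quarterCos (u n))‖ ≤ C * η n := fun n t ht => by
    rw [twist, map_quarterCos]
    exact (norm_quarterCos_mul_sub_le _ (hα1 n t) (hu1 n)).trans
      (mul_le_mul_of_nonneg_left (huT n t ht) hC0.le)
  -- Errors do not accumulate along the product: the new factor cos(π α(uₙ)/2) almost annihilates
  -- the old twist of `r n`, since `α (u n)` was chosen to act on it almost as a unit.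
  have hrT : ∀ n, ∀ t ∈ T (n + 1), ‖twist t (r (n + 1))‖ ≤ 2 * (C * η n) := fun n t ht => by
    rw [hrs, twist_mul, map_quarterCos]
    have h1 : ‖quarterCos (t.1 (u n)) * twist t (r n)‖ ≤ C * η n :=
      (norm_quarterCos_mul_le _ (hα1 n t)).trans
        (mul_le_mul_of_nonneg_left (hurT n t ht) hC0.le)
    have h2 : ‖twist t (quarterCos (u n)) * r n‖ ≤ C * η n := by
      refine (norm_mul_le _ _).trans ?_
      calc _ ≤ (C * η n) * 1 := by
            gcongr
            · exact mul_nonneg hC0.le (hη n).le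
            · exact hqT n t ht
            · exact hr1 n
        _ = _ := mul_one _
    linarith [norm_add_le (quarterCos (t.1 (u n)) * twist t (r n))
      (twist t (quarterCos (u n)) * r n)]
  have hrB : ∀ n, ∀ b ∈ B (n + 1), ‖r (n + 1) * b‖ ≤ ε (n + 1) := fun n b hb => by
    rw [hrs, mul_assoc]
    have h1 := (norm_quarterCos_mul_le (r n * b) (hu1 n)).trans
        (mul_le_mul_of_nonneg_left (hfB (n + 1) (r n) (hrR n) _ (hη n) b hb) hC0.le)
    have h2 := hη2 n
    have h3 : 0 < C * η n := mul_pos hC0 (hη n)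
    exact h1.trans (by linarith)
  refine ⟨r, fun n => quarterSin (u n) * r n, u, hrR, huU, fun n => rfl, rfl, hr1, fun n =>
    (norm_mul_le _ _).trans (mul_le_one₀ (hp1 n) (norm_nonneg _) (hr1 n)), fun n => ?_,
    fun n b hb => ⟨hrB n b hb, ?_⟩, fun n t ht => ?_⟩
  · have h := quarterSin_sq_add_quarterCos_sq (u n)
    rw [eq_sub_iff_add_eq, hrs]
    simp only [star_mul, (isSelfAdjoint_quarterSin (husa n)).star_eq,
      (isSelfAdjoint_quarterCos (husa n)).star_eq]
    calc _ = star (r n) * (quarterSin (u n) * quarterSin (u n)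
          + quarterCos (u n) * quarterCos (u n)) * r n := by noncomm_ring
      _ = _ := by rw [h, mul_one]
  · rw [mul_assoc]
    refine (norm_mul_le _ _).trans ?_
    calc _ ≤ 1 * ‖r (n + 1) * b‖ := by gcongr; exact hp1 _
      _ ≤ _ := by rw [one_mul]; exact hrB n b hb
  · cases n with
    | zero =>
      have h0 : r 0 = 1 := rfl
      have h := hpT 0 t (hT (Nat.zero_le 1) ht)
      have h3 : 0 < C * η 0 := mul_pos hC0 (hη 0)
      have h4 := hη1 0
      change ‖twist t (quarterSin (u 0) * r 0)‖ ≤ ε 0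
      rw [h0, mul_one]
      exact h.trans (by linarith)
    | succ n =>
      change ‖twist t (quarterSin (u (n + 1)) * r (n + 1))‖ ≤ ε (n + 1)
      rw [twist_mul]
      have h1 : ‖t.1 (quarterSin (u (n + 1))) * twist t (r (n + 1))‖ ≤ 2 * (C * η n) := by
        refine (norm_mul_le _ _).trans ?_
        calc _ ≤ 1 * ‖twist t (r (n + 1))‖ := by
              gcongr
              exact (NonUnitalStarAlgHom.norm_apply_le t.1 _).trans (hp1 _)
          _ ≤ _ := by rw [one_mul]; exact hrT n t ht
      have h2 : ‖twist t (quarterSin (u (n + 1))) * r (n + 1)‖ ≤ C * η (n + 1) := by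
        refine (norm_mul_le _ _).trans ?_
        calc _ ≤ (C * η (n + 1)) * 1 := by
              gcongr
              · exact mul_nonneg hC0.le (hη _).le
              · exact hpT _ t (hT (Nat.le_succ _) ht)
              · exact hr1 (n + 1)
          _ = _ := mul_one _
      have h3 := hη1 (n + 1)
      have h4 := hη2 n
      exact (norm_add_le _ _).trans (by linarith)

end Trig

/-! ### A `C*`-algebra as an ideal of its multiplier algebra -/

section Ideal

variable {J : Type*} [NonUnitalCStarAlgebra J]

theorem mul_coe (T : 𝓜(ℂ, J)) (a : J) : T * (a : 𝓜(ℂ, J)) = (T.fst a : J) := by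
  refine eq_of_fst_eq (ContinuousLinearMap.ext fun b => ?_)
  simp [fst_mul]

theorem coe_coe_mul (a b : J) : (a : 𝓜(ℂ, J)) * (b : 𝓜(ℂ, J)) = ((a * b : J) : 𝓜(ℂ, J)) :=
  (map_mul (DoubleCentralizer.coeHom (𝕜 := ℂ) (A := J)) a b).symm

theorem coe_star (a : J) : ((star a : J) : 𝓜(ℂ, J)) = star (a : 𝓜(ℂ, J)) :=
  map_star (DoubleCentralizer.coeHom (𝕜 := ℂ) (A := J)) a

theorem coe_sub (a b : J) : ((a - b : J) : 𝓜(ℂ, J)) = (a : 𝓜(ℂ, J)) - (b : 𝓜(ℂ, J)) :=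
  map_sub (DoubleCentralizer.coeHom (𝕜 := ℂ) (A := J)) a b

theorem coe_mul (T : 𝓜(ℂ, J)) (a : J) : (a : 𝓜(ℂ, J)) * T = (T.snd a : J) := by
  have h := congrArg star (mul_coe (star T) (star a))
  rw [coe_star, star_mul, star_star, star_star, ← coe_star, DoubleCentralizer.star_fst] at h
  simpa using h

theorem norm_coe (a : J) : ‖(a : 𝓜(ℂ, J))‖ = ‖a‖ := by
  rw [← DoubleCentralizer.norm_fst, DoubleCentralizer.coe_fst, ContinuousLinearMap.opNorm_mul_apply]

theorem isometry_coe : Isometry (fun a : J => (a : 𝓜(ℂ, J))) :=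
  Isometry.of_dist_eq fun a b => by rw [dist_eq_norm, dist_eq_norm, ← coe_sub, norm_coe]

variable (J) in
/-- The algebra `J` as a subspace of `M(J)`. -/
noncomputable def idealSubmodule : Submodule ℂ 𝓜(ℂ, J) :=
  LinearMap.range ((DoubleCentralizer.coeHom (𝕜 := ℂ) (A := J) : J →ₗ[ℂ] 𝓜(ℂ, J)))

theorem coe_mem_inIdeal (a : J) : (a : 𝓜(ℂ, J)) ∈ inIdeal J := ⟨a, rfl⟩

theorem isClosed_inIdeal : IsClosed (inIdeal J) := isometry_coe.isClosedEmbedding.isClosed_range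

theorem inIdeal_mul_left (T : 𝓜(ℂ, J)) {x : 𝓜(ℂ, J)} (hx : x ∈ inIdeal J) :
    T * x ∈ inIdeal J := by
  obtain ⟨a, rfl⟩ := hx
  exact ⟨_, (mul_coe T a).symm⟩

theorem inIdeal_mul_right {x : 𝓜(ℂ, J)} (hx : x ∈ inIdeal J) (T : 𝓜(ℂ, J)) :
    x * T ∈ inIdeal J := by
  obtain ⟨a, rfl⟩ := hx
  exact ⟨_, (coe_mul T a).symm⟩

theorem inIdeal_star {x : 𝓜(ℂ, J)} (hx : x ∈ inIdeal J) : star x ∈ inIdeal J := by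
  obtain ⟨a, rfl⟩ := hx
  exact ⟨_, coe_star a⟩

theorem inIdeal_add {x y : 𝓜(ℂ, J)} (hx : x ∈ inIdeal J) (hy : y ∈ inIdeal J) :
    x + y ∈ inIdeal J := (idealSubmodule J).add_mem hx hy

theorem inIdeal_sub {x y : 𝓜(ℂ, J)} (hx : x ∈ inIdeal J) (hy : y ∈ inIdeal J) :
    x - y ∈ inIdeal J := (idealSubmodule J).sub_mem hx hy

theorem inIdeal_neg {x : 𝓜(ℂ, J)} (hx : x ∈ inIdeal J) : -x ∈ inIdeal J :=
  (idealSubmodule J).neg_mem hx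

theorem inIdeal_zero : (0 : 𝓜(ℂ, J)) ∈ inIdeal J := (idealSubmodule J).zero_mem

theorem eq_of_mul_coe_eq {S T : 𝓜(ℂ, J)}
    (h : ∀ j : J, S * (j : 𝓜(ℂ, J)) = T * (j : 𝓜(ℂ, J))) : S = T := by
  refine eq_of_fst_eq (ContinuousLinearMap.ext fun j => ?_)
  have := h j
  rw [mul_coe, mul_coe] at this
  exact isometry_coe.injective this

theorem memC₀_iff {G : Type*} [TopologicalSpace G] {f : G → 𝓜(ℂ, J)} :
    MemC₀ f ↔ Continuous f ∧ (∀ g, f g ∈ inIdeal J) ∧ Tendsto f (cocompact G) (𝓝 0) := by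
  constructor
  · rintro ⟨F, hF⟩
    obtain rfl : f = fun g => (F g : 𝓜(ℂ, J)) := funext hF
    refine ⟨isometry_coe.continuous.comp F.continuous, fun g => ⟨_, rfl⟩, ?_⟩
    have h := F.zero_at_infty'
    rw [tendsto_zero_iff_norm_tendsto_zero] at h ⊢
    exact h.congr fun g => (norm_coe _).symm
  · rintro ⟨hc, hm, h0⟩
    choose F hF using hm
    obtain rfl : f = fun g => (F g : 𝓜(ℂ, J)) := funext fun g => (hF g).symm
    refine ⟨⟨⟨F, isometry_coe.isUniformInducing.isInducing.continuous_iff.2 hc⟩, ?_⟩, fun g => rfl⟩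
    rw [tendsto_zero_iff_norm_tendsto_zero] at h0 ⊢
    exact h0.congr fun g => norm_coe _

theorem MemC₀.of_tendstoUniformly {G : Type*} [TopologicalSpace G] {F : ℕ → G → 𝓜(ℂ, J)}
    {f : G → 𝓜(ℂ, J)} (hF : ∀ n, MemC₀ (F n)) (h : TendstoUniformly F f atTop) : MemC₀ f := by
  simp only [memC₀_iff] at hF ⊢
  refine ⟨h.continuous (Eventually.of_forall fun n => (hF n).1).frequently, fun g =>
    isClosed_inIdeal.mem_of_tendsto (h.tendsto_at g) (Eventually.of_forall fun n => (hF n).2.1 g),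
    ?_⟩
  refine Metric.tendsto_nhds.2 fun ε hε => ?_
  obtain ⟨n, hn⟩ := (Metric.tendstoUniformly_iff.1 h (ε / 2) (half_pos hε)).exists
  filter_upwards [Metric.tendsto_nhds.1 (hF n).2.2 (ε / 2) (half_pos hε)] with g hg
  linarith [dist_triangle (f g) (F n g) 0, hn g]

theorem MemC₀.add {G : Type*} [TopologicalSpace G] {f f' : G → 𝓜(ℂ, J)} (hf : MemC₀ f)
    (hf' : MemC₀ f') : MemC₀ fun g => f g + f' g := by
  rw [memC₀_iff] at *
  exact ⟨hf.1.add hf'.1, fun g => inIdeal_add (hf.2.1 g) (hf'.2.1 g), by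
    simpa using hf.2.2.add hf'.2.2⟩

theorem MemC₀.neg {G : Type*} [TopologicalSpace G] {f : G → 𝓜(ℂ, J)} (hf : MemC₀ f) :
    MemC₀ fun g => - f g := by
  rw [memC₀_iff] at *
  exact ⟨hf.1.neg, fun g => inIdeal_neg (hf.2.1 g), by simpa using hf.2.2.neg⟩

theorem MemC₀.sum {G : Type*} [TopologicalSpace G] {F : ℕ → G → 𝓜(ℂ, J)}
    (hF : ∀ n, MemC₀ (F n)) (N : ℕ) : MemC₀ fun g => ∑ n ∈ Finset.range N, F n g := by
  induction N with
  | zero => exact ⟨0, fun g => by simp [DoubleCentralizer.coeHom.map_zero.symm]⟩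
  | succ N ih =>
    simp only [Finset.sum_range_succ]
    exact ih.add (hF N)

end Ideal

/-! ### Extensions of automorphisms to the multiplier algebra -/

section Aut

variable {J : Type*} [NonUnitalCStarAlgebra J]

@[simp] theorem mulExt_fst (α : J ≃⋆ₐ[ℂ] J) (T : 𝓜(ℂ, J)) (a : J) :
    (mulExt α T).fst a = α (T.fst (α.symm a)) := rfl

@[simp] theorem mulExt_snd (α : J ≃⋆ₐ[ℂ] J) (T : 𝓜(ℂ, J)) (a : J) :
    (mulExt α T).snd a = α (T.snd (α.symm a)) := rfl

/-- The extension of a `*`-automorphism to the multiplier algebra as a `*`-homomorphism. -/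
noncomputable def mulExtHom (α : J ≃⋆ₐ[ℂ] J) : 𝓜(ℂ, J) →⋆ₐ[ℂ] 𝓜(ℂ, J) where
  toFun := mulExt α
  map_one' := eq_of_fst_eq (ContinuousLinearMap.ext fun a => by simp)
  map_mul' S T := eq_of_fst_eq (ContinuousLinearMap.ext fun a => by simp)
  map_zero' := eq_of_fst_eq (ContinuousLinearMap.ext fun a => by simp)
  map_add' S T := eq_of_fst_eq (ContinuousLinearMap.ext fun a => by simp)
  commutes' z := eq_of_fst_eq (ContinuousLinearMap.ext fun a => by
    simp [Algebra.algebraMap_eq_smul_one])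
  map_star' T := eq_of_fst_eq (ContinuousLinearMap.ext fun a => by simp [map_star])

@[simp] theorem mulExtHom_apply (α : J ≃⋆ₐ[ℂ] J) (T : 𝓜(ℂ, J)) : mulExtHom α T = mulExt α T := rfl

theorem mulExt_coe (α : J ≃⋆ₐ[ℂ] J) (a : J) :
    mulExt α (a : 𝓜(ℂ, J)) = ((α a : J) : 𝓜(ℂ, J)) :=
  eq_of_fst_eq (ContinuousLinearMap.ext fun b => by simp)

theorem mulExt_mem_inIdeal (α : J ≃⋆ₐ[ℂ] J) {x : 𝓜(ℂ, J)} (hx : x ∈ inIdeal J) :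
    mulExt α x ∈ inIdeal J := by
  obtain ⟨a, rfl⟩ := hx
  exact ⟨_, (mulExt_coe α a).symm⟩

end Aut

/-! ### The group action and the grading on the multiplier algebra -/

section Action

variable {G J : Type*} [Group G] [TopologicalSpace G] [NonUnitalCStarAlgebra J]
  [GradedGAlgebra G J]

theorem mAct_mAct (g h : G) (T : 𝓜(ℂ, J)) : mAct g (mAct h T) = mAct (g * h) T := by
  refine eq_of_mul_coe_eq fun j => ?_
  rw [mul_coe, mul_coe]
  simp [mAct]
  rfl

@[simp] theorem mAct_one (T : 𝓜(ℂ, J)) : mAct (1 : G) T = T := by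
  refine eq_of_mul_coe_eq fun j => ?_
  rw [mul_coe, mul_coe]
  simp [mAct]
  rfl

theorem mAct_inv_mAct (g : G) (T : 𝓜(ℂ, J)) : mAct g⁻¹ (mAct g T) = T := by
  rw [mAct_mAct, inv_mul_cancel, mAct_one]

theorem mAct_mAct_inv (g : G) (T : 𝓜(ℂ, J)) : mAct g (mAct g⁻¹ T) = T := by
  rw [mAct_mAct, mul_inv_cancel, mAct_one]

/-- The action of a group element on the multiplier algebra as a `*`-homomorphism. -/
noncomputable def mActHom (g : G) : 𝓜(ℂ, J) →⋆ₐ[ℂ] 𝓜(ℂ, J) := mulExtHom (GradedGAlgebra.act g)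

@[simp] theorem mActHom_apply (g : G) (T : 𝓜(ℂ, J)) : mActHom g T = mAct g T := rfl

theorem norm_mAct (g : G) (T : 𝓜(ℂ, J)) : ‖mAct g T‖ = ‖T‖ := by
  refine le_antisymm (NonUnitalStarAlgHom.norm_apply_le (mActHom g) T) ?_
  conv_lhs => rw [← mAct_inv_mAct g T]
  exact NonUnitalStarAlgHom.norm_apply_le (mActHom g⁻¹) _

theorem mAct_sub (g : G) (S T : 𝓜(ℂ, J)) : mAct g (S - T) = mAct g S - mAct g T :=
  map_sub (mActHom g) S T

theorem mAct_mul (g : G) (S T : 𝓜(ℂ, J)) : mAct g (S * T) = mAct g S * mAct g T :=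
  map_mul (mActHom g) S T

theorem mAct_star (g : G) (T : 𝓜(ℂ, J)) : mAct g (star T) = star (mAct g T) :=
  map_star (mActHom g) T

theorem mAct_mem_inIdeal (g : G) {x : 𝓜(ℂ, J)} (hx : x ∈ inIdeal J) : mAct g x ∈ inIdeal J :=
  mulExt_mem_inIdeal _ hx

theorem continuous_mAct {x : 𝓜(ℂ, J)} (hx : x ∈ inIdeal J) :
    Continuous fun g : G => mAct g x := by
  obtain ⟨a, rfl⟩ := hx
  have : (fun g : G => mAct g (a : 𝓜(ℂ, J)))
      = fun g : G => ((GradedGAlgebra.act g a : J) : 𝓜(ℂ, J)) := funext fun g => mulExt_coe _ _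
  simp only [this]
  exact isometry_coe.continuous.comp (GradedGAlgebra.continuous_act a)

/-- The action on M(J) is not norm continuous in general. It is isometric, so continuity along the
orbits of the values `β x` is enough. -/
theorem continuousOn_mAct {X : Type*} [TopologicalSpace X] {γ : X → G} {β : X → 𝓜(ℂ, J)}
    (hγ : Continuous γ) (hβ : Continuous β) (hβc : ∀ x, Continuous fun g : G => mAct g (β x)) :
    Continuous fun x => mAct (γ x) (β x) := by
  refine continuous_iff_continuousAt.2 fun x => ?_
  have h1 : Tendsto (fun y => mAct (γ y) (β x)) (𝓝 x) (𝓝 (mAct (γ x) (β x))) :=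
    (((hβc x).comp hγ).tendsto x)
  have h2 : Tendsto (fun y => mAct (γ y) (β y - β x)) (𝓝 x) (𝓝 0) := by
    rw [tendsto_zero_iff_norm_tendsto_zero]
    simp only [norm_mAct]
    rw [← tendsto_zero_iff_norm_tendsto_zero]
    exact tendsto_sub_nhds_zero_iff.2 (hβ.tendsto x)
  have h3 := h2.add h1
  rw [zero_add] at h3
  refine h3.congr fun y => ?_
  rw [mAct_sub, sub_add_cancel]

variable (G) in
/-- The grading of the multiplier algebra as a `*`-homomorphism. -/
noncomputable def mGradingHom : 𝓜(ℂ, J) →⋆ₐ[ℂ] 𝓜(ℂ, J) := mulExtHom (GradedGAlgebra.grading G)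

@[simp] theorem mGradingHom_apply (T : 𝓜(ℂ, J)) : mGradingHom G T = mGrading G T := rfl

theorem evenPart_of_even {T : 𝓜(ℂ, J)} (hT : mGrading G T = T) : evenPart G T = T := by
  rw [evenPart, hT, ← two_smul ℂ T, smul_smul]
  norm_num

theorem oddPart_of_even {T : 𝓜(ℂ, J)} (hT : mGrading G T = T) : oddPart G T = 0 := by
  rw [oddPart, hT, sub_self, smul_zero]

theorem evenPart_add_oddPart (T : 𝓜(ℂ, J)) : evenPart G T + oddPart G T = T := by
  rw [evenPart, oddPart, ← smul_add, add_add_sub_cancel, ← two_smul ℂ T, smul_smul]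
  norm_num

theorem gComm_of_even_left {S : 𝓜(ℂ, J)} (hS : mGrading G S = S) (T : 𝓜(ℂ, J)) :
    gComm G S T = S * T - T * S := by
  have h : T * S = evenPart G T * S + oddPart G T * S := by
    rw [← add_mul, evenPart_add_oddPart]
  rw [gComm, evenPart_of_even hS, oddPart_of_even hS, h]
  simp only [mul_zero, add_zero, sub_zero]

theorem gComm_of_even_right (S : 𝓜(ℂ, J)) {T : 𝓜(ℂ, J)} (hT : mGrading G T = T) :
    gComm G S T = S * T - T * S := by
  have h : T * S = T * evenPart G S + T * oddPart G S := by
    rw [← mul_add, evenPart_add_oddPart]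
  rw [gComm, evenPart_of_even hT, oddPart_of_even hT, h]
  simp only [zero_mul, add_zero, sub_zero]

end Action

/-! ### Strict sums of multipliers -/

section StrictSum

variable {J : Type*} [NonUnitalCStarAlgebra J]

/-- The partial sums of `X`, applied to elements of `J`, converge to `M`. -/
def HasStrictSum (X : ℕ → 𝓜(ℂ, J)) (M : 𝓜(ℂ, J)) : Prop :=
  ∀ x ∈ inIdeal J, Tendsto (fun N => (∑ n ∈ Finset.range N, X n) * x) atTop (𝓝 (M * x))

theorem HasStrictSum.unique {X : ℕ → 𝓜(ℂ, J)} {M M' : 𝓜(ℂ, J)} (h : HasStrictSum X M)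
    (h' : HasStrictSum X M') : M = M' :=
  eq_of_mul_coe_eq fun j => tendsto_nhds_unique (h _ ⟨j, rfl⟩) (h' _ ⟨j, rfl⟩)

theorem HasStrictSum.mul_right {X : ℕ → 𝓜(ℂ, J)} {M : 𝓜(ℂ, J)} (h : HasStrictSum X M)
    (y : 𝓜(ℂ, J)) : HasStrictSum (fun n => X n * y) (M * y) := fun x hx => by
  simpa only [← Finset.sum_mul, mul_assoc] using h (y * x) (inIdeal_mul_left y hx)

theorem HasStrictSum.mul_left {X : ℕ → 𝓜(ℂ, J)} {M : 𝓜(ℂ, J)} (h : HasStrictSum X M)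
    (y : 𝓜(ℂ, J)) : HasStrictSum (fun n => y * X n) (y * M) := fun x hx => by
  simpa only [← Finset.mul_sum, mul_assoc] using (h x hx).const_mul y

theorem HasStrictSum.sub {X Y : ℕ → 𝓜(ℂ, J)} {M N : 𝓜(ℂ, J)} (h : HasStrictSum X M)
    (h' : HasStrictSum Y N) : HasStrictSum (fun n => X n - Y n) (M - N) := fun x hx => by
  simpa only [Finset.sum_sub_distrib, sub_mul] using (h x hx).sub (h' x hx)

theorem HasStrictSum.mulExt {X : ℕ → 𝓜(ℂ, J)} {M : 𝓜(ℂ, J)} (h : HasStrictSum X M)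
    (α : J ≃⋆ₐ[ℂ] J) : HasStrictSum (fun n => mulExt α (X n)) (mulExt α M) := by
  rintro _ ⟨j, rfl⟩
  have h1 := ((map_continuous (mulExtHom α)).tendsto _).comp (h _ ⟨α.symm j, rfl⟩)
  simp only [Function.comp_def, map_mul, map_sum, mulExtHom_apply, mulExt_coe,
    StarAlgEquiv.apply_symm_apply] at h1
  exact h1

theorem hasStrictSum_of_hasSum {X : ℕ → 𝓜(ℂ, J)} {M : 𝓜(ℂ, J)} (h : HasSum X M) :
    HasStrictSum X M := fun _ _ => h.tendsto_sum_nat.mul_const _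

theorem HasStrictSum.eq_tsum {X : ℕ → 𝓜(ℂ, J)} {M : 𝓜(ℂ, J)} (h : HasStrictSum X M)
    (hX : Summable X) : M = ∑' n, X n := h.unique (hasStrictSum_of_hasSum hX.hasSum)

theorem HasStrictSum.mem_inIdeal {X : ℕ → 𝓜(ℂ, J)} {M : 𝓜(ℂ, J)} (h : HasStrictSum X M)
    (hX : Summable fun n => ‖X n‖) (hm : ∀ n, X n ∈ inIdeal J) : M ∈ inIdeal J := by
  rw [h.eq_tsum hX.of_norm]
  exact isClosed_inIdeal.mem_of_tendsto hX.of_norm.hasSum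
    (Eventually.of_forall fun F => (idealSubmodule J).sum_mem fun n _ => hm n)

/-- Norm balls are closed under strict limits. With `T = 0` and `T = 1` this transfers the two
bounds that encode 0 ≤ M ≤ 1. -/
theorem HasStrictSum.norm_sub_le {X : ℕ → 𝓜(ℂ, J)} {M : 𝓜(ℂ, J)} (h : HasStrictSum X M)
    (T : 𝓜(ℂ, J)) {C : ℝ} (hC : ∀ N, ‖T - ∑ n ∈ Finset.range N, X n‖ ≤ C) : ‖T - M‖ ≤ C := by
  have hC0 : 0 ≤ C := (norm_nonneg _).trans (hC 0)
  rw [← DoubleCentralizer.norm_fst]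
  refine ContinuousLinearMap.opNorm_le_bound _ hC0 fun j => ?_
  rw [← norm_coe, ← mul_coe]
  have h1 := ((tendsto_const_nhds (x := T * (j : 𝓜(ℂ, J)))).sub (h _ ⟨j, rfl⟩)).norm
  rw [sub_mul]
  refine le_of_tendsto h1 (Eventually.of_forall fun N => ?_)
  rw [← sub_mul, ← norm_coe j]
  exact (norm_mul_le _ _).trans (by gcongr; exact hC N)

theorem HasStrictSum.isSelfAdjoint {X : ℕ → 𝓜(ℂ, J)} {M : 𝓜(ℂ, J)} (h : HasStrictSum X M)
    (hX : ∀ n, IsSelfAdjoint (X n)) : IsSelfAdjoint M := by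
  refine eq_of_mul_coe_eq fun j => ?_
  -- Strict convergence is only known against elements of J on the right. After multiplying by `i`
  -- on the left as well, the adjoint moves onto `i`.
  suffices hs : ∀ i : J, (i : 𝓜(ℂ, J)) * (star M * (j : 𝓜(ℂ, J))) = i * (M * (j : 𝓜(ℂ, J))) by
    have h1 := hs (star ((star M * j - M * j : 𝓜(ℂ, J)).fst 0))
    have h2 : ∀ x ∈ inIdeal J, (∀ i : J, (i : 𝓜(ℂ, J)) * x = 0) → x = 0 := by
      rintro _ ⟨a, rfl⟩ ha
      have := ha (star a)
      rw [coe_star] at this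
      exact (CStarRing.star_mul_self_eq_zero_iff _).1 this
    refine sub_eq_zero.1 (h2 _ (inIdeal_sub (inIdeal_mul_left _ ⟨j, rfl⟩)
      (inIdeal_mul_left _ ⟨j, rfl⟩)) fun i => ?_)
    rw [mul_sub, hs, sub_self]
  intro i
  have h1 := (h _ ⟨j, rfl⟩).const_mul (i : 𝓜(ℂ, J))
  have h2 := ((h _ ⟨star i, rfl⟩).star).mul_const (j : 𝓜(ℂ, J))
  refine tendsto_nhds_unique ?_ h1
  simp only [star_mul, coe_star, star_star, mul_assoc] at h2
  refine h2.congr fun N => ?_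
  rw [star_sum, Finset.sum_congr rfl fun n _ => (hX n).star_eq]

/-- The partial sums are uniformly bounded and converge in norm on each `w k`, hence they are Cauchy
on all of J. As the terms are self-adjoint, the right multiplication of the limit is the conjugate
of its left multiplication by the involution. -/
theorem exists_hasStrictSum {X : ℕ → 𝓜(ℂ, J)} (hX : ∀ n, IsSelfAdjoint (X n))
    (hX1 : ∀ N, ‖∑ n ∈ Finset.range N, X n‖ ≤ 1) {w : ℕ → 𝓜(ℂ, J)}
    (hw : ∀ x ∈ inIdeal J, Tendsto (fun k => w k * x) atTop (𝓝 x))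
    (hs : ∀ k, Summable fun n => ‖X n * w k‖) : ∃ M, HasStrictSum X M := by
  have hcau : ∀ j : J, ∃ y : J, Tendsto (fun N => (∑ n ∈ Finset.range N, X n).fst j) atTop
      (𝓝 y) := by
    intro j
    refine cauchySeq_tendsto_of_complete (Metric.cauchySeq_iff.2 fun ε hε => ?_)
    obtain ⟨k, hk⟩ := (Metric.tendsto_nhds.1 (hw _ ⟨j, rfl⟩) (ε / 3) (by positivity)).exists
    have h1 := ((hs k).of_norm.hasSum.tendsto_sum_nat.mul_const (j : 𝓜(ℂ, J))).cauchySeq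
    obtain ⟨N, hN⟩ := Metric.cauchySeq_iff.1 h1 (ε / 3) (by positivity)
    refine ⟨N, fun m hm n hn => ?_⟩
    have hd : ∀ m, dist ((∑ n ∈ Finset.range m, X n) * (j : 𝓜(ℂ, J)))
        ((∑ n ∈ Finset.range m, X n * w k) * (j : 𝓜(ℂ, J))) < ε / 3 := fun m => by
      rw [dist_comm, dist_eq_norm, ← Finset.sum_mul, mul_assoc, ← mul_sub, ]
      rw [dist_eq_norm] at hk
      refine lt_of_le_of_lt (norm_mul_le _ _) (lt_of_le_of_lt ?_ hk)
      nlinarith [hX1 m, norm_nonneg (w k * (j : 𝓜(ℂ, J)) - j)]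
    have h2 := hN m hm n hn
    have e : ∀ m, ((∑ n ∈ Finset.range m, X n).fst j : 𝓜(ℂ, J))
      = (∑ n ∈ Finset.range m, X n) * (j : 𝓜(ℂ, J)) := fun m => (mul_coe _ _).symm
    rw [← isometry_coe.dist_eq, e, e]
    have := dist_triangle4 ((∑ n ∈ Finset.range m, X n) * (j : 𝓜(ℂ, J)))
      ((∑ n ∈ Finset.range m, X n * w k) * (j : 𝓜(ℂ, J)))
      ((∑ n' ∈ Finset.range n, X n' * w k) * (j : 𝓜(ℂ, J)))
      ((∑ n' ∈ Finset.range n, X n') * (j : 𝓜(ℂ, J)))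
    have h3 := hd m
    have h4 := hd n
    rw [dist_comm] at h4
    linarith
  choose L hL using hcau
  let L' : J →ₗ[ℂ] J :=
    { toFun := L
      map_add' := fun x y => tendsto_nhds_unique (hL (x + y)) (by simpa using (hL x).add (hL y))
      map_smul' := fun a x =>
        tendsto_nhds_unique (hL (a • x)) (by simpa using (hL x).const_smul a) }
  let Lc : J →L[ℂ] J := L'.mkContinuous 1 fun j => by
    refine le_of_tendsto (hL j).norm (Eventually.of_forall fun N => ?_)
    refine (ContinuousLinearMap.le_opNorm _ _).trans ?_
    gcongr
    rw [DoubleCentralizer.norm_fst]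
    exact hX1 N
  have hLc : ∀ j, Tendsto (fun N => (∑ n ∈ Finset.range N, X n).fst j) atTop (𝓝 (Lc j)) := hL
  let sc : J →L⋆[ℂ] J := (starL ℂ : J ≃L⋆[ℂ] J).toContinuousLinearMap
  refine ⟨⟨(Lc, (sc.comp Lc).comp sc), fun x y => ?_⟩, ?_⟩
  · change star (Lc (star x)) * y = x * Lc y
    refine tendsto_nhds_unique ((hLc (star x)).star.mul_const y)
      (((hLc y).const_mul x).congr fun N => ?_)
    rw [star_fst_mul, star_star, star_sum, Finset.sum_congr rfl fun n _ => (hX n).star_eq]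
  · rintro _ ⟨j, rfl⟩
    simp only [mul_coe]
    exact (isometry_coe.continuous.tendsto _).comp (hLc j)

end StrictSum

/-! ### Functions vanishing at infinity -/

section ZeroAtInfty

variable {E : Type*} [TopologicalSpace E]

theorem zeroAtInfty_norm_le {φ : C₀(E, ℂ)} {C : ℝ} (hC : 0 ≤ C) : ‖φ‖ ≤ C ↔ ∀ x, ‖φ x‖ ≤ C := by
  rw [← ZeroAtInftyContinuousMap.norm_toBCF_eq_norm, BoundedContinuousFunction.norm_le hC]
  rfl

theorem zeroAtInfty_norm_apply_le (φ : C₀(E, ℂ)) (x : E) : ‖φ x‖ ≤ ‖φ‖ :=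
  (zeroAtInfty_norm_le (norm_nonneg _)).1 le_rfl x

theorem exists_isCompact_norm_lt (φ : C₀(E, ℂ)) {ε : ℝ} (hε : 0 < ε) :
    ∃ K : Set E, IsCompact K ∧ ∀ x ∉ K, ‖φ x‖ < ε := by
  have h := φ.zero_at_infty' (Metric.ball_mem_nhds (0 : ℂ) hε)
  obtain ⟨K, hK, hKs⟩ := mem_cocompact.1 h
  exact ⟨K, hK, fun x hx => by simpa using hKs hx⟩

theorem exists_cutoff_sequence [LocallyCompactSpace E] [T2Space E] [SigmaCompactSpace E] :
    ∃ ψ : ℕ → C₀(E, ℂ), (∀ n, HasCompactSupport (ψ n)) ∧ (∀ n, ‖ψ n‖ ≤ 1) ∧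
      (∀ n, star (ψ n) = ψ n) ∧ ∀ φ, Tendsto (fun n => ψ n * φ) atTop (𝓝 φ) := by
  let K := CompactExhaustion.choice E
  have h : ∀ n, ∃ f : C(E, ℝ), Set.EqOn f 1 (K n) ∧ Set.EqOn f 0 ∅ ∧ HasCompactSupport f ∧
      ∀ x, f x ∈ Set.Icc (0 : ℝ) 1 := fun n =>
    exists_continuous_one_zero_of_isCompact (K.isCompact n) isClosed_empty (Set.disjoint_empty _)
  choose f hf1 _ hfc hf using h
  refine ⟨fun n => toC₀ (f n) (hfc n), fun n =>
    (hfc n).comp_left (g := fun r : ℝ => (r : ℂ)) Complex.ofReal_zero, fun n => ?_, fun n => ?_,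
    fun φ => ?_⟩
  · refine (zeroAtInfty_norm_le zero_le_one).2 fun x => ?_
    change ‖((f n x : ℝ) : ℂ)‖ ≤ 1
    rw [Complex.norm_real, Real.norm_of_nonneg (hf n x).1]
    exact (hf n x).2
  · ext x
    change star ((f n x : ℝ) : ℂ) = (f n x : ℝ)
    simp
  · refine Metric.tendsto_atTop.2 fun ε hε => ?_
    obtain ⟨L, hL, hφ⟩ := exists_isCompact_norm_lt φ (half_pos hε)
    obtain ⟨N, hN⟩ := K.exists_superset_of_isCompact hL
    refine ⟨N, fun n hn => ?_⟩
    rw [dist_eq_norm]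
    refine lt_of_le_of_lt ((zeroAtInfty_norm_le (half_pos hε).le).2 fun x => ?_) (half_lt_self hε)
    change ‖((f n x : ℝ) : ℂ) * φ x - φ x‖ ≤ ε / 2
    by_cases hx : x ∈ K n
    · rw [hf1 n hx]
      simpa using (half_pos hε).le
    · have hx' : x ∉ L := fun h => hx (K.subset hn (hN h))
      rw [← sub_one_mul, norm_mul, ← Complex.ofReal_one, ← Complex.ofReal_sub, Complex.norm_real]
      have h1 : ‖f n x - 1‖ ≤ 1 := by
        rw [Real.norm_eq_abs, abs_le]
        constructor <;> linarith [(hf n x).1, (hf n x).2]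
      calc _ ≤ 1 * (ε / 2) := by gcongr; exact (hφ x hx').le
        _ = _ := one_mul _

/-- Functions vanishing off a fixed compact set embed isometrically into the separable space of
continuous functions on that set, and countably many such sets suffice. -/
theorem exists_dense_sequence_compactSupport [LocallyCompactSpace E] [T2Space E]
    [SigmaCompactSpace E] [SecondCountableTopology E] :
    ∃ φ : ℕ → C₀(E, ℂ), (∀ n, HasCompactSupport (φ n)) ∧ DenseRange φ := by
  obtain ⟨ψ, hψc, -, -, hψ⟩ := exists_cutoff_sequence (E := E)
  let V : ℕ → Set C₀(E, ℂ) := fun n => {φ | ∀ x ∉ tsupport (ψ n), φ x = 0}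
  have hVsep : ∀ n, TopologicalSpace.IsSeparable (V n) := fun n => by
    have : CompactSpace (tsupport (ψ n)) := isCompact_iff_compactSpace.1 (hψc n)
    let F : V n → C(tsupport (ψ n), ℂ) := fun φ => (φ.1 : C(E, ℂ)).restrict _
    have hF : Isometry F := Isometry.of_dist_eq fun φ φ' => by
      rw [Subtype.dist_eq, dist_eq_norm, dist_eq_norm]
      refine le_antisymm ((ContinuousMap.norm_le _ (norm_nonneg _)).2 fun x =>
        zeroAtInfty_norm_apply_le (φ.1 - φ'.1) x) ((zeroAtInfty_norm_le (norm_nonneg _)).2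
          fun x => ?_)
      by_cases hx : x ∈ tsupport (ψ n)
      · exact ContinuousMap.norm_coe_le_norm (F φ - F φ') ⟨x, hx⟩
      · have h1 := φ.2 x hx
        have h2 := φ'.2 x hx
        rw [ZeroAtInftyContinuousMap.sub_apply, h1, h2, sub_zero, norm_zero]
        exact norm_nonneg _
    have := hF.isUniformInducing.isInducing.secondCountableTopology
    exact (TopologicalSpace.IsSeparable.of_separableSpace (Set.univ : Set (V n))).image
      continuous_subtype_val |>.mono (by simp)
  have hV : TopologicalSpace.IsSeparable (⋃ n, V n) := .iUnion hVsep
  obtain ⟨t, htV, htc, ht⟩ := hV.exists_countable_dense_subset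
  have hVd : Dense (⋃ n, V n) := fun φ => by
    refine mem_closure_of_tendsto (hψ φ) (Eventually.of_forall fun n => Set.mem_iUnion.2 ⟨n, ?_⟩)
    intro x hx
    rw [ZeroAtInftyContinuousMap.mul_apply, image_eq_zero_of_notMem_tsupport hx, zero_mul]
  have htd : Dense t := fun φ => by
    have := closure_mono ht (hVd φ)
    rwa [closure_closure] at this
  obtain ⟨φ, rfl⟩ := htc.exists_eq_range htd.nonempty
  refine ⟨φ, fun k => ?_, htd⟩
  obtain ⟨n, hn⟩ := Set.mem_iUnion.1 (htV ⟨k, rfl⟩)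
  exact HasCompactSupport.intro (hψc n) hn

end ZeroAtInfty

/-! ### Translation of functions -/

section Translate

variable {G E : Type*} [Group G] [TopologicalSpace E] [MulAction G E]

section ConstSMul

variable [ContinuousConstSMul G E]

@[simp] theorem translate_apply (g : G) (φ : C₀(E, ℂ)) (x : E) :
    translate g φ x = φ (g⁻¹ • x) := rfl

theorem translate_star (g : G) (φ : C₀(E, ℂ)) :
    translate g (star φ) = star (translate g φ) := rfl

theorem translate_sub (g : G) (φ ψ : C₀(E, ℂ)) :
    translate g (φ - ψ) = translate g φ - translate g ψ := rfl

theorem norm_translate_le (g : G) (φ : C₀(E, ℂ)) : ‖translate g φ‖ ≤ ‖φ‖ :=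
  (zeroAtInfty_norm_le (norm_nonneg _)).2 fun _ => zeroAtInfty_norm_apply_le φ _

end ConstSMul

variable [TopologicalSpace G]

/-- Near `g₀` both translates are small off the compact set V·L; on it, currying gives uniform
convergence. -/
theorem continuous_translate [IsTopologicalGroup G] [ContinuousSMul G E] [LocallyCompactSpace G]
    (φ : C₀(E, ℂ)) :
    Continuous fun g : G => translate g φ := by
  refine continuous_iff_continuousAt.2 fun g₀ => Metric.tendsto_nhds.2 fun ε hε => ?_
  obtain ⟨L, hL, hφ⟩ := exists_isCompact_norm_lt φ (show 0 < ε / 4 by positivity)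
  obtain ⟨V, hVc, hV⟩ := exists_compact_mem_nhds g₀
  let F : C(G, C(E, ℂ)) := ContinuousMap.curry
    ⟨fun p : G × E => φ (p.1⁻¹ • p.2), φ.continuous.comp (continuous_fst.inv.smul continuous_snd)⟩
  have hL' : IsCompact ((fun p : G × E => p.1 • p.2) '' (V ×ˢ L)) :=
    (hVc.prod hL).image continuous_smul
  have h := (ContinuousMap.tendsto_iff_forall_isCompact_tendstoUniformlyOn.1
    (F.continuous.tendsto g₀)) _ hL'
  filter_upwards [Metric.tendstoUniformlyOn_iff.1 h (ε / 2) (half_pos hε), hV] with g hg hgV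
  rw [dist_eq_norm]
  refine lt_of_le_of_lt ((zeroAtInfty_norm_le (half_pos hε).le).2 fun x => ?_) (half_lt_self hε)
  change ‖φ (g⁻¹ • x) - φ (g₀⁻¹ • x)‖ ≤ ε / 2
  by_cases hx : x ∈ (fun p : G × E => p.1 • p.2) '' (V ×ˢ L)
  · have := hg x hx
    rw [dist_comm, dist_eq_norm] at this
    exact this.le
  · have hout : ∀ g ∈ V, ‖φ (g⁻¹ • x)‖ < ε / 4 := fun g hg => hφ _ fun hgL =>
      hx ⟨(g, g⁻¹ • x), ⟨hg, hgL⟩, smul_inv_smul g x⟩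
    have h1 := hout g hgV
    have h2 := hout g₀ (mem_of_mem_nhds hV)
    linarith [norm_sub_le (φ (g⁻¹ • x)) (φ (g₀⁻¹ • x))]

/-- Project to G the preimage of `L' × L` under the proper map (g, x) ↦ (g x, x). -/
theorem exists_isCompact_smul_disjoint [ProperSMul G E] {L L' : Set E} (hL : IsCompact L)
    (hL' : IsCompact L') :
    ∃ K : Set G, IsCompact K ∧ ∀ g ∉ K, ∀ x ∈ L', g⁻¹ • x ∉ L := by
  refine ⟨_, ((ProperSMul.isProperMap_smul_pair (G := G) (X := E)).isCompact_preimage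
    (hL'.prod hL)).image continuous_fst, fun g hg x hx hxL => hg ⟨(g, g⁻¹ • x), ⟨?_, hxL⟩, rfl⟩⟩
  simpa using hx

theorem exists_isCompact_translate_mul_eq_zero [ContinuousConstSMul G E] [ProperSMul G E]
    {φ ψ : C₀(E, ℂ)}
    (hφ : HasCompactSupport φ) (hψ : HasCompactSupport ψ) :
    ∃ K : Set G, IsCompact K ∧ ∀ g ∉ K, translate g φ * ψ = 0 := by
  obtain ⟨K, hK, h⟩ := exists_isCompact_smul_disjoint (G := G) hφ hψ
  refine ⟨K, hK, fun g hg => ?_⟩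
  ext x
  rw [ZeroAtInftyContinuousMap.mul_apply, translate_apply]
  by_cases hx : x ∈ tsupport ψ
  · rw [image_eq_zero_of_notMem_tsupport (h g hg x hx), zero_mul]; rfl
  · rw [image_eq_zero_of_notMem_tsupport hx, mul_zero]; rfl

/-- Finitely many compact neighbourhoods cover the quotient, so E is the G-saturation of a compact
set. -/
theorem sigmaCompactSpace_of_compact_quotient [ContinuousSMul G E] [SigmaCompactSpace G]
    [LocallyCompactSpace E]
    [CompactSpace (Quotient (MulAction.orbitRel G E))] : SigmaCompactSpace E := by
  choose L hLc hL using fun x : E => exists_compact_mem_nhds x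
  have hopen : IsOpenMap (Quotient.mk (MulAction.orbitRel G E)) :=
    isOpenMap_quotient_mk'_mul
  obtain ⟨t, ht⟩ := isCompact_univ.elim_finite_subcover
    (fun x : E => Quotient.mk (MulAction.orbitRel G E) '' interior (L x))
    (fun x => hopen _ isOpen_interior) (fun q _ => by
      obtain ⟨x, rfl⟩ := Quotient.exists_rep q
      exact Set.mem_iUnion.2 ⟨x, x, mem_interior_iff_mem_nhds.2 (hL x), rfl⟩)
  have hC : IsCompact (⋃ x ∈ t, L x) := t.isCompact_biUnion fun x _ => hLc x
  refine ⟨⟨fun n => (fun p : G × E => p.1 • p.2) '' (compactCovering G n ×ˢ ⋃ x ∈ t, L x),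
    fun n => ((isCompact_compactCovering G n).prod hC).image continuous_smul, ?_⟩⟩
  refine Set.eq_univ_of_forall fun y => ?_
  obtain ⟨x, hx, z, hz, hzy⟩ := Set.mem_iUnion₂.1 (ht (Set.mem_univ (Quotient.mk _ y)))
  obtain ⟨g, hg⟩ := (MulAction.orbitRel_apply.1 (Quotient.exact hzy.symm) : y ∈ MulAction.orbit G z)
  obtain ⟨n, hn⟩ := Set.mem_iUnion.1
    ((iUnion_compactCovering G).symm ▸ Set.mem_univ g : g ∈ ⋃ n, compactCovering G n)
  exact Set.mem_iUnion.2 ⟨n, (g, z), ⟨hn, Set.mem_iUnion₂.2 ⟨x, hx, interior_subset hz⟩⟩, hg⟩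

end Translate

/-! ### Weights and integrals on the group -/

section Weight

variable {G : Type*} [TopologicalSpace G] [MeasurableSpace G] [BorelSpace G] [T2Space G]
  [WeaklyLocallyCompactSpace G] [SigmaCompactSpace G]

/-- Take ∑ aₙ 1_{Kₙ} over a compact exhaustion, with aₙ = 2⁻⁽ⁿ⁺¹⁾ / (1 + μ(Kₙ)): the n-th term then
has sup norm and integral at most 2⁻⁽ⁿ⁺¹⁾. -/
theorem exists_integrable_weight (μ : Measure G) [IsFiniteMeasureOnCompacts μ] :
    ∃ w : G → ℝ, Integrable w μ ∧ (∀ g, 0 < w g) ∧ (∀ g, w g ≤ 1) ∧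
      ∀ K, IsCompact K → ∃ δ > 0, ∀ g ∈ K, δ ≤ w g := by
  let K := CompactExhaustion.choice G
  let a : ℕ → ENNReal := fun n => 2⁻¹ ^ (n + 1) / (1 + μ (K n))
  have hμ : ∀ n, μ (K n) ≠ ⊤ := fun n => (K.isCompact n).measure_ne_top
  have ha2 : ∀ n, a n ≤ 2⁻¹ ^ (n + 1) := fun n =>
    ENNReal.div_le_of_le_mul (le_mul_of_one_le_right' le_self_add)
  have ha0 : ∀ n, a n ≠ 0 := fun n => by
    refine ENNReal.div_ne_zero.2 ⟨?_, ?_⟩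
    · exact pow_ne_zero _ (by simp)
    · simp [hμ n]
  have haμ : ∀ n, a n * μ (K n) ≤ 2⁻¹ ^ (n + 1) := fun n => by
    calc a n * μ (K n) ≤ (1 + μ (K n)) * a n := by
          rw [mul_comm]
          gcongr
          exact le_add_self
      _ ≤ _ := ENNReal.mul_div_le
  have hsum : ∑' n : ℕ, (2⁻¹ : ENNReal) ^ (n + 1) = 1 := by
    rw [ENNReal.tsum_geometric_add_one, ENNReal.one_sub_inv_two, inv_inv]
    exact ENNReal.inv_mul_cancel (by simp) (by simp)
  let ℓ : G → ENNReal := fun g => ∑' n, (K n).indicator (fun _ => a n) g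
  have hmeas : ∀ n, Measurable ((K n).indicator (fun _ => a n)) := fun n =>
    measurable_const.indicator (K.isCompact n).isClosed.measurableSet
  have hℓm : Measurable ℓ := Measurable.tsum hmeas
  have hℓ1 : ∀ g, ℓ g ≤ 1 := fun g => by
    rw [← hsum]
    refine ENNReal.tsum_le_tsum fun n =>
      (Set.indicator_le_self' (fun _ _ => zero_le) g).trans (ha2 n)
  have hℓt : ∀ g, ℓ g ≠ ⊤ := fun g => ne_top_of_le_ne_top ENNReal.one_ne_top (hℓ1 g)
  have hℓa : ∀ n, ∀ g ∈ K n, (a n).toReal ≤ (ℓ g).toReal := fun n g hg => by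
    refine ENNReal.toReal_mono (hℓt g) ?_
    refine le_trans ?_ (ENNReal.le_tsum n)
    simp [hg]
  have hat : ∀ n, 0 < (a n).toReal := fun n => ENNReal.toReal_pos (ha0 n)
    (ne_top_of_le_ne_top (by simp) (ha2 n))
  refine ⟨fun g => (ℓ g).toReal, integrable_toReal_of_lintegral_ne_top hℓm.aemeasurable ?_,
    fun g => ?_, fun g => ENNReal.toReal_le_of_le_ofReal zero_le_one (by simpa using hℓ1 g),
    fun L hL => ?_⟩
  · rw [lintegral_tsum fun n => (hmeas n).aemeasurable]
    refine ne_top_of_le_ne_top ENNReal.one_ne_top ?_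
    rw [← hsum]
    refine ENNReal.tsum_le_tsum fun n => ?_
    rw [lintegral_indicator (K.isCompact n).isClosed.measurableSet, setLIntegral_const]
    exact haμ n
  · obtain ⟨n, hn⟩ := K.exists_mem g
    exact (hat n).trans_le (hℓa n g hn)
  · obtain ⟨n, hn⟩ := K.exists_superset_of_isCompact hL
    exact ⟨_, hat n, fun g hg => hℓa n g (hn hg)⟩

/-- A compact exhaustion is cofinal among the compact sets. Countable generation lets the
convergence theorem for exhausting covers apply. -/
instance isCountablyGenerated_atTop_compacts :
    (atTop : Filter (TopologicalSpace.Compacts G)).IsCountablyGenerated := by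
  let K := CompactExhaustion.choice G
  have : (atTop : Filter (TopologicalSpace.Compacts G)).HasBasis (fun _ : ℕ => True)
      (fun n => Set.Ici (⟨K n, K.isCompact n⟩ : TopologicalSpace.Compacts G)) := by
    refine ⟨fun s => ⟨fun hs => ?_, fun ⟨n, _, hn⟩ => mem_of_superset (Ici_mem_atTop _) hn⟩⟩
    obtain ⟨L, hL⟩ := mem_atTop_sets.1 hs
    obtain ⟨n, hn⟩ := K.exists_superset_of_isCompact L.isCompact
    exact ⟨n, trivial, fun L' hL' => hL L' (le_trans (show L ≤ ⟨K n, K.isCompact n⟩ from hn) hL')⟩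
  exact this.isCountablyGenerated

theorem tendsto_setIntegral_compacts {F : Type*} [NormedAddCommGroup F] [NormedSpace ℝ F]
    (μ : Measure G) {f : G → F} (hf : Integrable f μ) :
    Tendsto (fun K : TopologicalSpace.Compacts G => ∫ g in K, f g ∂μ) atTop
      (𝓝 (∫ g, f g ∂μ)) := by
  have : AECover μ (atTop : Filter (TopologicalSpace.Compacts G)) (fun K => (K : Set G)) := by
    refine ⟨Eventually.of_forall fun g => ?_, fun K => K.isCompact.isClosed.measurableSet⟩
    filter_upwards [Ici_mem_atTop (⟨{g}, isCompact_singleton⟩ : TopologicalSpace.Compacts G)]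
      with K hK
    exact hK (Set.mem_singleton g)
  exact this.integral_tendsto_of_countably_generated hf

end Weight

/-! ### Left approximate units of subspaces -/

section LeftFixed

variable {ι M : Type*} [NormedRing M] [NormedAlgebra ℂ M]

/-- The elements `x` with `f i * x → x`. -/
def leftFixed (l : Filter ι) (f : ι → M) : Submodule ℂ M where
  carrier := {x | Tendsto (fun i => f i * x) l (𝓝 x)}
  add_mem' hx hy := by simpa only [Set.mem_ofPred_eq, mul_add] using hx.add hy
  zero_mem' := by simpa using tendsto_const_nhds
  smul_mem' a x hx := by simpa only [Set.mem_ofPred_eq, mul_smul_comm] using hx.const_smul a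

theorem mem_leftFixed {l : Filter ι} {f : ι → M} {x : M} :
    x ∈ leftFixed l f ↔ Tendsto (fun i => f i * x) l (𝓝 x) := Iff.rfl

theorem leftFixed_mul {l : Filter ι} {f : ι → M} {x : M} (hx : x ∈ leftFixed l f) (y : M) :
    x * y ∈ leftFixed l f := by
  rw [mem_leftFixed] at *
  simpa only [← mul_assoc] using hx.mul_const y

theorem isClosed_leftFixed {l : Filter ι} {f : ι → M} {C : ℝ} (hf : ∀ᶠ i in l, ‖f i‖ ≤ C) :
    IsClosed (leftFixed l f : Set M) := by
  rcases l.eq_or_neBot with rfl | hl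
  · convert isClosed_univ
    ext x
    simp [mem_leftFixed]
  have hC : 0 ≤ C := by
    obtain ⟨i, hi⟩ := hf.exists
    exact (norm_nonneg _).trans hi
  refine isClosed_of_closure_subset fun x hx => Metric.tendsto_nhds.2 fun ε hε => ?_
  obtain ⟨y, hy, hxy⟩ := Metric.mem_closure_iff.1 hx (ε / (2 * (C + 1))) (by positivity)
  filter_upwards [hf, Metric.tendsto_nhds.1 (mem_leftFixed.1 hy) (ε / 2) (half_pos hε)]
    with i hi hiy
  rw [dist_eq_norm] at *
  have h1 : ‖f i * (x - y)‖ ≤ C * ‖x - y‖ := (norm_mul_le _ _).trans (by gcongr)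
  have h2 : f i * x - x = f i * (x - y) + (f i * y - y) - (x - y) := by noncomm_ring
  have h3 : (C + 1) * ‖x - y‖ < ε / 2 := by
    calc _ < (C + 1) * (ε / (2 * (C + 1))) := by gcongr
      _ = ε / 2 := by field_simp
  rw [h2]
  linarith [norm_sub_le (f i * (x - y) + (f i * y - y)) (x - y),
    norm_add_le (f i * (x - y)) (f i * y - y)]

end LeftFixed

/-! ### The representation of functions by multipliers -/

section FunRep

variable {G E J P : Type*} [Group G] [TopologicalSpace G] [TopologicalSpace E] [MulAction G E]
  [ContinuousConstSMul G E] [NonUnitalCStarAlgebra J] [NonUnitalCStarAlgebra P]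
  [GradedGAlgebra G P] [GradedGAlgebra G J]
  (Φ : ProperAlgebra G E P) (π : GRep G P J)

theorem funRep_mul_hom (φ : C₀(E, ℂ)) (p : P) :
    funRep Φ π φ * π.hom p = π.hom ((Φ.hom φ).fst p) := extend_mul _ _ _ _

theorem ext_of_mul_hom {S T : 𝓜(ℂ, J)} (h : ∀ p, S * π.hom p = T * π.hom p) : S = T :=
  extension_unique π.hom π.nondegenerate h

theorem funRep_star (φ : C₀(E, ℂ)) : funRep Φ π (star φ) = star (funRep Φ π φ) := by
  refine ext_of_mul_hom π fun p => ?_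
  refine star_injective (ext_of_mul_hom π fun q => star_injective ?_)
  simp only [star_mul, star_star]
  rw [funRep_mul_hom, ← mul_assoc (star (π.hom q)), ← star_mul, funRep_mul_hom,
    ← map_star π.hom, ← map_star π.hom, ← map_mul, ← map_mul, star_fst_mul, map_star]

/-- The representation of `C₀(E)` as a `*`-homomorphism. -/
noncomputable def funRepHom : C₀(E, ℂ) →⋆ₙₐ[ℂ] 𝓜(ℂ, J) where
  toFun := funRep Φ π
  map_smul' z φ := ext_of_mul_hom π fun p => by
    simp [funRep_mul_hom]
  map_zero' := ext_of_mul_hom π fun p => by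
    simp [funRep_mul_hom]
  map_add' φ ψ := ext_of_mul_hom π fun p => by
    simp [funRep_mul_hom, add_mul]
  map_mul' φ ψ := ext_of_mul_hom π fun p => by
    simp [funRep_mul_hom, mul_assoc]
  map_star' φ := funRep_star Φ π φ

theorem norm_funRep_le (φ : C₀(E, ℂ)) : ‖funRep Φ π φ‖ ≤ ‖φ‖ :=
  NonUnitalStarAlgHom.norm_apply_le (funRepHom Φ π) φ

theorem continuous_funRep : Continuous (funRep Φ π) := map_continuous (funRepHom Φ π)

theorem funRep_mul (φ ψ : C₀(E, ℂ)) : funRep Φ π (φ * ψ) = funRep Φ π φ * funRep Φ π ψ :=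
  map_mul (funRepHom Φ π) φ ψ

theorem funRep_sub (φ ψ : C₀(E, ℂ)) : funRep Φ π (φ - ψ) = funRep Φ π φ - funRep Φ π ψ :=
  map_sub (funRepHom Φ π) φ ψ

theorem funRep_zero : funRep Φ π 0 = 0 := map_zero (funRepHom Φ π)

/-- Centrality of the functions in M(P), tested after multiplying by a further element of P. -/
theorem funRep_comm_hom (φ : C₀(E, ℂ)) (p : P) :
    funRep Φ π φ * π.hom p = π.hom p * funRep Φ π φ := by
  refine ext_of_mul_hom π fun q => ?_
  rw [funRep_mul_hom, mul_assoc, funRep_mul_hom, ← map_mul, ← map_mul]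
  congr 1
  have h := ((Set.mem_center_iff.1 (Φ.central φ)).comm (p : 𝓜(ℂ, P))).eq
  have h1 := congrArg (fun T : 𝓜(ℂ, P) => T.fst q) h
  simp only [DoubleCentralizer.mul_fst] at h1
  rw [fst_mul]
  simpa using h1

theorem funRep_even (φ : C₀(E, ℂ)) : mGrading G (funRep Φ π φ) = funRep Φ π φ := by
  refine ext_of_mul_hom π fun p => ?_
  have h1 : π.hom p = mGrading G (π.hom (GradedGAlgebra.grading G p)) := by
    rw [← π.graded, GradedGAlgebra.grading_grading]
  have h2 : mGrading G (funRep Φ π φ * π.hom (GradedGAlgebra.grading G p))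
      = mGrading G (funRep Φ π φ) * mGrading G (π.hom (GradedGAlgebra.grading G p)) :=
    map_mul (mGradingHom G) _ _
  conv_lhs => rw [h1]
  rw [← h2, funRep_mul_hom, funRep_mul_hom, ← π.graded]
  congr 1
  have h3 : (mGrading G (Φ.hom φ)).fst p = (Φ.hom φ).fst p := by rw [Φ.graded]
  rw [← h3, mGrading, mulExt_fst]
  have h4 : GradedGAlgebra.grading G p = (GradedGAlgebra.grading G).symm p := by
    conv_rhs => rw [← GradedGAlgebra.grading_grading (G := G) p]
    rw [StarAlgEquiv.symm_apply_apply]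
  rw [h4]

/-- Clear on products φ p, and these span a dense subspace of P; boundedness of ψ makes the set of
good elements closed. -/
theorem hom_mem_leftFixed_funRep {ι : Type*} {l : Filter ι} {ψ : ι → C₀(E, ℂ)} {C : ℝ}
    (hψ1 : ∀ i, ‖ψ i‖ ≤ C) (hψ : ∀ φ, Tendsto (fun i => ψ i * φ) l (𝓝 φ)) (p : P) :
    π.hom p ∈ leftFixed l (fun i => funRep Φ π (ψ i)) := by
  have hcl := isClosed_leftFixed (l := l) (f := fun i => funRep Φ π (ψ i)) (C := C)
    (Eventually.of_forall fun i => (norm_funRep_le Φ π _).trans (hψ1 i))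
  have h1 : IsClosed {p : P | π.hom p ∈ leftFixed l (fun i => funRep Φ π (ψ i))} :=
    hcl.preimage (map_continuous π.hom)
  refine (closure_minimal ?_ h1) (Φ.nondegenerate p)
  have h3 : (Submodule.span ℂ {a : P | ∃ b a', a = (Φ.hom b).fst a'}) ≤
      (leftFixed l (fun i => funRep Φ π (ψ i))).comap (π.hom : P →ₗ[ℂ] 𝓜(ℂ, J)) := by
    rw [Submodule.span_le]
    rintro _ ⟨φ, p', rfl⟩
    change Tendsto (fun i => funRep Φ π (ψ i) * π.hom ((Φ.hom φ).fst p')) l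
      (𝓝 (π.hom ((Φ.hom φ).fst p')))
    simp only [← funRep_mul_hom, ← mul_assoc, ← funRep_mul]
    exact (((continuous_funRep Φ π).tendsto _).comp (hψ φ)).mul_const _
  exact h3

theorem inIdeal_subset_leftFixed_funRep {ι : Type*} {l : Filter ι} {ψ : ι → C₀(E, ℂ)} {C : ℝ}
    (hψ1 : ∀ i, ‖ψ i‖ ≤ C) (hψ : ∀ φ, Tendsto (fun i => ψ i * φ) l (𝓝 φ)) :
    inIdeal J ⊆ leftFixed l (fun i => funRep Φ π (ψ i)) := by
  have hcl := isClosed_leftFixed (l := l) (f := fun i => funRep Φ π (ψ i)) (C := C)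
    (Eventually.of_forall fun i => (norm_funRep_le Φ π _).trans (hψ1 i))
  rintro _ ⟨j, rfl⟩
  have h1 : IsClosed {j : J | (j : 𝓜(ℂ, J)) ∈ leftFixed l (fun i => funRep Φ π (ψ i))} :=
    hcl.preimage isometry_coe.continuous
  refine (closure_minimal ?_ h1) (π.nondegenerate j)
  have h3 : (Submodule.span ℂ {a : J | ∃ b a', a = (π.hom b).fst a'}) ≤
      (leftFixed l (fun i => funRep Φ π (ψ i))).comap
        (DoubleCentralizer.coeHom (𝕜 := ℂ) (A := J) : J →ₗ[ℂ] 𝓜(ℂ, J)) := by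
    rw [Submodule.span_le]
    rintro _ ⟨p, a, rfl⟩
    change ((π.hom p).fst a : 𝓜(ℂ, J)) ∈ leftFixed l (fun i => funRep Φ π (ψ i))
    rw [← mul_coe]
    exact leftFixed_mul (hom_mem_leftFixed_funRep Φ π hψ1 hψ p) _
  exact h3

theorem norm_funRep_translate_le (g : G) (φ : C₀(E, ℂ)) :
    ‖funRep Φ π (translate g φ)‖ ≤ ‖φ‖ :=
  (norm_funRep_le Φ π _).trans (norm_translate_le g φ)

end FunRep

/-! ### Decay of translated functions at infinity of the group -/

section Vanishing

variable {G E J P : Type*} [Group G] [TopologicalSpace G] [TopologicalSpace E] [MulAction G E]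
  [ContinuousSMul G E] [ProperSMul G E] [NonUnitalCStarAlgebra J] [NonUnitalCStarAlgebra P]
  [GradedGAlgebra G P] [GradedGAlgebra G J] (Φ : ProperAlgebra G E P) (π : GRep G P J)

theorem tendsto_funRep_translate_mul {ψ : ℕ → C₀(E, ℂ)} (hψc : ∀ n, HasCompactSupport (ψ n))
    (hψ : ∀ φ, Tendsto (fun n => ψ n * φ) atTop (𝓝 φ)) (φ : C₀(E, ℂ)) {x : 𝓜(ℂ, J)}
    (hx : Tendsto (fun n => funRep Φ π (ψ n) * x) atTop (𝓝 x)) :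
    Tendsto (fun g : G => funRep Φ π (translate g φ) * x) (cocompact G) (𝓝 0) := by
  refine Metric.tendsto_nhds.2 fun ε hε => ?_
  -- Both `x` and `φ` are cut off to compact supports, `x` first, since the accuracy needed for `φ`
  -- depends on the norm of the cut-off `x`. The main term then vanishes for `g` outside a compact
  -- set.
  obtain ⟨n, hn⟩ := (Metric.tendsto_nhds.1 hx (ε / (2 * (‖φ‖ + 1))) (by positivity)).exists
  obtain ⟨m, hm⟩ := (Metric.tendsto_nhds.1 (hψ φ)
    (ε / (2 * (‖funRep Φ π (ψ n) * x‖ + 1))) (by positivity)).exists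
  have hmc : HasCompactSupport (ψ m * φ : C₀(E, ℂ)) := (hψc m).mul_right
  obtain ⟨K, hK, hKz⟩ := exists_isCompact_translate_mul_eq_zero (G := G) hmc (hψc n)
  filter_upwards [hK.compl_mem_cocompact] with g hg
  have h0 : funRep Φ π (translate g (ψ m * φ)) * (funRep Φ π (ψ n) * x) = 0 := by
    rw [← mul_assoc, ← funRep_mul, hKz g hg, funRep_zero, zero_mul]
  have h1 : funRep Φ π (translate g φ) * x
      = funRep Φ π (translate g (φ - ψ m * φ)) * (funRep Φ π (ψ n) * x)
        + funRep Φ π (translate g φ) * (x - funRep Φ π (ψ n) * x) := by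
    rw [translate_sub, funRep_sub, sub_mul, h0]
    noncomm_ring
  have h2 : ‖funRep Φ π (translate g (φ - ψ m * φ)) * (funRep Φ π (ψ n) * x)‖ < ε / 2 := by
    refine lt_of_le_of_lt (norm_mul_le _ _) ?_
    rw [dist_comm, dist_eq_norm] at hm
    calc _ ≤ ‖φ - ψ m * φ‖ * (‖funRep Φ π (ψ n) * x‖ + 1) := by
          gcongr
          · exact norm_funRep_translate_le Φ π g _
          · linarith
      _ < (ε / (2 * (‖funRep Φ π (ψ n) * x‖ + 1))) * (‖funRep Φ π (ψ n) * x‖ + 1) := by gcongr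
      _ = ε / 2 := by field_simp
  have h3 : ‖funRep Φ π (translate g φ) * (x - funRep Φ π (ψ n) * x)‖ < ε / 2 := by
    refine lt_of_le_of_lt (norm_mul_le _ _) ?_
    rw [dist_comm, dist_eq_norm] at hn
    calc _ ≤ (‖φ‖ + 1) * ‖x - funRep Φ π (ψ n) * x‖ := by
          gcongr
          exact (norm_funRep_translate_le Φ π g _).trans (by linarith)
      _ < (‖φ‖ + 1) * (ε / (2 * (‖φ‖ + 1))) := by gcongr
      _ = ε / 2 := by field_simp
  rw [dist_zero_right, h1]
  linarith [norm_add_le (funRep Φ π (translate g (φ - ψ m * φ)) * (funRep Φ π (ψ n) * x))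
    (funRep Φ π (translate g φ) * (x - funRep Φ π (ψ n) * x))]

theorem tendsto_funRep_translate_mul_hom [LocallyCompactSpace E] [T2Space E]
    [SigmaCompactSpace E] (φ : C₀(E, ℂ)) (p : P) :
    Tendsto (fun g : G => funRep Φ π (translate g φ) * π.hom p) (cocompact G) (𝓝 0) := by
  obtain ⟨ψ, hψc, hψ1, -, hψ⟩ := exists_cutoff_sequence (E := E)
  exact tendsto_funRep_translate_mul Φ π hψc hψ φ (hom_mem_leftFixed_funRep Φ π hψ1 hψ p)

end Vanishing

/-! ### Functions in C₀(G, J) and the strict resolution of unity by the cut-off function -/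

section Decay

variable {G E J P : Type*} [Group G] [TopologicalSpace G] [IsTopologicalGroup G]
  [LocallyCompactSpace G] [TopologicalSpace E] [MulAction G E]
  [ContinuousSMul G E] [NonUnitalCStarAlgebra J] [NonUnitalCStarAlgebra P]
  [GradedGAlgebra G P] [GradedGAlgebra G J]
  (Φ : ProperAlgebra G E P) (π : GRep G P J)

theorem continuous_funRep_translate (φ : C₀(E, ℂ)) :
    Continuous fun g : G => funRep Φ π (translate g φ) :=
  (continuous_funRep Φ π).comp (continuous_translate φ)

variable [ProperSMul G E] [LocallyCompactSpace E] [T2Space E] [SigmaCompactSpace E]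

theorem memC₀_funRep_translate_mul (φ : C₀(E, ℂ)) {x : 𝓜(ℂ, J)} (hx : x ∈ inIdeal J) :
    MemC₀ fun g : G => funRep Φ π (translate g φ) * x := by
  obtain ⟨ψ, hψc, hψ1, -, hψ⟩ := exists_cutoff_sequence (E := E)
  exact memC₀_iff.2 ⟨(continuous_funRep_translate Φ π φ).mul continuous_const,
    fun g => inIdeal_mul_left _ hx, tendsto_funRep_translate_mul Φ π hψc hψ φ
      (inIdeal_subset_leftFixed_funRep Φ π hψ1 hψ hx)⟩

theorem memC₀_mul_funRep_translate (φ : C₀(E, ℂ)) {x : 𝓜(ℂ, J)} (hx : x ∈ inIdeal J) :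
    MemC₀ fun g : G => x * funRep Φ π (translate g φ) := by
  have h := memC₀_iff.1 (memC₀_funRep_translate_mul (G := G) Φ π (star φ) (inIdeal_star hx))
  refine memC₀_iff.2 ⟨continuous_const.mul (continuous_funRep_translate Φ π φ),
    fun g => inIdeal_mul_right hx _, ?_⟩
  have h1 := h.2.2.star
  rw [star_zero] at h1
  refine h1.congr fun g => ?_
  rw [star_mul, star_star, ← funRep_star, ← translate_star, star_star]

theorem memC₀_commutator_funRep_translate (φ : C₀(E, ℂ)) {x : 𝓜(ℂ, J)} (hx : x ∈ inIdeal J) :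
    MemC₀ fun g : G => x * funRep Φ π (translate g φ) - funRep Φ π (translate g φ) * x := by
  simp only [sub_eq_add_neg]
  exact (memC₀_mul_funRep_translate Φ π φ hx).add (memC₀_funRep_translate_mul Φ π φ hx).neg

variable [MeasurableSpace G] [BorelSpace G] [T2Space G] (μ : Measure G)
  [IsFiniteMeasureOnCompacts μ]

theorem isCutoff_tendsto {c : C(E, ℝ)} (hc : IsCutoff μ c) {x : 𝓜(ℂ, J)} (hx : x ∈ inIdeal J) :
    Tendsto (fun K : TopologicalSpace.Compacts G =>
      (∫ g in K, funRep Φ π (translate g (toC₀ c hc.compactSupport)) *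
        funRep Φ π (translate g (toC₀ c hc.compactSupport)) ∂μ) * x) atTop (𝓝 x) := by
  set c' := toC₀ c hc.compactSupport with hc'
  have hcts : Continuous fun g : G => translate g (c' * c') := continuous_translate _
  have hint : ∀ K : TopologicalSpace.Compacts G,
      IntegrableOn (fun g : G => translate g (c' * c')) K μ := fun K =>
    hcts.continuousOn.integrableOn_compact K.isCompact
  -- The integral is formed in C₀(E) first. There `κ K` has norm at most 1, and by properness `κ K *
  -- ψ = ψ` for compactly supported ψ as soon as `K` is large; density and boundedness do the rest.
  let κ : TopologicalSpace.Compacts G → C₀(E, ℂ) := fun K => ∫ g in K, translate g (c' * c') ∂μ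
  let ρ : C₀(E, ℂ) →L[ℂ] 𝓜(ℂ, J) :=
    ⟨(funRepHom Φ π : C₀(E, ℂ) →ₗ[ℂ] 𝓜(ℂ, J)), continuous_funRep Φ π⟩
  have hρκ : ∀ K : TopologicalSpace.Compacts G, (∫ g in K, funRep Φ π (translate g c') *
        funRep Φ π (translate g c') ∂μ) = funRep Φ π (κ K) := fun K => by
    have h := ρ.integral_comp_comm (hint K)
    change _ = ρ (κ K)
    rw [← h]
    refine integral_congr_ae (Eventually.of_forall fun g => ?_)
    exact (funRep_mul Φ π _ _).symm
  let ev : E → C₀(E, ℂ) →L[ℂ] ℂ := fun x => LinearMap.mkContinuous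
    { toFun := fun φ => φ x, map_add' := fun _ _ => rfl, map_smul' := fun _ _ => rfl } 1
    fun φ => by rw [one_mul]; exact zeroAtInfty_norm_apply_le φ x
  have hκ : ∀ (K : TopologicalSpace.Compacts G) x,
      κ K x = ((∫ g in K, c (g⁻¹ • x) ^ 2 ∂μ : ℝ) : ℂ) := fun K x => by
    have h := (ev x).integral_comp_comm (hint K)
    change ev x (κ K) = _
    rw [← h, ← integral_complex_ofReal]
    refine integral_congr_ae (Eventually.of_forall fun g => ?_)
    change (c (g⁻¹ • x) : ℂ) * (c (g⁻¹ • x) : ℂ) = _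
    push_cast
    ring
  have hci : ∀ x, Integrable (fun g : G => c (g⁻¹ • x) ^ 2) μ := fun x => by
    by_contra h
    have := hc.integral_eq_one x
    rw [integral_undef h] at this
    exact zero_ne_one this
  have hκ1 : ∀ K, ‖κ K‖ ≤ 1 := fun K => by
    refine (zeroAtInfty_norm_le zero_le_one).2 fun x => ?_
    rw [hκ, Complex.norm_real, Real.norm_of_nonneg (integral_nonneg fun g => sq_nonneg _),
      ← hc.integral_eq_one x]
    exact setIntegral_le_integral (hci x) (Eventually.of_forall fun g => sq_nonneg _)
  have hκψ : ∀ ψ : C₀(E, ℂ), HasCompactSupport ψ → ∀ᶠ K in atTop, κ K * ψ = ψ := fun ψ hψ => by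
    obtain ⟨K₀, hK₀, hK₀z⟩ := exists_isCompact_smul_disjoint (G := G) hc.compactSupport hψ
    filter_upwards [Ici_mem_atTop (⟨K₀, hK₀⟩ : TopologicalSpace.Compacts G)] with K hK
    ext x
    rw [ZeroAtInftyContinuousMap.mul_apply]
    by_cases hx : x ∈ tsupport ψ
    · have : ∫ g in K, c (g⁻¹ • x) ^ 2 ∂μ = 1 := by
        rw [← hc.integral_eq_one x]
        refine setIntegral_eq_integral_of_forall_compl_eq_zero fun g hg => ?_
        rw [image_eq_zero_of_notMem_tsupport (hK₀z g (fun h => hg (hK h)) x hx)]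
        norm_num
      rw [hκ, this]
      simp
    · rw [image_eq_zero_of_notMem_tsupport hx, mul_zero]
  obtain ⟨ψ, hψc, hψ1, -, hψ⟩ := exists_cutoff_sequence (E := E)
  have hcl : IsClosed (leftFixed (atTop : Filter (TopologicalSpace.Compacts G))
      (fun K => funRep Φ π (κ K)) : Set 𝓜(ℂ, J)) := isClosed_leftFixed (C := 1)
    (Eventually.of_forall fun K => (norm_funRep_le Φ π _).trans (hκ1 K))
  simp only [hρκ]
  refine mem_leftFixed.1 (hcl.mem_of_tendsto (mem_leftFixed.1
    (inIdeal_subset_leftFixed_funRep Φ π hψ1 hψ hx)) (Eventually.of_forall fun n => ?_))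
  refine leftFixed_mul (mem_leftFixed.2 (tendsto_const_nhds.congr' ?_)) x
  filter_upwards [hκψ _ (hψc n)] with K hK
  rw [← funRep_mul, hK]

end Decay

/-! ### Convex combinations of approximate units -/

section Convex

variable {M : Type*} [CStarAlgebra M]

theorem exists_forall_norm_mul_sub_le {f : ℕ → M} (hf : ∀ i, ‖f i‖ ≤ 1) {Q : Set M}
    (hQ : IsCompact Q) (hQf : Q ⊆ leftFixed atTop f) {ε : ℝ} (hε : 0 < ε) :
    ∃ N, ∀ j ≥ N, ∀ b ∈ Q, ‖f j * b - b‖ ≤ ε := by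
  obtain ⟨t, htQ, htf, ht⟩ := hQ.finite_cover_balls (show 0 < ε / 3 by positivity)
  have h : ∀ᶠ j in atTop, ∀ b ∈ t, ‖f j * b - b‖ ≤ ε / 3 := by
    refine (htf.eventually_all).2 fun b hb => ?_
    filter_upwards [Metric.tendsto_nhds.1 (hQf (htQ hb)) (ε / 3) (by positivity)] with j hj
    rw [dist_eq_norm] at hj
    exact hj.le
  obtain ⟨N, hN⟩ := eventually_atTop.1 h
  refine ⟨N, fun j hj b hb => ?_⟩
  obtain ⟨b', hb', hbb'⟩ := Set.mem_iUnion₂.1 (ht hb)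
  rw [Metric.mem_ball, dist_eq_norm] at hbb'
  have h1 : f j * b - b = f j * (b - b') + (f j * b' - b') - (b - b') := by noncomm_ring
  have h2 : ‖f j * (b - b')‖ ≤ ‖b - b'‖ :=
    (norm_mul_le _ _).trans (mul_le_of_le_one_left (norm_nonneg _) (hf j))
  rw [h1]
  linarith [norm_sub_le (f j * (b - b') + (f j * b' - b')) (b - b'),
    norm_add_le (f j * (b - b')) (f j * b' - b'), hN j hj b' hb']

theorem convexHull_norm_le {s : Set M} {C : ℝ} (hs : ∀ u ∈ s, ‖u‖ ≤ C) {u : M}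
    (hu : u ∈ convexHull ℝ s) : ‖u‖ ≤ C := by
  have h : convexHull ℝ s ⊆ Metric.closedBall 0 C :=
    convexHull_min (fun u hu => by simpa using hs u hu) (convex_closedBall _ _)
  simpa using h hu

/-- The condition cuts out a closed ball pulled back along a linear map, hence a convex set. The
neighbouring lemmas have the same reason: every property asked of an approximate unit must survive
averaging. -/
theorem convexHull_norm_mul_sub_le {s : Set M} {b c : M} {ε : ℝ}
    (hs : ∀ u ∈ s, ‖u * b - c‖ ≤ ε) {u : M} (hu : u ∈ convexHull ℝ s) : ‖u * b - c‖ ≤ ε := by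
  have h : convexHull ℝ s ⊆ (LinearMap.mulRight ℝ b) ⁻¹' Metric.closedBall c ε :=
    convexHull_min (fun u hu => by simpa [dist_eq_norm] using hs u hu)
      ((convex_closedBall _ _).linear_preimage _)
  simpa [dist_eq_norm] using h hu

/-- The twisted commutator as a linear map. -/
noncomputable def twistLinear (t : (M →⋆ₐ[ℂ] M) × M) : M →ₗ[ℝ] M where
  toFun := twist t
  map_add' x y := by simp only [twist, map_add]; noncomm_ring
  map_smul' a x := by
    have h : t.1 (a • x) = a • t.1 x := by
      rw [← Complex.coe_smul, map_smul, Complex.coe_smul]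
    simp only [twist, h, smul_mul_assoc, mul_smul_comm, smul_sub, RingHom.id_apply]

@[simp] theorem twistLinear_apply (t : (M →⋆ₐ[ℂ] M) × M) (x : M) :
    twistLinear t x = twist t x := rfl

theorem convexHull_norm_twist_le {s : Set M} {t : (M →⋆ₐ[ℂ] M) × M} {ε : ℝ}
    (hs : ∀ u ∈ s, ‖twist t u‖ ≤ ε) {u : M} (hu : u ∈ convexHull ℝ s) : ‖twist t u‖ ≤ ε := by
  have h : convexHull ℝ s ⊆ (twistLinear t) ⁻¹' Metric.closedBall 0 ε :=
    convexHull_min (fun u hu => by simpa using hs u hu)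
      ((convex_closedBall _ _).linear_preimage _)
  simpa using h hu

theorem convexHull_isSelfAdjoint {s : Set M} (hs : ∀ u ∈ s, IsSelfAdjoint u) {u : M}
    (hu : u ∈ convexHull ℝ s) : IsSelfAdjoint u := by
  have h : convexHull ℝ s ⊆ {u | IsSelfAdjoint u} :=
    convexHull_min hs fun x hx y hy a b _ _ _ =>
      ((IsSelfAdjoint.all a).smul hx).add ((IsSelfAdjoint.all b).smul hy)
  exact h hu

theorem convexHull_mem_submodule {s : Set M} {V : Submodule ℂ M} (hs : ∀ u ∈ s, u ∈ V) {u : M}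
    (hu : u ∈ convexHull ℝ s) : u ∈ V := by
  have h : convexHull ℝ s ⊆ (V.restrictScalars ℝ : Set M) :=
    convexHull_min hs (V.restrictScalars ℝ).convex
  exact h hu

theorem convexHull_map_eq {s : Set M} (α : M →⋆ₐ[ℂ] M) (hs : ∀ u ∈ s, α u = u) {u : M}
    (hu : u ∈ convexHull ℝ s) : α u = u := by
  have h := convexHull_norm_twist_le (t := (α, 1)) (ε := 0) (s := s) (fun u hu => by
    simp [twist, hs u hu]) hu
  simpa [twist, sub_eq_zero] using h

theorem leftFixed_le_of_mem_convexHull {w v : ℕ → M}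
    (hv : ∀ n, v n ∈ convexHull ℝ (w '' Set.Ici n)) :
    leftFixed atTop w ≤ leftFixed atTop v := by
  intro x hx
  refine Metric.tendsto_atTop.2 fun ε hε => ?_
  obtain ⟨N, hN⟩ := Metric.tendsto_atTop.1 (mem_leftFixed.1 hx) (ε / 2) (half_pos hε)
  refine ⟨N, fun n hn => ?_⟩
  rw [dist_eq_norm]
  refine lt_of_le_of_lt (convexHull_norm_mul_sub_le ?_ (hv n)) (half_lt_self hε)
  rintro _ ⟨k, hk, rfl⟩
  rw [← dist_eq_norm]
  exact (hN k (hn.trans hk)).le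

theorem mem_leftFixed_mul {ι : Type*} {l : Filter ι} {f g : ι → M} (hf : ∀ i, ‖f i‖ ≤ 1)
    {x : M} (hx : x ∈ leftFixed l f) (hx' : x ∈ leftFixed l g) :
    x ∈ leftFixed l (fun i => f i * g i) := by
  rw [mem_leftFixed, tendsto_iff_norm_sub_tendsto_zero] at *
  refine squeeze_zero (fun i => norm_nonneg _) (fun i => ?_) (by simpa using hx'.add hx)
  have h1 : f i * g i * x - x = f i * (g i * x - x) + (f i * x - x) := by noncomm_ring
  rw [h1]
  refine (norm_add_le _ _).trans (add_le_add_left ?_ _)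
  exact (norm_mul_le _ _).trans (mul_le_of_le_one_left (norm_nonneg _) (hf i))

/-- Averages of an approximate unit almost commute with prescribed elements. -/
theorem exists_convexHull_twist_le {w : ℕ → M} (hsa : ∀ i, IsSelfAdjoint (w i))
    (hw : ∀ i, ‖w i‖ ≤ 1) {S : Set ((M →⋆ₐ[ℂ] M) × M)} {C : ℝ} (hS : ∀ t ∈ S, ‖t.2‖ ≤ C)
    (h : ∀ i, ∀ ε > 0, ∃ N, ∀ j ≥ N, ∀ t ∈ S,
      ‖twist t (w i) * star t.2 * t.1 (w j) - twist t (w i) * star t.2‖ ≤ ε ∧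
      ‖twist t (w i) * w j - twist t (w i)‖ ≤ ε) (n₀ : ℕ) {ε : ℝ} (hε : 0 < ε) :
    ∃ u ∈ convexHull ℝ (w '' Set.Ici n₀), ∀ t ∈ S, ‖twist t u‖ ≤ ε := by
  have hα : ∀ (t : (M →⋆ₐ[ℂ] M) × M) i, ‖t.1 (w i)‖ ≤ 1 := fun t i =>
    (NonUnitalStarAlgHom.norm_apply_le t.1 _).trans (hw i)
  have hb : ∀ i, ∀ t : S, ‖twist t.1 (w i)‖ ≤ 2 * max C 0 := fun i t => by
    have h1 := (norm_mul_le (t.1.1 (w i)) t.1.2).trans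
      (mul_le_of_le_one_left (norm_nonneg _) (hα t.1 i))
    have h2 := (norm_mul_le t.1.2 (w i)).trans (mul_le_of_le_one_right (norm_nonneg _) (hw i))
    have h3 := (hS t.1 t.2).trans (le_max_left C 0)
    exact (norm_sub_le _ _).trans (by linarith)
  obtain ⟨m, hm, k, hk, hy⟩ := exists_average_norm_le (fun i (t : S) => twist t.1 (w i)) _ hb
    (fun i ε hε => by
      obtain ⟨N, hN⟩ := h i (ε / (1 + max C 0)) (by positivity)
      refine ⟨N, fun j hj t => ?_⟩
      obtain ⟨h1, h2⟩ := hN j hj t.1 t.2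
      set τ := twist t.1 (w i)
      have h3 : τ * star (twist t.1 (w j)) = (τ * star t.1.2 * t.1.1 (w j) - τ * star t.1.2)
          - (τ * w j - τ) * star t.1.2 := by
        simp only [twist, star_sub, star_mul, (hsa j).star_eq, ((hsa j).map t.1.1).star_eq]
        noncomm_ring
      rw [h3]
      refine (norm_sub_le _ _).trans ?_
      have h4 : ‖(τ * w j - τ) * star t.1.2‖ ≤ ε / (1 + max C 0) * max C 0 := by
        refine (norm_mul_le _ _).trans ?_
        rw [norm_star]
        gcongr
        exact (hS t.1 t.2).trans (le_max_left C 0)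
      calc _ ≤ ε / (1 + max C 0) + ε / (1 + max C 0) * max C 0 := add_le_add h1 h4
        _ = ε := by field_simp) n₀ hε
  have hm' : (0 : ℝ) < m := by exact_mod_cast hm
  refine ⟨∑ i ∈ Finset.range m, (m : ℝ)⁻¹ • w (k i), ?_, fun t ht => ?_⟩
  · refine (convex_convexHull ℝ _).sum_mem (fun i _ => by positivity) ?_ fun i _ =>
      subset_convexHull ℝ _ ⟨k i, hk i, rfl⟩
    simp [hm.ne']
  · rw [← twistLinear_apply, map_sum]
    simp only [map_smul, twistLinear_apply]
    rw [← Finset.smul_sum, norm_smul, norm_inv, Real.norm_of_nonneg hm'.le,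
      inv_mul_le_iff₀ hm', mul_comm]
    exact hy ⟨t, ht⟩

end Convex

/-! ### Approximate units of the ideal -/

section IdealUnit

variable {G J : Type*} [Group G] [TopologicalSpace G] [NonUnitalCStarAlgebra J]
  [GradedGAlgebra G J]

variable (G J) in
/-- A sequence of even self-adjoint contractions in `J` that is an approximate unit of `J`. -/
structure IsIdealUnit (w : ℕ → 𝓜(ℂ, J)) : Prop where
  isSelfAdjoint : ∀ i, IsSelfAdjoint (w i)
  norm_le : ∀ i, ‖w i‖ ≤ 1
  mem : ∀ i, w i ∈ inIdeal J
  even : ∀ i, mGrading G (w i) = w i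
  subset : inIdeal J ⊆ leftFixed atTop w

theorem IsIdealUnit.of_mem_convexHull {w v : ℕ → 𝓜(ℂ, J)} (hw : IsIdealUnit G J w)
    (hv : ∀ n, v n ∈ convexHull ℝ (w '' Set.Ici n)) : IsIdealUnit G J v where
  isSelfAdjoint n := convexHull_isSelfAdjoint
    (by rintro _ ⟨k, -, rfl⟩; exact hw.isSelfAdjoint k) (hv n)
  norm_le n := convexHull_norm_le (by rintro _ ⟨k, -, rfl⟩; exact hw.norm_le k) (hv n)
  mem n := convexHull_mem_submodule (V := idealSubmodule J)
    (by rintro _ ⟨k, -, rfl⟩; exact hw.mem k) (hv n)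
  even n := convexHull_map_eq (mGradingHom G) (by rintro _ ⟨k, -, rfl⟩; exact hw.even k) (hv n)
  subset := hw.subset.trans (leftFixed_le_of_mem_convexHull hv)

/-- Averaging the given unit with its image under the grading makes it even. -/
theorem exists_isIdealUnit (hJ : IsSigmaUnital J) : ∃ w, IsIdealUnit G J w := by
  obtain ⟨u, hu, hu'⟩ := hJ
  let γ : J ≃⋆ₐ[ℂ] J := GradedGAlgebra.grading G
  have hγγ : ∀ a, γ (γ a) = a := GradedGAlgebra.grading_grading
  have hγ1 : ∀ a, ‖γ a‖ = ‖a‖ := StarAlgEquiv.norm_map γ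
  have hsa : ∀ n, star (u n) = u n := fun n => by
    obtain ⟨b, hb⟩ := (hu n).1
    rw [hb, star_mul, star_star]
  let v : ℕ → J := fun n => (1 / 2 : ℂ) • (u n + γ (u n))
  refine ⟨fun n => v n, fun n => ?_, fun n => ?_, fun n => ⟨_, rfl⟩, fun n => ?_, ?_⟩
  · rw [IsSelfAdjoint, ← coe_star]
    congr 1
    simp only [v, star_smul, star_add, hsa, ← map_star]
    norm_num
  · rw [norm_coe]
    have h := norm_add_le (u n) (γ (u n))
    rw [hγ1] at h
    rw [norm_smul]
    norm_num
    linarith [(hu n).2]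
  · rw [mGrading, mulExt_coe]
    congr 1
    change γ (v n) = v n
    simp only [v, map_smul, map_add, hγγ, add_comm]
  · rintro _ ⟨j, rfl⟩
    have h1 : Tendsto (fun n => u n * j) atTop (𝓝 j) := (hu' j).1
    have h2 : Tendsto (fun n => γ (u n) * j) atTop (𝓝 j) := by
      have h3 := (((map_continuous γ).tendsto _).comp (hu' (γ j)).1)
      simpa only [Function.comp_def, map_mul, hγγ] using h3
    have h3 := ((h1.add h2).const_smul (1 / 2 : ℂ))
    have h4 : (1 / 2 : ℂ) • (j + j) = j := by
      rw [← two_smul ℂ, smul_smul]; norm_num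
    rw [h4] at h3
    refine ((isometry_coe.continuous.tendsto _).comp h3).congr fun n => ?_
    simp only [Function.comp_def, coe_coe_mul, v, smul_mul_assoc, add_mul]

theorem IsIdealUnit.exists_twist_le [IsTopologicalGroup G] {w : ℕ → 𝓜(ℂ, J)}
    (hw : IsIdealUnit G J w)
    {K : Set (G × 𝓜(ℂ, J))} (hK : IsCompact K) (n₀ : ℕ) {ε : ℝ} (hε : 0 < ε) :
    ∃ u ∈ convexHull ℝ (w '' Set.Ici n₀), ∀ p ∈ K, ‖twist (mActHom p.1, p.2) u‖ ≤ ε := by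
  have hc : ∀ i, Continuous fun p : G × 𝓜(ℂ, J) => twist (mActHom p.1, p.2) (w i) := fun i =>
    (((continuous_mAct (hw.mem i)).comp continuous_fst).mul continuous_snd).sub
      (continuous_snd.mul continuous_const)
  have hm : ∀ i (p : G × 𝓜(ℂ, J)), twist (mActHom p.1, p.2) (w i) ∈ inIdeal J := fun i p =>
    inIdeal_sub (inIdeal_mul_right (mAct_mem_inIdeal _ (hw.mem i)) _)
      (inIdeal_mul_left _ (hw.mem i))
  obtain ⟨C, hC⟩ := (hK.image continuous_snd).isBounded.exists_norm_le
  obtain ⟨u, hu, hut⟩ := exists_convexHull_twist_le hw.isSelfAdjoint hw.norm_le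
    (S := (fun p : G × 𝓜(ℂ, J) => (mActHom p.1, p.2)) '' K) (C := C)
    (by rintro _ ⟨p, hp, rfl⟩; exact hC _ ⟨p, hp, rfl⟩) (fun i ε hε => by
      -- Being almost fixed on the right by g(wⱼ) becomes, after applying g⁻¹ and taking adjoints,
      -- being almost fixed on the left by wⱼ. Uniformity then holds on the compact image of `K`.
      let F₁ : G × 𝓜(ℂ, J) → 𝓜(ℂ, J) := fun p =>
        star (mAct p.1⁻¹ (twist (mActHom p.1, p.2) (w i) * star p.2))
      let F₂ : G × 𝓜(ℂ, J) → 𝓜(ℂ, J) := fun p => star (twist (mActHom p.1, p.2) (w i))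
      have hF₁ : Continuous F₁ := (continuousOn_mAct continuous_fst.inv
        ((hc i).mul continuous_snd.star)
        fun p => continuous_mAct (inIdeal_mul_right (hm i p) _)).star
      have hF₂ : Continuous F₂ := (hc i).star
      obtain ⟨N₁, hN₁⟩ := exists_forall_norm_mul_sub_le hw.norm_le (hK.image hF₁)
        (Set.Subset.trans (by
          rintro _ ⟨p, -, rfl⟩
          exact inIdeal_star (mAct_mem_inIdeal _ (inIdeal_mul_right (hm i p) _))) hw.subset) hε
      obtain ⟨N₂, hN₂⟩ := exists_forall_norm_mul_sub_le hw.norm_le (hK.image hF₂)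
        (Set.Subset.trans (by
          rintro _ ⟨p, -, rfl⟩
          exact inIdeal_star (hm i p)) hw.subset) hε
      refine ⟨max N₁ N₂, ?_⟩
      rintro j hj _ ⟨p, hp, rfl⟩
      have h1 := hN₁ j ((le_max_left _ _).trans hj) _ ⟨p, hp, rfl⟩
      have h2 := hN₂ j ((le_max_right _ _).trans hj) _ ⟨p, hp, rfl⟩
      constructor
      · rw [← norm_star, ← norm_mAct p.1] at h1
        refine le_of_eq_of_le (congrArg norm ?_) h1
        simp only [F₁, star_sub, star_mul, star_star, (hw.isSelfAdjoint j).star_eq]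
        rw [← mActHom_apply p.1, map_sub, map_mul]
        simp only [mActHom_apply, mAct_mAct_inv]
      · rw [← norm_star] at h2
        simpa only [F₂, star_sub, star_mul, star_star, (hw.isSelfAdjoint j).star_eq] using h2)
    n₀ hε
  exact ⟨u, hu, fun p hp => hut _ ⟨p, hp, rfl⟩⟩

end IdealUnit

/-! ### Positive contractions -/

section Positive

variable {M : Type*} [CStarAlgebra M]

theorem norm_one_sub_le_of_star_mul_self {b : M} (hb : ‖star b * b‖ ≤ 1) :
    ‖1 - star b * b‖ ≤ 1 := by
  let _ := CStarAlgebra.spectralOrder M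
  have _ := CStarAlgebra.spectralOrderedRing M
  have h := (CStarAlgebra.norm_le_one_iff_of_nonneg _ (star_mul_self_nonneg b)).1 hb
  exact (CStarAlgebra.norm_le_one_iff_of_nonneg _ (sub_nonneg.2 h)).2
    (sub_le_self _ (star_mul_self_nonneg b))

/-- For a self-adjoint contraction, ‖1 - x‖ ≤ 1 forces the spectrum to be non-negative. Positivity
is carried in this form because norm bounds pass to convex hulls and strict limits. -/
theorem exists_eq_star_mul_self {x : M} (hx : IsSelfAdjoint x) (hx1 : ‖x‖ ≤ 1)
    (hx1' : ‖1 - x‖ ≤ 1) : ∃ b, x = star b * b := by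
  let _ := CStarAlgebra.spectralOrder M
  have _ := CStarAlgebra.spectralOrderedRing M
  have h := (SpectrumRestricts.nnreal_iff_nnnorm (t := 1) hx hx1).2 (by
    rw [← NNReal.coe_le_coe]
    simpa using hx1')
  have h0 : 0 ≤ x := (nonneg_iff_isSelfAdjoint_and_quasispectrumRestricts).2 ⟨hx, h⟩
  exact CStarAlgebra.nonneg_iff_eq_star_mul_self.1 h0

/-- From 0 ≤ aₙ ≤ 1 the sum lies between 0 and ∑ Dₙ* Dₙ, which telescopes to 1 - r_N* r_N ≤ 1. -/
theorem norm_sum_conjugate_le {D a r : ℕ → M} (hr0 : r 0 = 1)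
    (hD : ∀ n, star (D n) * D n = star (r n) * r n - star (r (n + 1)) * r (n + 1))
    (ha : ∀ n, IsSelfAdjoint (a n)) (ha1 : ∀ n, ‖a n‖ ≤ 1) (ha1' : ∀ n, ‖1 - a n‖ ≤ 1) (N : ℕ) :
    ‖∑ n ∈ Finset.range N, star (D n) * a n * D n‖ ≤ 1 ∧
      ‖1 - ∑ n ∈ Finset.range N, star (D n) * a n * D n‖ ≤ 1 := by
  let _ := CStarAlgebra.spectralOrder M
  have _ := CStarAlgebra.spectralOrderedRing M
  have ha0 : ∀ n, 0 ≤ a n := fun n => by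
    obtain ⟨b, hb⟩ := exists_eq_star_mul_self (ha n) (ha1 n) (ha1' n)
    rw [hb]
    exact star_mul_self_nonneg b
  have ha2 : ∀ n, a n ≤ 1 := fun n =>
    (CStarAlgebra.norm_le_one_iff_of_nonneg _ (ha0 n)).1 (ha1 n)
  have h0 : 0 ≤ ∑ n ∈ Finset.range N, star (D n) * a n * D n :=
    Finset.sum_nonneg fun n _ => star_left_conjugate_nonneg (ha0 n) _
  have h1 : ∑ n ∈ Finset.range N, star (D n) * a n * D n ≤ 1 := by
    calc _ ≤ ∑ n ∈ Finset.range N, star (D n) * D n := Finset.sum_le_sum fun n _ => by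
          simpa using star_left_conjugate_le_conjugate (ha2 n) (D n)
      _ = 1 - star (r N) * r N := by
          rw [Finset.sum_congr rfl fun n _ => hD n, Finset.sum_range_sub', hr0]
          simp
      _ ≤ 1 := sub_le_self _ (star_mul_self_nonneg _)
  exact ⟨(CStarAlgebra.norm_le_one_iff_of_nonneg _ h0).2 h1,
    (CStarAlgebra.norm_le_one_iff_of_nonneg _ (sub_nonneg.2 h1)).2 (sub_le_self _ h0)⟩

end Positive

/-! ### A localized approximate unit -/

section Localized

variable {G E J P : Type*} [Group G] [TopologicalSpace G] [TopologicalSpace E] [MulAction G E]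
  [ContinuousConstSMul G E] [NonUnitalCStarAlgebra J] [NonUnitalCStarAlgebra P]
  [GradedGAlgebra G P] [GradedGAlgebra G J]
  (Φ : ProperAlgebra G E P) (π : GRep G P J)

/-- A multiplier that commutes with all translates of a compactly supported function by group
elements outside a compact set. -/
def IsLocalized (x : 𝓜(ℂ, J)) : Prop :=
  ∀ φ : C₀(E, ℂ), HasCompactSupport φ → ∃ K : Set G, IsCompact K ∧ ∀ g ∉ K,
    Commute x (funRep Φ π (translate g φ))

theorem IsLocalized.one : IsLocalized Φ π 1 := fun _ _ =>
  ⟨∅, isCompact_empty, fun _ _ => Commute.one_left _⟩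

variable {Φ π} in
theorem IsLocalized.mul {x y : 𝓜(ℂ, J)} (hx : IsLocalized Φ π x) (hy : IsLocalized Φ π y) :
    IsLocalized Φ π (x * y) := fun φ hφ => by
  obtain ⟨K, hK, h⟩ := hx φ hφ
  obtain ⟨L, hL, h'⟩ := hy φ hφ
  exact ⟨K ∪ L, hK.union hL, fun g hg => (h g fun hh => hg (.inl hh)).mul_left
    (h' g fun hh => hg (.inr hh))⟩

variable {Φ π} in
theorem IsLocalized.quarterCos {u : 𝓜(ℂ, J)} (hu : IsLocalized Φ π u) (hu1 : ‖u‖ ≤ 1) :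
    IsLocalized Φ π (quarterCos u) := fun φ hφ => by
  obtain ⟨K, hK, h⟩ := hu φ hφ
  refine ⟨K, hK, fun g hg => sub_eq_zero.1 (norm_le_zero_iff.1 ?_)⟩
  refine (norm_quarterCos_mul_sub_le _ hu1 hu1).trans ?_
  rw [(h g hg).eq, sub_self, norm_zero, mul_zero]

theorem convexHull_isLocalized {s : Set 𝓜(ℂ, J)} (hs : ∀ u ∈ s, IsLocalized Φ π u)
    {u : 𝓜(ℂ, J)} (hu : u ∈ convexHull ℝ s) : IsLocalized Φ π u := by
  have h : convexHull ℝ s ⊆ {u | IsLocalized Φ π u} :=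
    convexHull_min hs fun x hx y hy a b _ _ _ φ hφ => by
      obtain ⟨K, hK, h⟩ := hx φ hφ
      obtain ⟨L, hL, h'⟩ := hy φ hφ
      exact ⟨K ∪ L, hK.union hL, fun g hg => ((h g fun hh => hg (.inl hh)).smul_left a).add_left
        ((h' g fun hh => hg (.inr hh)).smul_left b)⟩
  exact h hu

end Localized

section LocalizedUnit

variable {G E J P : Type*} [Group G] [TopologicalSpace G] [IsTopologicalGroup G]
  [LocallyCompactSpace G] [TopologicalSpace E] [MulAction G E]
  [ContinuousSMul G E] [NonUnitalCStarAlgebra J] [NonUnitalCStarAlgebra P]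
  [GradedGAlgebra G P] [GradedGAlgebra G J]
  [ProperSMul G E] [LocallyCompactSpace E] [T2Space E] [SigmaCompactSpace E]
  (Φ : ProperAlgebra G E P) (π : GRep G P J)

/-- Compress an approximate unit as ψⱼ vⱼ ψⱼ with compactly supported ψⱼ. If g(φ) ψⱼ = 0 the
commutator with g(φ) is exactly zero, and by properness this fails only on a compact set of g, where
averaging applies and `l` has a positive lower bound. Functions commute with each other, so
compression does not enlarge commutators. -/
theorem exists_localized_unit (hJ : IsSigmaUnital J) {φ : ℕ → C₀(E, ℂ)}
    (hφ : ∀ k, HasCompactSupport (φ k)) {l : G → ℝ} (hl : ∀ g, 0 < l g)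
    (hlK : ∀ K, IsCompact K → ∃ δ > 0, ∀ g ∈ K, δ ≤ l g) :
    ∃ u : ℕ → 𝓜(ℂ, J), IsIdealUnit G J u ∧ (∀ j, IsLocalized Φ π (u j)) ∧
      ∀ j, ∀ k ≤ j, ∀ g, ‖u j * funRep Φ π (translate g (φ k))
        - funRep Φ π (translate g (φ k)) * u j‖ ≤ (1 / 2) ^ j * l g := by
  obtain ⟨w, hw⟩ := exists_isIdealUnit (G := G) hJ
  obtain ⟨ψ, hψc, hψ1, hψs, hψ⟩ := exists_cutoff_sequence (E := E)
  choose K hK hKz using fun j k => exists_isCompact_translate_mul_eq_zero (G := G) (hφ k) (hψc j)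
  have hstep : ∀ j, ∃ v ∈ convexHull ℝ (w '' Set.Ici j), ∀ k ≤ j, ∀ g ∈ K j k,
      ‖v * funRep Φ π (translate g (φ k)) - funRep Φ π (translate g (φ k)) * v‖
        ≤ (1 / 2) ^ j * l g := fun j => by
    have hKj : IsCompact (⋃ k ∈ Set.Iic j, K j k) :=
      (Set.finite_Iic j).isCompact_biUnion fun k _ => hK j k
    obtain ⟨δ, hδ, hδl⟩ := hlK _ hKj
    have hQ : IsCompact (⋃ k ∈ Set.Iic j, (fun g : G =>
        ((1 : G), funRep Φ π (translate g (φ k)))) '' K j k) :=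
      (Set.finite_Iic j).isCompact_biUnion fun k _ => (hK j k).image
        (continuous_const.prodMk (continuous_funRep_translate Φ π _))
    obtain ⟨v, hv, hvt⟩ := hw.exists_twist_le hQ j (show 0 < (1 / 2) ^ j * δ by positivity)
    refine ⟨v, hv, fun k hk g hg => ?_⟩
    have h1 := hvt _ (Set.mem_iUnion₂.2 ⟨k, hk, g, hg, rfl⟩)
    simp only [twist, mActHom_apply, mAct_one] at h1
    refine h1.trans ?_
    gcongr
    exact hδl g (Set.mem_iUnion₂.2 ⟨k, hk, hg⟩)
  choose v hv hvφ using hstep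
  have hvu := hw.of_mem_convexHull hv
  have hcomm : ∀ φ φ' : C₀(E, ℂ), Commute (funRep Φ π φ) (funRep Φ π φ') := fun φ φ' => by
    rw [Commute, SemiconjBy, ← funRep_mul, ← funRep_mul, mul_comm]
  have hρ1 : ∀ j, ‖funRep Φ π (ψ j)‖ ≤ 1 := fun j => (norm_funRep_le Φ π _).trans (hψ1 j)
  have hρs : ∀ j, IsSelfAdjoint (funRep Φ π (ψ j)) := fun j => by
    rw [IsSelfAdjoint, ← funRep_star, hψs]
  have hu : ∀ j, ∀ φ : C₀(E, ℂ), funRep Φ π (ψ j) * v j * funRep Φ π (ψ j) * funRep Φ π φ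
      - funRep Φ π φ * (funRep Φ π (ψ j) * v j * funRep Φ π (ψ j))
      = funRep Φ π (ψ j) * (v j * funRep Φ π φ - funRep Φ π φ * v j) * funRep Φ π (ψ j) := by
    intro j φ
    have h1 : funRep Φ π (ψ j) * v j * funRep Φ π (ψ j) * funRep Φ π φ
        = funRep Φ π (ψ j) * v j * funRep Φ π φ * funRep Φ π (ψ j) := by
      rw [mul_assoc _ _ (funRep Φ π φ), (hcomm (ψ j) φ).eq, ← mul_assoc]
    have h2 : funRep Φ π φ * (funRep Φ π (ψ j) * v j * funRep Φ π (ψ j))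
        = funRep Φ π (ψ j) * funRep Φ π φ * v j * funRep Φ π (ψ j) := by
      rw [← mul_assoc, ← mul_assoc, (hcomm φ (ψ j)).eq]
    rw [h1, h2]
    noncomm_ring
  have hzero : ∀ j, ∀ φ' : C₀(E, ℂ), φ' * ψ j = 0 →
      Commute (funRep Φ π (ψ j) * v j * funRep Φ π (ψ j)) (funRep Φ π φ') := fun j φ' h => by
    rw [Commute, SemiconjBy, mul_assoc _ _ (funRep Φ π φ'), (hcomm (ψ j) φ').eq,
      ← mul_assoc (funRep Φ π φ'), ← mul_assoc (funRep Φ π φ'), ← funRep_mul, h, funRep_zero]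
    simp
  refine ⟨fun j => funRep Φ π (ψ j) * v j * funRep Φ π (ψ j), ⟨fun j => ?_, fun j => ?_,
    fun j => inIdeal_mul_right (inIdeal_mul_left _ (hvu.mem j)) _, fun j => ?_, fun x hx => ?_⟩,
    fun j φ' hφ' => ?_, fun j k hk g => ?_⟩
  · simp only [IsSelfAdjoint, star_mul, (hρs j).star_eq, (hvu.isSelfAdjoint j).star_eq, mul_assoc]
  · refine (norm_mul_le _ _).trans (mul_le_one₀ ((norm_mul_le _ _).trans
      (mul_le_one₀ (hρ1 j) (norm_nonneg _) (hvu.norm_le j))) (norm_nonneg _) (hρ1 j))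
  · rw [← mGradingHom_apply, map_mul, map_mul, mGradingHom_apply, mGradingHom_apply, funRep_even,
      hvu.even]
  · have h1 := inIdeal_subset_leftFixed_funRep Φ π hψ1 hψ hx
    have h2 := mem_leftFixed_mul hρ1 h1 (hvu.subset hx)
    refine mem_leftFixed_mul (fun j => ?_) h2 h1
    exact (norm_mul_le _ _).trans (mul_le_one₀ (hρ1 j) (norm_nonneg _) (hvu.norm_le j))
  · obtain ⟨L, hL, hLz⟩ := exists_isCompact_translate_mul_eq_zero (G := G) hφ' (hψc j)
    exact ⟨L, hL, fun g hg => hzero j _ (hLz g hg)⟩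
  · by_cases hg : g ∈ K j k
    · rw [hu]
      refine le_trans ?_ (hvφ j k hk g hg)
      refine (norm_mul_le _ _).trans (mul_le_of_le_one_right (norm_nonneg _) (hρ1 j) |>.trans ?_)
      exact (norm_mul_le _ _).trans (mul_le_of_le_one_left (norm_nonneg _) (hρ1 j))
    · rw [(hzero j _ (hKz j k g hg)).eq, sub_self, norm_zero]
      have := hl g
      positivity

end LocalizedUnit

/-! ### Approximate units in the image of the proper algebra -/

section ProperUnit

variable {G J P : Type*} [Group G] [TopologicalSpace G] [NonUnitalCStarAlgebra J]
  [NonUnitalCStarAlgebra P] [GradedGAlgebra G P] [GradedGAlgebra G J]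
  (π : GRep G P J) (A₁ : NonUnitalStarSubalgebra ℂ 𝓜(ℂ, J))

/-- A sequence of even positive contractions in the image of `P` that is an approximate unit
of `A₁`. -/
structure IsProperUnit (a : ℕ → 𝓜(ℂ, J)) : Prop where
  mem : ∀ n, a n ∈ Set.range π.hom
  isSelfAdjoint : ∀ n, IsSelfAdjoint (a n)
  norm_le : ∀ n, ‖a n‖ ≤ 1
  norm_one_sub_le : ∀ n, ‖1 - a n‖ ≤ 1
  even : ∀ n, mGrading G (a n) = a n
  subset : (A₁ : Set 𝓜(ℂ, J)) ⊆ leftFixed atTop a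

variable {π A₁}

theorem IsProperUnit.of_mem_convexHull {a b : ℕ → 𝓜(ℂ, J)} (ha : IsProperUnit π A₁ a)
    (hb : ∀ n, b n ∈ convexHull ℝ (a '' Set.Ici n)) : IsProperUnit π A₁ b where
  mem n := convexHull_mem_submodule (V := LinearMap.range (π.hom : P →ₗ[ℂ] 𝓜(ℂ, J)))
    (by rintro _ ⟨k, -, rfl⟩; exact ha.mem k) (hb n)
  isSelfAdjoint n := convexHull_isSelfAdjoint
    (by rintro _ ⟨k, -, rfl⟩; exact ha.isSelfAdjoint k) (hb n)
  norm_le n := convexHull_norm_le (by rintro _ ⟨k, -, rfl⟩; exact ha.norm_le k) (hb n)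
  norm_one_sub_le n := by
    have h := convexHull_norm_mul_sub_le (b := 1) (c := 1) (ε := 1)
      (by rintro _ ⟨k, -, rfl⟩; rw [mul_one, norm_sub_rev]; exact ha.norm_one_sub_le k) (hb n)
    rwa [mul_one, norm_sub_rev] at h
  even n := convexHull_map_eq (mGradingHom G) (by rintro _ ⟨k, -, rfl⟩; exact ha.even k) (hb n)
  subset := ha.subset.trans (leftFixed_le_of_mem_convexHull hb)

theorem exists_isProperUnit (hA₁σ : IsSigmaUnital A₁)
    (hPA₁d : (A₁ : Set 𝓜(ℂ, J)) ⊆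
      closure (Submodule.span ℂ {y | ∃ p : P, ∃ a ∈ A₁, y = π.hom p * a} : Set 𝓜(ℂ, J))) :
    ∃ a, IsProperUnit π A₁ a := by
  let _ := CStarAlgebra.spectralOrder P
  have _ := CStarAlgebra.spectralOrderedRing P
  have hl := CStarAlgebra.increasingApproximateUnit P
  set l := CStarAlgebra.approximateUnit P
  obtain ⟨v, -, hv⟩ := hA₁σ
  let γ : P ≃⋆ₐ[ℂ] P := GradedGAlgebra.grading G
  have hγγ : ∀ a, γ (γ a) = a := GradedGAlgebra.grading_grading
  let F : P → 𝓜(ℂ, J) := fun e => π.hom ((1 / 2 : ℂ) • (e + γ e))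
  have hFe : ∀ e, F e = (1 / 2 : ℂ) • (π.hom e + mGrading G (π.hom e)) := fun e => by
    simp only [F, map_smul, map_add, γ, π.graded]
  have hnorm : ∀ S T : 𝓜(ℂ, J), ‖S‖ ≤ 1 → ‖T‖ ≤ 1 → ‖(1 / 2 : ℂ) • (S + T)‖ ≤ 1 :=
    fun S T hS hT => by
      rw [norm_smul]
      norm_num
      linarith [norm_add_le S T]
  have hgood : ∀ᶠ e in l, IsSelfAdjoint (F e) ∧ ‖F e‖ ≤ 1 ∧ ‖1 - F e‖ ≤ 1 := by
    filter_upwards [hl.eventually_nonneg, hl.eventually_norm] with e he0 he1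
    obtain ⟨b, hb⟩ := CStarAlgebra.nonneg_iff_eq_star_mul_self.1 he0
    have hπ : π.hom e = star (π.hom b) * π.hom b := by rw [hb, map_mul, map_star]
    have hπ' : mGrading G (π.hom e) = star (mGrading G (π.hom b)) * mGrading G (π.hom b) := by
      rw [hπ, ← mGradingHom_apply, map_mul, map_star]
      rfl
    have h1 : ‖π.hom e‖ ≤ 1 := (NonUnitalStarAlgHom.norm_apply_le π.hom e).trans he1
    have h1' : ‖mGrading G (π.hom e)‖ ≤ 1 :=
      (NonUnitalStarAlgHom.norm_apply_le (mGradingHom G) _).trans h1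
    have h2 : ‖1 - π.hom e‖ ≤ 1 := by
      rw [hπ] at h1 ⊢
      exact norm_one_sub_le_of_star_mul_self h1
    have h2' : ‖1 - mGrading G (π.hom e)‖ ≤ 1 := by
      rw [hπ'] at h1' ⊢
      exact norm_one_sub_le_of_star_mul_self h1'
    refine ⟨?_, ?_, ?_⟩
    · rw [hFe, hπ, ← hπ, hπ', hπ]
      simp [IsSelfAdjoint]
    · rw [hFe]
      exact hnorm _ _ h1 h1'
    · have h3 : 1 - F e = (1 / 2 : ℂ) • ((1 - π.hom e) + (1 - mGrading G (π.hom e))) := by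
        rw [hFe, sub_add_sub_comm, smul_sub, ← two_smul ℂ (1 : 𝓜(ℂ, J)), smul_smul]
        norm_num
      rw [h3]
      exact hnorm _ _ h2 h2'
  have hFP : ∀ p, π.hom p ∈ leftFixed l F := fun p => by
    have h1 : Tendsto (fun e => e * p) l (𝓝 p) := hl.tendsto_mul_right p
    have h2 : Tendsto (fun e => γ e * p) l (𝓝 p) := by
      have h3 := ((map_continuous γ).tendsto _).comp (hl.tendsto_mul_right (γ p))
      simpa only [Function.comp_def, map_mul, hγγ] using h3
    have h3 := (h1.add h2).const_smul (1 / 2 : ℂ)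
    have h4 : (1 / 2 : ℂ) • (p + p) = p := by
      rw [← two_smul ℂ, smul_smul]; norm_num
    rw [h4] at h3
    refine (((map_continuous π.hom).tendsto _).comp h3).congr fun e => ?_
    simp only [Function.comp_def, F, ← map_mul, smul_mul_assoc, add_mul]
  have hFA : (A₁ : Set 𝓜(ℂ, J)) ⊆ leftFixed l F := by
    have hcl : IsClosed (leftFixed l F : Set 𝓜(ℂ, J)) :=
      isClosed_leftFixed (C := 1) (hgood.mono fun e he => he.2.1)
    refine hPA₁d.trans (closure_minimal ?_ hcl)
    have : Submodule.span ℂ {y | ∃ p : P, ∃ a ∈ A₁, y = π.hom p * a} ≤ leftFixed l F := by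
      rw [Submodule.span_le]
      rintro _ ⟨p, a, -, rfl⟩
      exact leftFixed_mul (hFP p) a
    exact this
  -- The approximate unit of P is only a net. A sequence is extracted by testing against the σ-unit
  -- of A₁, which suffices because the fixed elements form a closed right ideal.
  have hstep : ∀ n : ℕ, ∃ e, (IsSelfAdjoint (F e) ∧ ‖F e‖ ≤ 1 ∧ ‖1 - F e‖ ≤ 1) ∧
      ∀ k ∈ Set.Iic n, dist (F e * v k) (v k) < 1 / (n + 1) := fun n => by
    refine (hgood.and ((Set.finite_Iic n).eventually_all.2 fun k _ => ?_)).exists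
    exact Metric.tendsto_nhds.1 (mem_leftFixed.1 (hFA (v k).2)) _ (by positivity)
  choose e he hev using hstep
  have hvF : ∀ k, (v k : 𝓜(ℂ, J)) ∈ leftFixed atTop fun n => F (e n) := fun k => by
    refine tendsto_iff_dist_tendsto_zero.2 (squeeze_zero' (Eventually.of_forall fun n =>
      dist_nonneg) ?_ tendsto_one_div_add_atTop_nhds_zero_nat)
    filter_upwards [Ici_mem_atTop k] with n hn
    exact (hev n k hn).le
  refine ⟨fun n => F (e n), fun n => ⟨_, rfl⟩, fun n => (he n).1, fun n => (he n).2.1,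
    fun n => (he n).2.2, fun n => ?_, fun x hx => ?_⟩
  · have h1 : mGrading G (F (e n)) = π.hom (γ ((1 / 2 : ℂ) • (e n + γ (e n)))) :=
      (π.graded _).symm
    rw [h1, map_smul, map_add, hγγ, add_comm]
  · have hcl : IsClosed (leftFixed atTop (fun n => F (e n)) : Set 𝓜(ℂ, J)) :=
      isClosed_leftFixed (C := 1) (Eventually.of_forall fun n => (he n).2.1)
    have h1 := (continuous_subtype_val.tendsto _).comp (hv ⟨x, hx⟩).1
    exact hcl.mem_of_tendsto h1 (Eventually.of_forall fun k => leftFixed_mul (hvF k) x)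

/-- Neither `x * b` nor the homogeneous parts of `b` need lie in A₁. But `x * b` is the graded
commutator plus parts of `b` times parts of `x`; the parts of `b` are almost fixed because the unit
is even, and the fixed elements form a right ideal. -/
theorem IsProperUnit.mul_mem_leftFixed {a : ℕ → 𝓜(ℂ, J)} (ha : IsProperUnit π A₁ a)
    {x b : 𝓜(ℂ, J)} (hx : ∀ a ∈ A₁, gComm G x a ∈ A₁) (hb : b ∈ A₁) :
    x * b ∈ leftFixed atTop a := by
  have hb0 : b ∈ leftFixed atTop a := ha.subset hb
  have hb1 : mGrading G b ∈ leftFixed atTop a := by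
    have h := ((map_continuous (mGradingHom (J := J) G)).tendsto _).comp (mem_leftFixed.1 hb0)
    refine h.congr fun n => ?_
    simp only [Function.comp_def, map_mul, mGradingHom_apply, ha.even]
  have he : evenPart G b ∈ leftFixed atTop a :=
    (leftFixed atTop a).smul_mem _ ((leftFixed atTop a).add_mem hb0 hb1)
  have ho : oddPart G b ∈ leftFixed atTop a :=
    (leftFixed atTop a).smul_mem _ ((leftFixed atTop a).sub_mem hb0 hb1)
  have h := (leftFixed atTop a).add_mem (ha.subset (hx b hb)) ((leftFixed atTop a).sub_mem
    ((leftFixed atTop a).add_mem ((leftFixed atTop a).add_mem (leftFixed_mul he (evenPart G x))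
      (leftFixed_mul he (oddPart G x))) (leftFixed_mul ho (evenPart G x)))
    (leftFixed_mul ho (oddPart G x)))
  rwa [gComm, sub_add_cancel] at h

theorem continuous_mAct_hom (p : P) : Continuous fun g : G => mAct g (π.hom p) := by
  simp only [← π.equivariant]
  exact (map_continuous π.hom).comp (GradedGAlgebra.continuous_act p)

theorem mAct_hom_mem_range (g : G) {x : 𝓜(ℂ, J)} (hx : x ∈ Set.range π.hom) :
    mAct g x ∈ Set.range π.hom := by
  obtain ⟨p, rfl⟩ := hx
  exact ⟨_, π.equivariant g p⟩

theorem IsProperUnit.exists_twist_le [IsTopologicalGroup G] {a : ℕ → 𝓜(ℂ, J)}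
    (ha : IsProperUnit π A₁ a) (hPA₁ : ∀ p : P, π.hom p ∈ A₁) {K : Set G} (hK : IsCompact K)
    {X : Set 𝓜(ℂ, J)} (hX : X.Finite) (hXA : ∀ x ∈ X, ∀ a ∈ A₁, gComm G x a ∈ A₁) (n₀ : ℕ)
    {ε : ℝ} (hε : 0 < ε) :
    ∃ u ∈ convexHull ℝ (a '' Set.Ici n₀), (∀ g ∈ K, ‖mAct g u - u‖ ≤ ε) ∧
      ∀ x ∈ X, ‖u * x - x * u‖ ≤ ε := by
  have hran : ∀ x ∈ Set.range π.hom, x ∈ A₁ := by rintro _ ⟨p, rfl⟩; exact hPA₁ p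
  have hcts : ∀ x ∈ Set.range π.hom, Continuous fun g : G => mAct g x := by
    rintro _ ⟨p, rfl⟩; exact continuous_mAct_hom p
  obtain ⟨C, hC⟩ := hX.isBounded.exists_norm_le
  obtain ⟨u, hu, hut⟩ := exists_convexHull_twist_le ha.isSelfAdjoint ha.norm_le
    (S := (fun g : G => (mActHom g, 1)) '' K ∪ (fun x => (mActHom (1 : G), x)) '' X)
    (C := max C ‖(1 : 𝓜(ℂ, J))‖) (by
      rintro _ (⟨g, -, rfl⟩ | ⟨x, hx, rfl⟩)
      · exact le_max_right _ _
      · exact (hC x hx).trans (le_max_left _ _)) (fun i ε hε => by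
      let F₁ : G → 𝓜(ℂ, J) := fun g => star (mAct g⁻¹ (mAct g (a i) - a i))
      let F₂ : G → 𝓜(ℂ, J) := fun g => star (mAct g (a i) - a i)
      let F₃ : 𝓜(ℂ, J) → 𝓜(ℂ, J) := fun x => star (a i * x - x * a i)
      -- Its value is `x` times an element of A₁, which is where `IsProperUnit.mul_mem_leftFixed` is
      -- needed.
      let F₄ : 𝓜(ℂ, J) → 𝓜(ℂ, J) := fun x => star ((a i * x - x * a i) * star x)
      have hr : ∀ g : G, mAct g (a i) - a i ∈ Set.range π.hom := fun g =>
        (LinearMap.range (π.hom : P →ₗ[ℂ] 𝓜(ℂ, J))).sub_mem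
          (mAct_hom_mem_range g (ha.mem i)) (ha.mem i)
      have hF₂ : Continuous F₂ := ((hcts _ (ha.mem i)).sub continuous_const).star
      have hF₁ : Continuous F₁ := (continuousOn_mAct continuous_inv
        ((hcts _ (ha.mem i)).sub continuous_const) fun g => hcts _ (hr g)).star
      have hcomm : ∀ x ∈ X, a i * x - x * a i ∈ A₁ := fun x hx => by
        have h := hXA x hx _ (hran _ (ha.mem i))
        rw [gComm_of_even_right _ (ha.even i)] at h
        rw [← neg_sub]
        exact neg_mem h
      have hQ : IsCompact ((F₁ '' K ∪ F₂ '' K) ∪ (F₃ '' X ∪ F₄ '' X)) :=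
        ((hK.image hF₁).union (hK.image hF₂)).union
          ((hX.image F₃).isCompact.union (hX.image F₄).isCompact)
      obtain ⟨N, hN⟩ := exists_forall_norm_mul_sub_le ha.norm_le hQ (by
        rintro _ ((⟨g, -, rfl⟩ | ⟨g, -, rfl⟩) | (⟨x, hx, rfl⟩ | ⟨x, hx, rfl⟩))
        · exact ha.subset (star_mem (hran _ (mAct_hom_mem_range _ (hr g))))
        · exact ha.subset (star_mem (hran _ (hr g)))
        · exact ha.subset (star_mem (hcomm x hx))
        · simp only [F₄]
          rw [star_mul, star_star]
          exact ha.mul_mem_leftFixed (hXA x hx) (star_mem (hcomm x hx))) hε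
      have hstar : ∀ j y, ‖a j * star y - star y‖ = ‖y * a j - y‖ := fun j y => by
        rw [← norm_star (y * a j - y), star_sub, star_mul, (ha.isSelfAdjoint j).star_eq]
      refine ⟨N, ?_⟩
      rintro j hj _ (⟨g, hg, rfl⟩ | ⟨x, hx, rfl⟩)
      · have h1 := hN j hj _ (.inl (.inl ⟨g, hg, rfl⟩))
        have h2 := hN j hj _ (.inl (.inr ⟨g, hg, rfl⟩))
        simp only [F₁, F₂, hstar] at h1 h2
        simp only [twist, mActHom_apply, one_mul, mul_one, star_one]
        refine ⟨?_, h2⟩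
        rw [← norm_mAct g, ← mActHom_apply g, map_sub, map_mul] at h1
        simpa only [mActHom_apply, mAct_mAct_inv] using h1
      · have h1 := hN j hj _ (.inr (.inr ⟨x, hx, rfl⟩))
        have h2 := hN j hj _ (.inr (.inl ⟨x, hx, rfl⟩))
        simp only [F₃, F₄, hstar] at h1 h2
        simp only [twist, mActHom_apply, mAct_one]
        exact ⟨h1, h2⟩) n₀ hε
  refine ⟨u, hu, fun g hg => ?_, fun x hx => ?_⟩
  · simpa [twist] using hut _ (.inl ⟨g, hg, rfl⟩)
  · simpa [twist] using hut _ (.inr ⟨x, hx, rfl⟩)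

theorem exists_quasicentral_properUnit [IsTopologicalGroup G] (hA₁σ : IsSigmaUnital A₁)
    (hPA₁ : ∀ p : P, π.hom p ∈ A₁)
    (hPA₁d : (A₁ : Set 𝓜(ℂ, J)) ⊆
      closure (Submodule.span ℂ {y | ∃ p : P, ∃ a ∈ A₁, y = π.hom p * a} : Set 𝓜(ℂ, J)))
    {K : ℕ → Set G} (hK : ∀ n, IsCompact (K n)) {X : ℕ → Set 𝓜(ℂ, J)} (hX : ∀ n, (X n).Finite)
    (hXA : ∀ n, ∀ x ∈ X n, ∀ a ∈ A₁, gComm G x a ∈ A₁) {V : ℕ → Set 𝓜(ℂ, J)}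
    (hV : ∀ n, (V n).Finite) (hVA : ∀ n, V n ⊆ A₁) {ε : ℕ → ℝ} (hε : ∀ n, 0 < ε n) :
    ∃ a, IsProperUnit π A₁ a ∧ ∀ n, (∀ g ∈ K n, ‖mAct g (a n) - a n‖ ≤ ε n) ∧
      (∀ x ∈ X n, ‖a n * x - x * a n‖ ≤ ε n) ∧ ∀ v ∈ V n, ‖a n * v - v‖ ≤ ε n := by
  obtain ⟨b, hb⟩ := exists_isProperUnit hA₁σ hPA₁d
  choose N hN using fun n => exists_forall_norm_mul_sub_le hb.norm_le (hV n).isCompact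
    ((hVA n).trans hb.subset) (hε n)
  choose a ha haK haX using fun n => hb.exists_twist_le hPA₁ (hK n) (hX n) (hXA n)
    (max n (N n)) (hε n)
  refine ⟨a, hb.of_mem_convexHull fun n => convexHull_mono
    (Set.image_mono (Set.Ici_subset_Ici.2 (le_max_left _ _))) (ha n), fun n =>
    ⟨haK n, haX n, fun v hv => convexHull_norm_mul_sub_le ?_ (ha n)⟩⟩
  rintro _ ⟨k, hk, rfl⟩
  exact hN n k ((le_max_right _ _).trans hk) v hv

end ProperUnit

/-! ### A partition of unity in the multiplier algebra -/

section Partition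

variable (G : Type*) {J : Type*} [Group G] [TopologicalSpace G] [NonUnitalCStarAlgebra J]
  [GradedGAlgebra G J]

theorem norm_twist_smul_le_iff {x y : 𝓜(ℂ, J)} {c ε : ℝ} (hc : 0 < c) :
    ‖twist (mActHom (1 : G), c⁻¹ • y) x‖ ≤ ε ↔ ‖x * y - y * x‖ ≤ ε * c := by
  simp only [twist, mActHom_apply, mAct_one, mul_smul_comm, smul_mul_assoc]
  rw [← smul_sub, norm_smul, norm_inv, Real.norm_of_nonneg hc.le, inv_mul_le_iff₀ hc, mul_comm c]

end Partition

section Partition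

variable {G E J P : Type*} [Group G] [TopologicalSpace G] [IsTopologicalGroup G]
  [LocallyCompactSpace G] [TopologicalSpace E] [MulAction G E]
  [ContinuousSMul G E] [NonUnitalCStarAlgebra J] [NonUnitalCStarAlgebra P]
  [GradedGAlgebra G P] [GradedGAlgebra G J]
  [ProperSMul G E] [LocallyCompactSpace E] [T2Space E] [SigmaCompactSpace E]
  (Φ : ProperAlgebra G E P) (π : GRep G P J)

theorem exists_strict_partition (hJ : IsSigmaUnital J) {φ : ℕ → C₀(E, ℂ)}
    (hφ : ∀ k, HasCompactSupport (φ k)) {l : G → ℝ} (hl : ∀ g, 0 < l g)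
    (hlK : ∀ K, IsCompact K → ∃ δ > 0, ∀ g ∈ K, δ ≤ l g)
    {K : ℕ → Set G} (hK : ∀ n, IsCompact (K n)) (hKm : Monotone K)
    {X : ℕ → Set 𝓜(ℂ, J)} (hX : ∀ n, (X n).Finite) (hXm : Monotone X)
    {B : ℕ → Set 𝓜(ℂ, J)} (hB : ∀ n, IsCompact (B n)) (hBJ : ∀ n, B n ⊆ inIdeal J)
    {ε : ℕ → ℝ} (hε : ∀ n, 0 < ε n) :
    ∃ r D : ℕ → 𝓜(ℂ, J), r 0 = 1 ∧ (∀ n, D n ∈ inIdeal J) ∧ (∀ n, mGrading G (D n) = D n) ∧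
      (∀ n, ‖r n‖ ≤ 1) ∧ (∀ n, ‖D n‖ ≤ 1) ∧
      (∀ n, star (D n) * D n = star (r n) * r n - star (r (n + 1)) * r (n + 1)) ∧
      (∀ n, ∀ b ∈ B (n + 1), ‖r (n + 1) * b‖ ≤ ε (n + 1) ∧ ‖D (n + 1) * b‖ ≤ ε (n + 1)) ∧
      (∀ n, ∀ g ∈ K n, ‖mAct g (D n) - D n‖ ≤ ε n) ∧
      (∀ n, ∀ x ∈ X n, ‖D n * x - x * D n‖ ≤ ε n) ∧
      ∀ n, ∀ k ≤ n, ∀ g, ‖D n * funRep Φ π (translate g (φ k))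
        - funRep Φ π (translate g (φ k)) * D n‖ ≤ ε n * l g := by
  obtain ⟨w, hw, hwl, hwφ⟩ := exists_localized_unit Φ π hJ hφ hl hlK
  let U : Set 𝓜(ℂ, J) := convexHull ℝ (Set.range w)
  have hUsa : ∀ u ∈ U, IsSelfAdjoint u := fun u hu =>
    convexHull_isSelfAdjoint (by rintro _ ⟨k, rfl⟩; exact hw.isSelfAdjoint k) hu
  have hU1 : ∀ u ∈ U, ‖u‖ ≤ 1 := fun u hu =>
    convexHull_norm_le (by rintro _ ⟨k, rfl⟩; exact hw.norm_le k) hu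
  have hUJ : ∀ u ∈ U, u ∈ idealSubmodule J := fun u hu =>
    convexHull_mem_submodule (by rintro _ ⟨k, rfl⟩; exact hw.mem k) hu
  have hUe : ∀ u ∈ U, mGradingHom G u = u := fun u hu =>
    convexHull_map_eq (mGradingHom G) (by rintro _ ⟨k, rfl⟩; exact hw.even k) hu
  have hUl : ∀ u ∈ U, IsLocalized Φ π u := fun u hu =>
    convexHull_isLocalized Φ π (by rintro _ ⟨k, rfl⟩; exact hwl k) hu
  have hVcl : IsClosed (idealSubmodule J : Set 𝓜(ℂ, J)) := isClosed_inIdeal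
  have hVmul : ∀ x, ∀ v ∈ idealSubmodule J, x * v ∈ idealSubmodule J := fun x v hv =>
    inIdeal_mul_left x hv
  -- Since r - 1 lies in J, `r` commutes with every multiplier and is G-invariant modulo J, so the
  -- approximate unit can absorb all its twists. Locality makes the commutators with translates
  -- vanish off a compact set.
  let R : Set 𝓜(ℂ, J) := {r | r - 1 ∈ inIdeal J ∧ IsLocalized Φ π r ∧ mGradingHom G r = r}
  -- Dividing by the weight turns a uniform bound over all of G into the bound ε l(g). This part of
  -- the family is unbounded and not compact, so averaging cannot treat it directly.
  let T : ℕ → Set ((𝓜(ℂ, J) →⋆ₐ[ℂ] 𝓜(ℂ, J)) × 𝓜(ℂ, J)) := fun n =>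
    (fun g => (mActHom g, 1)) '' K n ∪ (fun x => (mActHom (1 : G), x)) '' X n ∪
      {t | ∃ k ≤ n, ∃ g : G, t = (mActHom (1 : G), (l g)⁻¹ • funRep Φ π (translate g (φ k)))}
  have hT : Monotone T := fun m n hmn => by
    refine Set.union_subset_union (Set.union_subset_union (Set.image_mono (hKm hmn))
      (Set.image_mono (hXm hmn))) ?_
    rintro t ⟨k, hk, g, rfl⟩
    exact ⟨k, hk.trans hmn, g, rfl⟩
  have hRmul : ∀ u ∈ U, ∀ r ∈ R, quarterCos u * r ∈ R := by
    rintro u hu r ⟨hr1, hr2, hr3⟩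
    refine ⟨?_, ((hUl u hu).quarterCos (hU1 u hu)).mul hr2, ?_⟩
    · have h : quarterCos u * r - 1 = (quarterCos u - 1) * r + (r - 1) := by noncomm_ring
      rw [h]
      exact inIdeal_add (inIdeal_mul_right (quarterCos_sub_one_mem hVcl hVmul (hUJ u hu)) _) hr1
    · rw [map_mul, map_quarterCos, hUe u hu, hr3]
  have H : ∀ n, ∀ r ∈ R, ∀ ε > 0, ∃ u ∈ U,
      (∀ t ∈ T n, ‖twist t u‖ ≤ ε ∧ ‖t.1 u * twist t r - twist t r‖ ≤ ε) ∧
      ∀ b ∈ B n, ‖u * (r * b) - r * b‖ ≤ ε := by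
    rintro n r ⟨hr1, hr2, -⟩ ε hε
    choose L hL hLr using fun k => hr2 (φ k) (hφ k)
    obtain ⟨δ, hδ, hδl⟩ := hlK _ ((Set.finite_Iic n).isCompact_biUnion fun k _ => hL k)
    have hcomm : ∀ x, r * x - x * r ∈ inIdeal J := fun x => by
      have h : r * x - x * r = (r - 1) * x - x * (r - 1) := by noncomm_ring
      rw [h]
      exact inIdeal_sub (inIdeal_mul_right hr1 _) (inIdeal_mul_left _ hr1)
    have hact : ∀ g : G, mAct g r - r = mAct g (r - 1) - (r - 1) := fun g => by
      have h1 : mAct g (1 : 𝓜(ℂ, J)) = 1 := map_one (mActHom g)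
      rw [mAct_sub, h1, sub_sub_sub_cancel_right]
    have hactJ : ∀ g : G, mAct g r - r ∈ inIdeal J := fun g => by
      rw [hact]
      exact inIdeal_sub (mAct_mem_inIdeal g hr1) hr1
    have hactc : Continuous fun g : G => mAct g⁻¹ (mAct g r - r) :=
      continuousOn_mAct continuous_inv (by
        simp only [hact]
        exact (continuous_mAct hr1).sub continuous_const) fun g => continuous_mAct (hactJ g)
    let Z : ℕ → G → 𝓜(ℂ, J) := fun k g => r * funRep Φ π (translate g (φ k))
      - funRep Φ π (translate g (φ k)) * r
    have hZ : ∀ k, Continuous (Z k) := fun k =>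
      (continuous_const.mul (continuous_funRep_translate Φ π _)).sub
        ((continuous_funRep_translate Φ π _).mul continuous_const)
    obtain ⟨N₁, hN₁⟩ := exists_forall_norm_mul_sub_le hw.norm_le
      (((((hK n).image hactc).union ((hX n).image fun x => r * x - x * r).isCompact).union
        ((hB n).image (f := fun b => r * b) (continuous_const.mul continuous_id)))) (by
        rintro _ ((⟨g, -, rfl⟩ | ⟨x, -, rfl⟩) | ⟨b, hb, rfl⟩)
        · exact hw.subset (mAct_mem_inIdeal _ (hactJ g))
        · exact hw.subset (hcomm x)
        · exact hw.subset (inIdeal_mul_left _ (hBJ n hb))) hε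
    obtain ⟨N₂, hN₂⟩ := exists_forall_norm_mul_sub_le hw.norm_le
      ((Set.finite_Iic n).isCompact_biUnion fun k _ => (hL k).image (hZ k)) (by
        rintro _ hz
        obtain ⟨k, -, g, -, rfl⟩ := Set.mem_iUnion₂.1 hz
        exact hw.subset (hcomm _)) (mul_pos hε hδ)
    obtain ⟨N₃, hN₃⟩ := exists_pow_lt_of_lt_one hε (show (1 / 2 : ℝ) < 1 by norm_num)
    let N := max (max N₁ N₂) (max N₃ n)
    have hNN₁ : N₁ ≤ N := (le_max_left _ _).trans (le_max_left _ _)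
    have hNN₂ : N₂ ≤ N := (le_max_right _ _).trans (le_max_left _ _)
    have hNN₃ : N₃ ≤ N := (le_max_left _ _).trans (le_max_right _ _)
    have hNn : n ≤ N := (le_max_right _ _).trans (le_max_right _ _)
    obtain ⟨u, hu, hut⟩ := hw.exists_twist_le
      (((hK n).prod (isCompact_singleton (x := (1 : 𝓜(ℂ, J))))).union
        ((isCompact_singleton (x := (1 : G))).prod (hX n).isCompact)) N hε
    have huU : u ∈ U := convexHull_mono (Set.image_subset_range _ _) hu
    have hkill : ∀ b c : 𝓜(ℂ, J), ∀ η, (∀ j ≥ N, ‖w j * b - c‖ ≤ η) → ‖u * b - c‖ ≤ η :=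
      fun b c η h => convexHull_norm_mul_sub_le (by rintro _ ⟨j, hj, rfl⟩; exact h j hj) hu
    refine ⟨u, huU, ?_, fun b hb => hkill _ _ _ fun j hj =>
      hN₁ j (hNN₁.trans hj) _ (.inr ⟨b, hb, rfl⟩)⟩
    rintro t ((⟨g, hg, rfl⟩ | ⟨x, hx, rfl⟩) | ⟨k, hk, g, rfl⟩)
    · refine ⟨hut (g, 1) (.inl ⟨hg, rfl⟩), ?_⟩
      have h := hkill _ _ _ fun j hj => hN₁ j (hNN₁.trans hj) _ (.inl (.inl ⟨g, hg, rfl⟩))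
      rw [← norm_mAct g, ← mActHom_apply g, map_sub, map_mul] at h
      simp only [mActHom_apply, mAct_mAct_inv] at h
      simpa only [twist, mActHom_apply, mul_one, one_mul] using h
    · refine ⟨hut (1, x) (.inr ⟨rfl, hx⟩), ?_⟩
      have h := hkill _ _ _ fun j hj => hN₁ j (hNN₁.trans hj) _ (.inl (.inr ⟨x, hx, rfl⟩))
      simpa only [twist, mActHom_apply, mAct_one] using h
    · constructor
      -- Every `w j` far enough out already satisfies the weighted bound for all g, so it passes to
      -- the average.
      · refine convexHull_norm_twist_le ?_ hu
        rintro _ ⟨j, hj, rfl⟩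
        rw [norm_twist_smul_le_iff G (hl g)]
        refine (hwφ j k (hk.trans (hNn.trans hj)) g).trans ?_
        have := hl g
        gcongr
        refine le_trans ?_ hN₃.le
        exact pow_le_pow_of_le_one (by norm_num) (by norm_num) (hNN₃.trans hj)
      · have h1 : twist (mActHom (1 : G), (l g)⁻¹ • funRep Φ π (translate g (φ k))) r
            = (l g)⁻¹ • Z k g := by
          simp only [twist, mActHom_apply, mAct_one, mul_smul_comm, smul_mul_assoc, Z, smul_sub]
        rw [h1]
        simp only [mActHom_apply, mAct_one]
        rw [mul_smul_comm, ← smul_sub, norm_smul, norm_inv, Real.norm_of_nonneg (hl g).le,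
          inv_mul_le_iff₀ (hl g), mul_comm]
        by_cases hg : g ∈ L k
        · have hgl := hδl g (Set.mem_iUnion₂.2 ⟨k, hk, hg⟩)
          refine (hkill _ _ _ fun j hj => hN₂ j (hNN₂.trans hj) _
            (Set.mem_iUnion₂.2 ⟨k, hk, g, hg, rfl⟩)).trans ?_
          gcongr
        · have h0 : Z k g = 0 := sub_eq_zero.2 (hLr k g hg).eq
          rw [h0, mul_zero, sub_zero, norm_zero]
          exact mul_nonneg hε.le (hl g).le
  obtain ⟨r, D, u, hrR, huU, hD, hr0, hr1, hD1, hDD, hDB, hDT⟩ := exists_partition_sequence T B U R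
    hT (fun u hu => ⟨hUsa u hu, hU1 u hu⟩)
    ⟨by rw [sub_self]; exact inIdeal_zero, IsLocalized.one Φ π, map_one _⟩ hRmul H ε hε
  refine ⟨r, D, hr0, fun n => ?_, fun n => ?_, hr1, hD1, hDD, hDB, fun n g hg => ?_,
    fun n x hx => ?_, fun n k hk g => ?_⟩
  · rw [hD]
    exact inIdeal_mul_right (quarterSin_mem hVcl hVmul (hUJ _ (huU n))) _
  · rw [hD, ← mGradingHom_apply, map_mul, map_quarterSin, hUe _ (huU n), (hrR n).2.2]
  · simpa [twist] using hDT n _ (.inl (.inl ⟨g, hg, rfl⟩))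
  · simpa [twist] using hDT n _ (.inl (.inr ⟨x, hx, rfl⟩))
  · exact (norm_twist_smul_le_iff G (hl g)).1 (hDT n _ (.inr ⟨k, hk, g, rfl⟩))

end Partition

/-! ### Averages over the group -/

section Average

variable {G E J P : Type*} [Group G] [TopologicalSpace G] [IsTopologicalGroup G]
  [LocallyCompactSpace G] [TopologicalSpace E] [MulAction G E]
  [ContinuousSMul G E] [NonUnitalCStarAlgebra J] [NonUnitalCStarAlgebra P]
  [GradedGAlgebra G P] [GradedGAlgebra G J]
  (Φ : ProperAlgebra G E P) (π : GRep G P J)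
  [ProperSMul G E] [LocallyCompactSpace E] [T2Space E] [SigmaCompactSpace E]
  [MeasurableSpace G] [BorelSpace G] [T2Space G] (μ : Measure G)
  [IsFiniteMeasureOnCompacts μ]

theorem integral_mem_inIdeal {X : Type*} [MeasurableSpace X] {ν : Measure X} {f : X → 𝓜(ℂ, J)}
    (hf : ∀ x, f x ∈ inIdeal J) : ∫ x, f x ∂ν ∈ inIdeal J := by
  choose F hF using hf
  obtain rfl : f = fun x => (F x : 𝓜(ℂ, J)) := funext fun x => (hF x).symm
  let L : J →ₗᵢ[ℂ] 𝓜(ℂ, J) :=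
    { (DoubleCentralizer.coeHom (𝕜 := ℂ) (A := J) : J →ₗ[ℂ] 𝓜(ℂ, J)) with norm_map' := norm_coe }
  exact ⟨_, (L.integral_comp_comm F).symm⟩

theorem isCutoff_tendsto_right {c : C(E, ℝ)} (hc : IsCutoff μ c) {x : 𝓜(ℂ, J)}
    (hx : x ∈ inIdeal J) :
    Tendsto (fun K : TopologicalSpace.Compacts G =>
      x * ∫ g in K, funRep Φ π (translate g (toC₀ c hc.compactSupport)) *
        funRep Φ π (translate g (toC₀ c hc.compactSupport)) ∂μ) atTop (𝓝 x) := by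
  have h := (isCutoff_tendsto Φ π μ hc (inIdeal_star hx)).star
  rw [star_star] at h
  refine h.congr fun K => ?_
  have hsa : ∀ g : G, star (funRep Φ π (translate g (toC₀ c hc.compactSupport)))
      = funRep Φ π (translate g (toC₀ c hc.compactSupport)) := fun g => by
    rw [← funRep_star]
    congr 1
    ext x
    exact Complex.conj_ofReal _
  rw [star_mul, star_star]
  congr 1
  have h1 := (starL' ℝ : 𝓜(ℂ, J) ≃L[ℝ] 𝓜(ℂ, J)).integral_comp_comm (μ := μ.restrict K) fun g : G =>
    funRep Φ π (translate g (toC₀ c hc.compactSupport)) *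
      funRep Φ π (translate g (toC₀ c hc.compactSupport))
  simp only [starL'_apply, star_mul, hsa] at h1
  exact h1.symm

/-- Write R M R = R² M + R [M, R] with R = g(c). The integrals of R² converge strictly to 1, and the
remainder is dominated by a multiple of `l`, so its norm integral is the difference I - M in J. -/
theorem exists_hasStrictIntegral [SecondCountableTopology G] {c : C(E, ℝ)} (hc : IsCutoff μ c)
    {M : 𝓜(ℂ, J)} {l : G → ℝ}
    (hl : Integrable l μ) {C : ℝ}
    (hM : ∀ g : G, M * funRep Φ π (translate g (toC₀ c hc.compactSupport))
      - funRep Φ π (translate g (toC₀ c hc.compactSupport)) * M ∈ inIdeal J)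
    (hMl : ∀ g : G, ‖M * funRep Φ π (translate g (toC₀ c hc.compactSupport))
      - funRep Φ π (translate g (toC₀ c hc.compactSupport)) * M‖ ≤ C * l g) :
    ∃ I, HasStrictIntegral μ (fun g : G => funRep Φ π (translate g (toC₀ c hc.compactSupport)) * M *
      funRep Φ π (translate g (toC₀ c hc.compactSupport))) I ∧ I - M ∈ inIdeal J := by
  have hleft := fun {x : 𝓜(ℂ, J)} (hx : x ∈ inIdeal J) => isCutoff_tendsto Φ π μ hc hx
  have hright := fun {x : 𝓜(ℂ, J)} (hx : x ∈ inIdeal J) => isCutoff_tendsto_right Φ π μ hc hx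
  have hR := continuous_funRep_translate (G := G) Φ π (toC₀ c hc.compactSupport)
  have hR1 := fun g : G => norm_funRep_translate_le Φ π g (toC₀ c hc.compactSupport)
  set R : G → 𝓜(ℂ, J) := fun g => funRep Φ π (translate g (toC₀ c hc.compactSupport))
  let F : G → 𝓜(ℂ, J) := fun g => R g * (M * R g - R g * M)
  have hF : Continuous F := hR.mul ((continuous_const.mul hR).sub (hR.mul continuous_const))
  have hFJ : ∀ g, F g ∈ inIdeal J := fun g => inIdeal_mul_left _ (hM g)
  have hFi : Integrable F μ := by
    refine (hl.const_mul (‖toC₀ c hc.compactSupport‖ * C)).mono' hF.aestronglyMeasurable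
      (Eventually.of_forall fun g => ?_)
    rw [mul_assoc]
    refine (norm_mul_le _ _).trans ?_
    have := (norm_nonneg _).trans (hMl g)
    gcongr
    · exact hR1 g
    · exact hMl g
  let Q : TopologicalSpace.Compacts G → 𝓜(ℂ, J) := fun K => ∫ g in K, R g * R g ∂μ
  have hRi : ∀ K : TopologicalSpace.Compacts G, IntegrableOn (fun g => R g * R g) K μ := fun K =>
    (hR.mul hR).continuousOn.integrableOn_compact K.isCompact
  let ρ : 𝓜(ℂ, J) →L[ℝ] 𝓜(ℂ, J) := (ContinuousLinearMap.mul ℝ 𝓜(ℂ, J)).flip M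
  have hsum : ∀ K : TopologicalSpace.Compacts G,
      ∫ g in K, R g * M * R g ∂μ = Q K * M + ∫ g in K, F g ∂μ := fun K => by
    have h1 : ∫ g in K, R g * R g * M ∂μ = Q K * M := ρ.integral_comp_comm (hRi K)
    have h2 : IntegrableOn (fun g => R g * R g * M) K μ := ρ.integrable_comp (hRi K)
    rw [← h1, ← integral_add h2 hFi.integrableOn]
    refine integral_congr_ae (Eventually.of_forall fun g => ?_)
    simp only [F]
    noncomm_ring
  have hFt := tendsto_setIntegral_compacts μ hFi
  refine ⟨M + ∫ g, F g ∂μ, ⟨fun K => ((hR.mul continuous_const).mul hR).continuousOn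
    |>.integrableOn_compact K.isCompact, fun j => ⟨?_, ?_⟩⟩, ?_⟩
  · rw [isometry_coe.isUniformInducing.isInducing.tendsto_nhds_iff]
    simp only [Function.comp_def, ← mul_coe]
    change Tendsto (fun K : TopologicalSpace.Compacts G =>
      (∫ g in K, R g * M * R g ∂μ) * (j : 𝓜(ℂ, J)))
      atTop _
    simp only [hsum, add_mul, mul_assoc (Q _) M]
    exact (hleft (inIdeal_mul_left M (coe_mem_inIdeal j))).add (hFt.mul_const _)
  · rw [isometry_coe.isUniformInducing.isInducing.tendsto_nhds_iff]
    simp only [Function.comp_def, ← coe_mul]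
    change Tendsto (fun K : TopologicalSpace.Compacts G =>
      (j : 𝓜(ℂ, J)) * ∫ g in K, R g * M * R g ∂μ)
      atTop _
    simp only [hsum, mul_add, ← mul_assoc]
    exact ((hright (coe_mem_inIdeal j)).mul_const M).add (hFt.const_mul _)
  · rw [add_sub_cancel_left]
    exact integral_mem_inIdeal hFJ

end Average

/-! ### Strict sums modulo the ideal -/

section Sum

variable {J : Type*} [NonUnitalCStarAlgebra J]

theorem HasStrictSum.mem_inIdeal_of_eventually_le {X : ℕ → 𝓜(ℂ, J)} {M : 𝓜(ℂ, J)}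
    (h : HasStrictSum X M) (hm : ∀ n, X n ∈ inIdeal J) {C : ℝ}
    (hX : ∀ᶠ n in atTop, ‖X n‖ ≤ C * (1 / 2) ^ n) : M ∈ inIdeal J := by
  refine h.mem_inIdeal (.of_norm_bounded_eventually_nat (summable_geometric_two.mul_left C) ?_) hm
  simpa only [norm_norm] using hX

theorem MemC₀.of_hasStrictSum {G : Type*} [TopologicalSpace G] {X : ℕ → G → 𝓜(ℂ, J)}
    {f : G → 𝓜(ℂ, J)} (h : ∀ g, HasStrictSum (fun n => X n g) (f g)) (hm : ∀ n, MemC₀ (X n))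
    {C : ℝ} (hX : ∀ᶠ n in atTop, ∀ g, ‖X n g‖ ≤ C * (1 / 2) ^ n) : MemC₀ f := by
  have hs := summable_geometric_two.mul_left C
  have hf : f = fun g => ∑' n, X n g := funext fun g => (h g).eq_tsum
    (.of_norm_bounded_eventually_nat hs (hX.mono fun n hn => hn g))
  rw [hf]
  refine .of_tendstoUniformly (fun N => MemC₀.sum hm N) ?_
  rw [← tendstoUniformlyOn_univ]
  exact tendstoUniformlyOn_tsum_nat_eventually hs (by simpa using hX)

theorem MemC₀.mul_const {G : Type*} [TopologicalSpace G] {f : G → 𝓜(ℂ, J)} (hf : MemC₀ f)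
    (T : 𝓜(ℂ, J)) : MemC₀ fun g => f g * T := by
  rw [memC₀_iff] at *
  exact ⟨hf.1.mul continuous_const, fun g => inIdeal_mul_right (hf.2.1 g) T, by
    simpa using hf.2.2.mul_const T⟩

theorem MemC₀.of_mem_closure {G X : Type*} [TopologicalSpace G] [SeminormedAddCommGroup X]
    {f : X → G → 𝓜(ℂ, J)} {S : Set X} (hS : ∀ s ∈ S, MemC₀ (f s)) {x : X} (hx : x ∈ closure S)
    {C : ℝ} (h : ∀ y g, ‖f x g - f y g‖ ≤ C * ‖x - y‖) : MemC₀ (f x) := by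
  obtain ⟨s, hs, hsx⟩ := mem_closure_iff_seq_limit.1 hx
  refine .of_tendstoUniformly (fun n => hS _ (hs n)) ?_
  rw [Metric.tendstoUniformly_iff]
  intro ε hε
  have h1 : Tendsto (fun n => C * ‖x - s n‖) atTop (𝓝 0) := by
    have := ((tendsto_const_nhds (x := x)).sub hsx).norm.const_mul C
    simpa using this
  filter_upwards [h1.eventually_lt_const hε] with n hn g
  rw [dist_eq_norm]
  exact (h _ g).trans_lt hn

end Sum

/-! ### Commutator estimates for conjugates D* a D -/

section Conjugate

variable {R : Type*} [NormedRing R] [StarRing R] [NormedStarGroup R] {D a : R}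

/-- The commutator of `star D` with `x` is, up to sign, the adjoint of that of `D` with `star x`.
Hence adjoints must be included among the prescribed elements. -/
theorem norm_conjugate_mul_sub_mul_le (hD : ‖D‖ ≤ 1) (ha : ‖a‖ ≤ 1) (x : R) :
    ‖star D * a * D * x - x * (star D * a * D)‖
      ≤ ‖D * x - x * D‖ + ‖D * star x - star x * D‖ + ‖a * x - x * a‖ := by
  have hD' : ‖star D‖ ≤ 1 := (norm_star D).trans_le hD
  have h : star D * a * D * x - x * (star D * a * D) = star D * a * (D * x - x * D)
      - star (D * star x - star x * D) * (a * D) + star D * (a * x - x * a) * D := by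
    simp only [star_sub, star_mul, star_star]
    noncomm_ring
  rw [h]
  have h1 : ‖star D * a * (D * x - x * D)‖ ≤ 1 * 1 * ‖D * x - x * D‖ := by
    grw [norm_mul_le, norm_mul_le, hD', ha]
  have h2 : ‖star (D * star x - star x * D) * (a * D)‖ ≤ ‖D * star x - star x * D‖ * (1 * 1) := by
    grw [norm_mul_le, norm_mul_le, ha, hD, norm_star]
  have h3 : ‖star D * (a * x - x * a) * D‖ ≤ 1 * ‖a * x - x * a‖ * 1 := by
    grw [norm_mul_le, norm_mul_le, hD', hD]
  linarith [norm_add_le (star D * a * (D * x - x * D)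
      - star (D * star x - star x * D) * (a * D)) (star D * (a * x - x * a) * D),
    norm_sub_le (star D * a * (D * x - x * D)) (star (D * star x - star x * D) * (a * D))]

/-- Moving `a` to the right of `D` makes `D` act on `a * x`, which lies in J in the applications and
can be almost annihilated. -/
theorem norm_conjugate_mul_le (hD : ‖D‖ ≤ 1) (x : R) :
    ‖star D * a * D * x‖ ≤ ‖D * a - a * D‖ * ‖x‖ + ‖D * (a * x)‖ := by
  have hD' : ‖star D‖ ≤ 1 := (norm_star D).trans_le hD
  have h : star D * a * D * x = star D * (D * (a * x)) - star D * ((D * a - a * D) * x) := by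
    noncomm_ring
  rw [h]
  have h1 : ‖star D * (D * (a * x))‖ ≤ 1 * ‖D * (a * x)‖ := by
    grw [norm_mul_le, hD']
  have h2 : ‖star D * ((D * a - a * D) * x)‖ ≤ 1 * (‖D * a - a * D‖ * ‖x‖) := by
    grw [norm_mul_le, norm_mul_le, hD']
  linarith [norm_sub_le (star D * (D * (a * x))) (star D * ((D * a - a * D) * x))]

/-- Here `x` is moved to the left of `D`, so that `1 - a` acts on it. -/
theorem norm_conjugate_one_sub_mul_le (hD : ‖D‖ ≤ 1) (ha : ‖1 - a‖ ≤ 1) (x : R) :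
    ‖star D * (1 - a) * D * x‖ ≤ ‖D * x - x * D‖ + ‖a * x - x‖ := by
  have hD' : ‖star D‖ ≤ 1 := (norm_star D).trans_le hD
  have h : star D * (1 - a) * D * x = star D * (1 - a) * (D * x - x * D)
      - star D * (a * x - x) * D := by
    noncomm_ring
  rw [h]
  have h1 : ‖star D * (1 - a) * (D * x - x * D)‖ ≤ 1 * 1 * ‖D * x - x * D‖ := by
    grw [norm_mul_le, norm_mul_le, hD', ha]
  have h2 : ‖star D * (a * x - x) * D‖ ≤ 1 * ‖a * x - x‖ * 1 := by
    grw [norm_mul_le, norm_mul_le, hD', hD]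
  linarith [norm_sub_le (star D * (1 - a) * (D * x - x * D)) (star D * (a * x - x) * D)]

theorem norm_map_conjugate_sub_le {α : R → R} (hαm : ∀ x y, α (x * y) = α x * α y)
    (hαs : ∀ x, α (star x) = star (α x)) (hα1 : ∀ x, ‖α x‖ = ‖x‖) (hD : ‖D‖ ≤ 1) (ha : ‖a‖ ≤ 1) :
    ‖α (star D * a * D) - star D * a * D‖ ≤ 2 * ‖α D - D‖ + ‖α a - a‖ := by
  have hD' : ‖star D‖ ≤ 1 := (norm_star D).trans_le hD
  have hD'' : ‖α D‖ ≤ 1 := (hα1 D).trans_le hD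
  have ha' : ‖α a‖ ≤ 1 := (hα1 a).trans_le ha
  have h : α (star D * a * D) - star D * a * D = star (α D - D) * (α a * α D)
      + star D * (α a - a) * α D + star D * a * (α D - D) := by
    simp only [hαm, hαs, star_sub]
    noncomm_ring
  rw [h]
  have h1 : ‖star (α D - D) * (α a * α D)‖ ≤ ‖α D - D‖ * (1 * 1) := by
    grw [norm_mul_le, norm_mul_le, norm_star, ha', hD'']
  have h2 : ‖star D * (α a - a) * α D‖ ≤ 1 * ‖α a - a‖ * 1 := by
    grw [norm_mul_le, norm_mul_le, hD', hD'']
  have h3 : ‖star D * a * (α D - D)‖ ≤ 1 * 1 * ‖α D - D‖ := by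
    grw [norm_mul_le, norm_mul_le, hD', ha]
  linarith [norm_add₃_le (a := star (α D - D) * (α a * α D)) (b := star D * (α a - a) * α D)
    (c := star D * a * (α D - D))]

end Conjugate

/-! ### The sum of conjugates along a partition of unity -/

section ConjugateSum

variable {J : Type*} [NonUnitalCStarAlgebra J] {r D a w : ℕ → 𝓜(ℂ, J)}

/-- The partial sums are 1 - r_N* r_N, and `r N` tends to 0 on J because it does so on an
approximate unit. -/
theorem hasStrictSum_star_mul_self (hr0 : r 0 = 1) (hr1 : ∀ n, ‖r n‖ ≤ 1)
    (hDD : ∀ n, star (D n) * D n = star (r n) * r n - star (r (n + 1)) * r (n + 1))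
    (hw : inIdeal J ⊆ leftFixed atTop w) (hrw : ∀ k, Tendsto (fun n => r n * w k) atTop (𝓝 0)) :
    HasStrictSum (fun n => star (D n) * D n) 1 := fun x hx => by
  have h1 : ∀ n, ‖1 - r n‖ ≤ ‖(1 : 𝓜(ℂ, J))‖ + 1 := fun n =>
    (norm_sub_le _ _).trans (by gcongr; exact hr1 n)
  have h2 : ∀ k, w k ∈ leftFixed atTop (fun n => 1 - r n) := fun k => by
    simpa [mem_leftFixed, sub_mul] using (tendsto_const_nhds (x := w k)).sub (hrw k)
  have h3 : x ∈ leftFixed atTop (fun n => 1 - r n) :=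
    (isClosed_leftFixed (Eventually.of_forall h1)).mem_of_tendsto (mem_leftFixed.1 (hw hx))
      (Eventually.of_forall fun k => leftFixed_mul (h2 k) x)
  have h4 : Tendsto (fun n => r n * x) atTop (𝓝 0) := by
    have := (tendsto_const_nhds (x := x)).sub (mem_leftFixed.1 h3)
    simpa [sub_mul] using this
  have h5 : Tendsto (fun n => star (r n) * (r n * x)) atTop (𝓝 0) := by
    rw [tendsto_zero_iff_norm_tendsto_zero] at h4 ⊢
    refine squeeze_zero (fun _ => norm_nonneg _) (fun n => ?_) h4
    grw [norm_mul_le, norm_star, hr1 n, one_mul]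
  have h6 : ∀ N, ∑ n ∈ Finset.range N, star (D n) * D n = 1 - star (r N) * r N := fun N => by
    rw [Finset.sum_congr rfl fun n _ => hDD n, Finset.sum_range_sub', hr0, star_one, one_mul]
  simpa [h6, sub_mul, mul_assoc] using (tendsto_const_nhds (x := x)).sub h5

end ConjugateSum

/-! ### The quasicentral multiplier M -/

section Construction

theorem norm_mAct_conjugate_sub_le {G J : Type*} [Group G] [TopologicalSpace G]
    [NonUnitalCStarAlgebra J] [GradedGAlgebra G J] (g : G) {D a : 𝓜(ℂ, J)} (hD : ‖D‖ ≤ 1)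
    (ha : ‖a‖ ≤ 1) :
    ‖mAct g (star D * a * D) - star D * a * D‖ ≤ 2 * ‖mAct g D - D‖ + ‖mAct g a - a‖ :=
  norm_map_conjugate_sub_le (α := mAct g) (mAct_mul g) (mAct_star g) (norm_mAct g) hD ha

variable {G E J P : Type*} [Group G] [TopologicalSpace G] [IsTopologicalGroup G]
  [LocallyCompactSpace G] [TopologicalSpace E] [MulAction G E]
  [ContinuousSMul G E] [NonUnitalCStarAlgebra J] [NonUnitalCStarAlgebra P]
  [GradedGAlgebra G P] [GradedGAlgebra G J]
  [ProperSMul G E] [LocallyCompactSpace E] [T2Space E] [SigmaCompactSpace E]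
  (Φ : ProperAlgebra G E P) (π : GRep G P J)

/-- a [x, g(φ)] = [x, a g(φ)] - [x, a] g(φ). The last term is an element of J times a translate; the
other lies in J pointwise by hypothesis and decays because a g(φ) does. -/
theorem memC₀_hom_mul_commutator {a x : 𝓜(ℂ, J)} (ha : a ∈ Set.range π.hom)
    (hax : x * a - a * x ∈ inIdeal J) (φ : C₀(E, ℂ))
    (haφ : ∀ g : G, x * (a * funRep Φ π (translate g φ)) - a * funRep Φ π (translate g φ) * x
      ∈ inIdeal J) :
    MemC₀ fun g : G => a * (x * funRep Φ π (translate g φ) - funRep Φ π (translate g φ) * x) := by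
  have hR := continuous_funRep_translate (G := G) Φ π φ
  have h1 := memC₀_mul_funRep_translate (G := G) Φ π φ (inIdeal_neg hax)
  have h2 : MemC₀ fun g : G =>
      x * (a * funRep Φ π (translate g φ)) - a * funRep Φ π (translate g φ) * x := by
    refine memC₀_iff.2 ⟨by fun_prop, haφ, ?_⟩
    obtain ⟨p, rfl⟩ := ha
    have h := tendsto_funRep_translate_mul_hom (G := G) Φ π φ p
    simp only [funRep_comm_hom] at h
    simpa using (h.const_mul x).sub (h.mul_const x)
  have h3 := h1.add h2
  refine (congrArg MemC₀ (funext fun g => ?_)).mp h3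
  noncomm_ring

set_option maxHeartbeats 1000000 in
theorem exists_quasicentral_multiplier [SigmaCompactSpace G] (hJ : IsSigmaUnital J)
    {A₁ : NonUnitalStarSubalgebra ℂ 𝓜(ℂ, J)} (hA₁σ : IsSigmaUnital A₁)
    (hPA₁ : ∀ p : P, π.hom p ∈ A₁)
    (hPA₁d : (A₁ : Set 𝓜(ℂ, J)) ⊆
      closure (Submodule.span ℂ {y | ∃ p : P, ∃ a ∈ A₁, y = π.hom p * a} : Set 𝓜(ℂ, J)))
    {φ : ℕ → C₀(E, ℂ)} (hφ : ∀ k, HasCompactSupport (φ k)) (hφ0 : star (φ 0) = φ 0)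
    (hφs : ∀ k, ∃ k', φ k' = star (φ k)) {l : G → ℝ} (hl : ∀ g, 0 < l g) (hl1 : ∀ g, l g ≤ 1)
    (hlK : ∀ K, IsCompact K → ∃ δ > 0, ∀ g ∈ K, δ ≤ l g)
    {v b x x' : ℕ → 𝓜(ℂ, J)} (hv : ∀ k, v k ∈ A₁) (hb : ∀ k, ∀ a ∈ A₁, a * b k ∈ inIdeal J)
    (hx : ∀ k, ∀ a ∈ A₁, gComm G (x k) a ∈ A₁) (hx' : ∀ k, ∀ a ∈ A₁, gComm G (x' k) a ∈ inIdeal J) :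
    ∃ M : 𝓜(ℂ, J), IsSelfAdjoint M ∧ ‖M‖ ≤ 1 ∧ ‖1 - M‖ ≤ 1 ∧ mGrading G M = M ∧
      (∀ g : G, mAct g M - M ∈ inIdeal J) ∧
      (∀ k, (1 - M) * v k ∈ inIdeal J) ∧
      (∀ k, M * b k ∈ inIdeal J) ∧
      (∀ k, M * x k - x k * M ∈ inIdeal J) ∧
      (∀ k, MemC₀ fun g : G =>
        M * funRep Φ π (translate g (φ k)) - funRep Φ π (translate g (φ k)) * M) ∧
      (∀ k i, MemC₀ fun g : G => M * (x' k * funRep Φ π (translate g (φ i))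
        - funRep Φ π (translate g (φ i)) * x' k)) ∧
      ∀ g : G, ‖M * funRep Φ π (translate g (φ 0)) - funRep Φ π (translate g (φ 0)) * M‖
        ≤ 4 * l g := by
  obtain ⟨w, hw⟩ := exists_isIdealUnit (G := G) hJ
  let K := CompactExhaustion.choice G
  have hε : ∀ n : ℕ, (0 : ℝ) < (1 / 2) ^ n := fun n => by positivity
  obtain ⟨a, ha, haT⟩ := exists_quasicentral_properUnit (G := G) hA₁σ hPA₁ hPA₁d
    (fun n => K.isCompact n) (X := fun n => x '' Set.Iic n) (fun n => (Set.finite_Iic n).image x)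
    (by rintro n _ ⟨k, -, rfl⟩; exact hx k) (V := fun n => v '' Set.Iic n)
    (fun n => (Set.finite_Iic n).image v) (by rintro n _ ⟨k, -, rfl⟩; exact hv k) hε
  have haA : ∀ n, a n ∈ A₁ := fun n => by
    obtain ⟨p, hp⟩ := ha.mem n
    exact hp ▸ hPA₁ p
  have hρ := funRep_even (G := G) (E := E) Φ π
  have hy : ∀ n k i, MemC₀ fun g : G => a n * (x' k * funRep Φ π (translate g (φ i))
      - funRep Φ π (translate g (φ i)) * x' k) := fun n k i => by
    refine memC₀_hom_mul_commutator Φ π (ha.mem n) ?_ (φ i) fun g => ?_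
    · rw [← gComm_of_even_right (G := G) _ (ha.even n)]
      exact hx' k _ (haA n)
    · obtain ⟨p, hp⟩ := ha.mem n
      have h1 : a n * funRep Φ π (translate g (φ i)) ∈ A₁ := by
        rw [← hp, ← funRep_comm_hom, funRep_mul_hom]
        exact hPA₁ _
      have h2 : mGrading G (a n * funRep Φ π (translate g (φ i)))
          = a n * funRep Φ π (translate g (φ i)) := by
        rw [← mGradingHom_apply, map_mul, mGradingHom_apply, mGradingHom_apply, ha.even, hρ]
      rw [← gComm_of_even_right (G := G) _ h2]
      exact hx' k _ h1
  have hyL : ∀ n k i, ∃ L : Set G, IsCompact L ∧ ∀ g ∉ L,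
      ‖a n * (x' k * funRep Φ π (translate g (φ i))
        - funRep Φ π (translate g (φ i)) * x' k)‖ ≤ (1 / 2) ^ n := fun n k i => by
    have h := (memC₀_iff.1 (hy n k i)).2.2.norm
    rw [norm_zero] at h
    obtain ⟨L, hL, hLs⟩ := mem_cocompact.1 (h.eventually_le_const (hε n))
    exact ⟨L, hL, fun g hg => hLs hg⟩
  choose L hL hLy using hyL
  -- The elements `D n` must almost annihilate: an approximate unit of J for strict convergence, the
  -- products a b for A₂, and the values of a [x', g(φ)] for property 6. The last are needed only
  -- for g in the compact set `L n k i`, being at most 2⁻ⁿ elsewhere.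
  let B : ℕ → Set 𝓜(ℂ, J) := fun n => w '' Set.Iic n ∪ (fun k => a n * b k) '' Set.Iic n ∪
    ⋃ k ∈ Set.Iic n, ⋃ i ∈ Set.Iic n, (fun g => a n * (x' k * funRep Φ π (translate g (φ i))
      - funRep Φ π (translate g (φ i)) * x' k)) '' L n k i
  have hB : ∀ n, IsCompact (B n) := fun n =>
    (((Set.finite_Iic n).image w).isCompact.union ((Set.finite_Iic n).image _).isCompact).union
      ((Set.finite_Iic n).isCompact_biUnion fun k _ => (Set.finite_Iic n).isCompact_biUnion
        fun i _ => (hL n k i).image (memC₀_iff.1 (hy n k i)).1)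
  have hBJ : ∀ n, B n ⊆ inIdeal J := by
    rintro n z ((⟨k, -, rfl⟩ | ⟨k, -, rfl⟩) | hz)
    · exact hw.mem k
    · exact hb k _ (haA n)
    · simp only [Set.mem_iUnion] at hz
      obtain ⟨k, -, i, -, g, -, rfl⟩ := hz
      exact (memC₀_iff.1 (hy n k i)).2.1 g
  obtain ⟨r, D, hr0, hDJ, hDe, hr1, hD1, hDD, hDB, hDK, hDX, hDφ⟩ := exists_strict_partition Φ π hJ
    hφ hl hlK (fun n => K.isCompact n) (fun m n h => K.subset h)
    (X := fun n => ⋃ k ∈ Set.Iic n, {x k, star (x k), v k, a k})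
    (fun n => (Set.finite_Iic n).biUnion fun k _ => by simp)
    (fun m n h => Set.biUnion_mono (Set.Iic_subset_Iic.2 h) fun _ _ => subset_rfl) hB hBJ hε
  have hDX' : ∀ n, ∀ k ≤ n, ∀ z ∈ ({x k, star (x k), v k, a k} : Set 𝓜(ℂ, J)),
      ‖D n * z - z * D n‖ ≤ (1 / 2) ^ n := fun n k hk z hz =>
    hDX n z (Set.mem_iUnion₂.2 ⟨k, hk, hz⟩)
  have hDB' : ∀ n ≥ 1, ∀ z ∈ B n, ‖r n * z‖ ≤ (1 / 2) ^ n ∧ ‖D n * z‖ ≤ (1 / 2) ^ n := by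
    rintro (_ | n) hn z hz
    · omega
    · exact hDB n z hz
  have hDa : ∀ n, ‖D n * a n - a n * D n‖ ≤ (1 / 2) ^ n := fun n =>
    hDX' n n le_rfl _ (by simp)
  let X : ℕ → 𝓜(ℂ, J) := fun n => star (D n) * a n * D n
  have hXJ : ∀ n, X n ∈ inIdeal J := fun n => inIdeal_mul_left _ (hDJ n)
  -- The terms are symmetric conjugates, so self-adjointness holds termwise and passes to the strict
  -- limit.
  have hXsa : ∀ n, IsSelfAdjoint (X n) := fun n => (ha.isSelfAdjoint n).conjugate' (D n)
  have hX1 := norm_sum_conjugate_le hr0 hDD ha.isSelfAdjoint ha.norm_le ha.norm_one_sub_le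
  have hwB : ∀ k, ∀ n ≥ k + 1, w k ∈ B n := fun k n hn =>
    .inl (.inl ⟨k, by simp; omega, rfl⟩)
  obtain ⟨M, hM⟩ : ∃ M, HasStrictSum X M := by
    refine exists_hasStrictSum hXsa (fun N => (hX1 N).1) hw.subset fun k => ?_
    refine .of_norm_bounded_eventually_nat summable_geometric_two ?_
    filter_upwards [eventually_ge_atTop (k + 1)] with n hn
    rw [norm_norm, mul_assoc]
    grw [norm_mul_le, norm_mul_le, norm_star, hD1, ha.norm_le, one_mul, one_mul]
    exact (hDB' n (by omega) _ (hwB k n hn)).2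
  have hone : HasStrictSum (fun n => star (D n) * D n) 1 := by
    refine hasStrictSum_star_mul_self hr0 hr1 hDD hw.subset fun k => ?_
    refine squeeze_zero_norm' ?_ (tendsto_pow_atTop_nhds_zero_of_lt_one (r := (1 / 2 : ℝ))
      (by norm_num) (by norm_num))
    filter_upwards [eventually_ge_atTop (k + 1)] with n hn
    exact (hDB' n (by omega) _ (hwB k n hn)).1
  have hM' : HasStrictSum (fun n => star (D n) * (1 - a n) * D n) (1 - M) := by
    simpa only [mul_sub, sub_mul, mul_one] using hone.sub hM
  -- The factor 2 comes from g(φ) and its adjoint; the commutator with `a n` is zero because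
  -- functions are central on P.
  have hXρ : ∀ n k k', φ k' = star (φ k) → k ≤ n → k' ≤ n → ∀ g : G,
      ‖X n * funRep Φ π (translate g (φ k)) - funRep Φ π (translate g (φ k)) * X n‖
        ≤ 2 * (1 / 2) ^ n * l g := fun n k k' hk' hkn hkn' g => by
    have h := norm_conjugate_mul_sub_mul_le (hD1 n) (ha.norm_le n)
      (funRep Φ π (translate g (φ k)))
    have h1 : a n * funRep Φ π (translate g (φ k)) - funRep Φ π (translate g (φ k)) * a n = 0 := by
      obtain ⟨p, hp⟩ := ha.mem n
      rw [← hp, funRep_comm_hom, sub_self]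
    rw [h1, norm_zero, ← funRep_star, ← translate_star, ← hk'] at h
    linarith [hDφ n k hkn g, hDφ n k' hkn' g]
  have hcomm : ∀ y, HasStrictSum (fun n => X n * y - y * X n) (M * y - y * M) := fun y =>
    (hM.mul_right y).sub (hM.mul_left y)
  refine ⟨M, hM.isSelfAdjoint hXsa, ?_, ?_, ?_, fun g => ?_, fun k => ?_, fun k => ?_, fun k => ?_,
    fun k => ?_, fun k i => ?_, fun g => ?_⟩
  · have h := hM.norm_sub_le 0 (C := 1) fun N => by
      rw [zero_sub, norm_neg]
      exact (hX1 N).1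
    rwa [zero_sub, norm_neg] at h
  · exact hM.norm_sub_le 1 fun N => (hX1 N).2
  · refine (hM.mulExt (GradedGAlgebra.grading G)).unique ?_
    have h : ∀ n, mGradingHom G (X n) = X n := fun n => by
      simp only [X, map_mul, map_star, mGradingHom_apply, hDe, ha.even]
    have h' : (fun n => mulExt (GradedGAlgebra.grading G) (X n)) = X := funext h
    rwa [h']
  · have hs : HasStrictSum (fun n => mAct g (X n) - X n) (mAct g M - M) :=
      (hM.mulExt (GradedGAlgebra.act g)).sub hM
    refine hs.mem_inIdeal_of_eventually_le
      (fun n => inIdeal_sub (mAct_mem_inIdeal g (hXJ n)) (hXJ n)) (C := 3) ?_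
    obtain ⟨N, hN⟩ := K.exists_mem g
    filter_upwards [eventually_ge_atTop N] with n hn
    have hg := K.subset hn hN
    have h := norm_mAct_conjugate_sub_le g (hD1 n) (ha.norm_le n)
    linarith [hDK n g hg, (haT n).1 g hg]
  · refine (hM'.mul_right (v k)).mem_inIdeal_of_eventually_le
      (fun n => inIdeal_mul_right (inIdeal_mul_left _ (hDJ n)) _) (C := 2) ?_
    filter_upwards [eventually_ge_atTop k] with n hn
    linarith [norm_conjugate_one_sub_mul_le (hD1 n) (ha.norm_one_sub_le n) (v k),
      hDX' n k hn (v k) (by simp), (haT n).2.2 (v k) ⟨k, hn, rfl⟩]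
  · refine (hM.mul_right (b k)).mem_inIdeal_of_eventually_le
      (fun n => inIdeal_mul_right (hXJ n) _) (C := ‖b k‖ + 1) ?_
    filter_upwards [eventually_ge_atTop (k + 1)] with n hn
    have h := norm_conjugate_mul_le (a := a n) (hD1 n) (b k)
    have h1 := (hDB' n (by omega) (a n * b k) (.inl (.inr ⟨k, by simp; omega, rfl⟩))).2
    have h2 := mul_le_mul_of_nonneg_right (hDa n) (norm_nonneg (b k))
    linarith
  · refine (hcomm (x k)).mem_inIdeal_of_eventually_le
      (fun n => inIdeal_sub (inIdeal_mul_right (hXJ n) _) (inIdeal_mul_left _ (hXJ n))) (C := 3) ?_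
    filter_upwards [eventually_ge_atTop k] with n hn
    linarith [norm_conjugate_mul_sub_mul_le (hD1 n) (ha.norm_le n) (x k),
      hDX' n k hn (x k) (by simp), hDX' n k hn (star (x k)) (by simp),
      (haT n).2.1 (x k) ⟨k, hn, rfl⟩]
  · refine MemC₀.of_hasStrictSum (fun g => hcomm _)
      (fun n => memC₀_commutator_funRep_translate Φ π (φ k) (hXJ n)) (C := 2) ?_
    obtain ⟨k', hk'⟩ := hφs k
    filter_upwards [eventually_ge_atTop (max k k')] with n hn g
    refine (hXρ n k k' hk' (by omega) (by omega) g).trans ?_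
    have := hl1 g
    exact mul_le_of_le_one_right (by positivity) this
  · refine MemC₀.of_hasStrictSum (fun g => hM.mul_right _) (fun n => ?_)
      (C := 2 * ‖x' k‖ * ‖φ i‖ + 1) ?_
    · have h1 := memC₀_mul_funRep_translate (G := G) Φ π (φ i) (inIdeal_mul_right (hXJ n) (x' k))
      have h2 := ((memC₀_mul_funRep_translate (G := G) Φ π (φ i) (hXJ n)).mul_const (x' k)).neg
      simpa only [mul_sub, ← mul_assoc, ← sub_eq_add_neg] using h1.add h2
    · filter_upwards [eventually_ge_atTop (max k i + 1)] with n hn g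
      set y := x' k * funRep Φ π (translate g (φ i)) - funRep Φ π (translate g (φ i)) * x' k
        with hy_def
      have hρ1 := norm_funRep_translate_le Φ π g (φ i)
      have hy1 : ‖y‖ ≤ 2 * ‖x' k‖ * ‖φ i‖ := by
        rw [hy_def]
        grw [norm_sub_le, norm_mul_le, norm_mul_le, hρ1]
        linarith
      have h1 : ‖D n * (a n * y)‖ ≤ (1 / 2) ^ n := by
        by_cases hg : g ∈ L n k i
        · refine (hDB' n (by omega) _ (.inr ?_)).2
          simp only [Set.mem_iUnion]
          exact ⟨k, by simp; omega, i, by simp; omega, g, hg, rfl⟩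
        · grw [norm_mul_le, hD1, one_mul]
          exact hLy n k i g hg
      have h := norm_conjugate_mul_le (a := a n) (hD1 n) y
      have h2 := mul_le_mul (hDa n) hy1 (norm_nonneg _) (hε n).le
      linarith
  -- Since `φ 0` is self-adjoint and has index 0, the bound holds from the first term on, and 4 is
  -- the sum of 2 · 2⁻ⁿ.
  · have h := (hcomm (funRep Φ π (translate g (φ 0)))).norm_sub_le 0 (C := 4 * l g) fun N => by
      rw [zero_sub, norm_neg]
      have h1 : ∑ n ∈ Finset.range N, 2 * (1 / 2 : ℝ) ^ n * l g ≤ 4 * l g := by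
        have h2 : ∑ n ∈ Finset.range N, (1 / 2 : ℝ) ^ n ≤ 2 := sum_geometric_two_le N
        rw [← Finset.sum_mul, ← Finset.mul_sum]
        have := hl g
        gcongr
        linarith
      exact (norm_sum_le_of_le _ fun n _ =>
        hXρ n 0 0 hφ0.symm (Nat.zero_le n) (Nat.zero_le n) g).trans h1
    rwa [zero_sub, norm_neg] at h

end Construction

/-! ### Reductions to sequences -/

/-- Adjoining a point `z` covers the empty set; with `z = 0` the commutator hypotheses hold
trivially at the extra point. -/
theorem exists_sequence_dense_insert {X : Type*} [PseudoMetricSpace X] {s : Set X}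
    (hs : TopologicalSpace.IsSeparable s) (z : X) :
    ∃ x : ℕ → X, (∀ k, x k ∈ insert z s) ∧ s ⊆ closure (Set.range x) := by
  obtain ⟨t, hts, htc, hst⟩ := hs.exists_countable_dense_subset
  obtain ⟨x, hx⟩ := (htc.insert z).exists_eq_range (Set.insert_nonempty z t)
  refine ⟨x, fun k => Set.insert_subset_insert hts (hx ▸ Set.mem_range_self k), hst.trans ?_⟩
  rw [← hx]
  exact closure_mono (Set.subset_insert z t)

theorem exists_dense_sequence_star {E : Type*} [TopologicalSpace E] [LocallyCompactSpace E]
    [T2Space E] [SigmaCompactSpace E] [SecondCountableTopology E] {χ : C₀(E, ℂ)}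
    (hχ : HasCompactSupport χ) (hχs : star χ = χ) :
    ∃ φ : ℕ → C₀(E, ℂ), (∀ k, HasCompactSupport (φ k)) ∧ DenseRange φ ∧ φ 0 = χ ∧
      ∀ k, ∃ k', φ k' = star (φ k) := by
  obtain ⟨φ, hφ, hφd⟩ := exists_dense_sequence_compactSupport (E := E)
  have hc : (Set.range φ ∪ star '' Set.range φ).Countable :=
    (Set.countable_range φ).union ((Set.countable_range φ).image _)
  obtain ⟨ψ, hψ⟩ := hc.exists_eq_range ⟨φ 0, .inl ⟨0, rfl⟩⟩
  have hmem : ∀ k, ψ k ∈ Set.range φ ∪ star '' Set.range φ := fun k => hψ ▸ Set.mem_range_self k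
  refine ⟨fun n => Nat.casesOn n χ ψ, ?_, ?_, rfl, ?_⟩
  · rintro (_ | k)
    · exact hχ
    · change HasCompactSupport (ψ k)
      rcases hmem k with ⟨i, hi⟩ | ⟨_, ⟨i, rfl⟩, hi⟩
      · exact hi ▸ hφ i
      · rw [← hi]
        exact (hφ i).comp_left (g := star) (star_zero ℂ)
  · refine hφd.mono ?_
    rintro _ ⟨i, rfl⟩
    obtain ⟨k, hk⟩ : φ i ∈ Set.range ψ := hψ ▸ .inl ⟨i, rfl⟩
    exact ⟨k + 1, hk⟩
  · rintro (_ | k)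
    · exact ⟨0, hχs.symm⟩
    · have h : star (ψ k) ∈ Set.range ψ := by
        rw [← hψ]
        rcases hmem k with h | ⟨_, h, hi⟩
        · exact .inr ⟨_, h, rfl⟩
        · rw [← hi, star_star]
          exact .inl h
      obtain ⟨m, hm⟩ := h
      exact ⟨m + 1, hm⟩

theorem IsSigmaUnital.exists_sequence {R : Type*} [NormedRing R] [StarRing R] [NormedAlgebra ℂ R]
    {A : NonUnitalStarSubalgebra ℂ R} (hA : IsSigmaUnital A) :
    ∃ v : ℕ → R, (∀ k, v k ∈ A) ∧ ∀ x ∈ A, Tendsto (fun k => v k * x) atTop (𝓝 x) := by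
  obtain ⟨u, -, hu⟩ := hA
  exact ⟨fun k => u k, fun k => (u k).2, fun x hx =>
    (continuous_subtype_val.tendsto _).comp (hu ⟨x, hx⟩).1⟩

theorem mul_mem_inIdeal_of_tendsto {J : Type*} [NonUnitalCStarAlgebra J] {T x : 𝓜(ℂ, J)}
    {v : ℕ → 𝓜(ℂ, J)} (hv : ∀ k, T * v k ∈ inIdeal J)
    (hx : Tendsto (fun k => v k * x) atTop (𝓝 x)) : T * x ∈ inIdeal J :=
  isClosed_inIdeal.mem_of_tendsto (hx.const_mul T) (Eventually.of_forall fun k => by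
    rw [← mul_assoc]
    exact inIdeal_mul_right (hv k) x)

theorem commutator_mem_inIdeal_of_mem_closure {J : Type*} [NonUnitalCStarAlgebra J]
    {M x : 𝓜(ℂ, J)} {s : Set 𝓜(ℂ, J)} (hs : ∀ y ∈ s, M * y - y * M ∈ inIdeal J)
    (hx : x ∈ closure s) : M * x - x * M ∈ inIdeal J :=
  closure_minimal hs ((isClosed_inIdeal (J := J)).preimage
    (f := fun y => M * y - y * M) (by fun_prop)) hx

/-! ### Passing from dense sequences to all functions and operators -/

section Density

variable {G E J P : Type*} [Group G] [TopologicalSpace G] [TopologicalSpace E] [MulAction G E]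
  [ContinuousConstSMul G E] [NonUnitalCStarAlgebra J] [NonUnitalCStarAlgebra P]
  [GradedGAlgebra G P] [GradedGAlgebra G J]
  (Φ : ProperAlgebra G E P) (π : GRep G P J)

/-- Translation does not increase the norm, so the expression depends on φ in a Lipschitz way,
uniformly in g. -/
theorem memC₀_mul_commutator_of_dense {M x : 𝓜(ℂ, J)} {s : Set C₀(E, ℂ)} (hs : Dense s)
    (hM : ∀ ψ ∈ s, MemC₀ fun g : G =>
      M * (x * funRep Φ π (translate g ψ) - funRep Φ π (translate g ψ) * x)) (φ : C₀(E, ℂ)) :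
    MemC₀ fun g : G => M * (x * funRep Φ π (translate g φ) - funRep Φ π (translate g φ) * x) := by
  refine MemC₀.of_mem_closure (f := fun (ψ : C₀(E, ℂ)) (g : G) =>
    M * (x * funRep Φ π (translate g ψ) - funRep Φ π (translate g ψ) * x)) hM (hs φ)
    (C := ‖M‖ * (2 * ‖x‖)) fun ψ g => ?_
  have h : M * (x * funRep Φ π (translate g φ) - funRep Φ π (translate g φ) * x)
      - M * (x * funRep Φ π (translate g ψ) - funRep Φ π (translate g ψ) * x)
      = M * (x * funRep Φ π (translate g (φ - ψ)) - funRep Φ π (translate g (φ - ψ)) * x) := by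
    rw [translate_sub, funRep_sub]
    noncomm_ring
  rw [h]
  grw [norm_mul_le, norm_sub_le, norm_mul_le, norm_mul_le, norm_funRep_translate_le]
  exact le_of_eq (by ring)

theorem memC₀_commutator_of_dense {M : 𝓜(ℂ, J)} {s : Set C₀(E, ℂ)} (hs : Dense s)
    (hM : ∀ ψ ∈ s, MemC₀ fun g : G =>
      M * funRep Φ π (translate g ψ) - funRep Φ π (translate g ψ) * M) (φ : C₀(E, ℂ)) :
    MemC₀ fun g : G => M * funRep Φ π (translate g φ) - funRep Φ π (translate g φ) * M := by
  simpa only [one_mul] using memC₀_mul_commutator_of_dense Φ π (M := 1) (x := M) hs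
    (by simpa only [one_mul] using hM) φ

theorem memC₀_mul_commutator_of_mem_closure {M x : 𝓜(ℂ, J)} {φ : C₀(E, ℂ)} {s : Set 𝓜(ℂ, J)}
    (hM : ∀ y ∈ s, MemC₀ fun g : G =>
      M * (y * funRep Φ π (translate g φ) - funRep Φ π (translate g φ) * y)) (hx : x ∈ closure s) :
    MemC₀ fun g : G => M * (x * funRep Φ π (translate g φ) - funRep Φ π (translate g φ) * x) := by
  refine MemC₀.of_mem_closure (f := fun (y : 𝓜(ℂ, J)) (g : G) =>
    M * (y * funRep Φ π (translate g φ) - funRep Φ π (translate g φ) * y)) hM hx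
    (C := ‖M‖ * (2 * ‖φ‖)) fun y g => ?_
  have h : M * (x * funRep Φ π (translate g φ) - funRep Φ π (translate g φ) * x)
      - M * (y * funRep Φ π (translate g φ) - funRep Φ π (translate g φ) * y)
      = M * ((x - y) * funRep Φ π (translate g φ) - funRep Φ π (translate g φ) * (x - y)) := by
    noncomm_ring
  rw [h]
  grw [norm_mul_le, norm_sub_le, norm_mul_le, norm_mul_le, norm_funRep_translate_le]
  exact le_of_eq (by ring)

end Density

end TechThm

/-! ### Assembly of the two multipliers -/

theorem theorem2p6
    {G E J P : Type*}
    [Group G] [TopologicalSpace G] [IsTopologicalGroup G] [T2Space G] [LocallyCompactSpace G]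
    [SecondCountableTopology G] [MeasurableSpace G] [BorelSpace G]
    (μ : Measure G) [μ.IsHaarMeasure]
    [TopologicalSpace E] [TopologicalSpace.MetrizableSpace E] [LocallyCompactSpace E]
    [MulAction G E] [ContinuousSMul G E] [ProperSMul G E]
    [CompactSpace (Quotient (MulAction.orbitRel G E))]
    [NonUnitalCStarAlgebra J] [GradedGAlgebra G J] (hJ : IsSigmaUnital J)
    [NonUnitalCStarAlgebra P] [GradedGAlgebra G P]
    (Φ : ProperAlgebra G E P) (π : GRep G P J)
    (A₁ A₂ : NonUnitalStarSubalgebra ℂ 𝓜(ℂ, J))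
    (hA₁c : IsClosed (A₁ : Set 𝓜(ℂ, J))) (hA₂c : IsClosed (A₂ : Set 𝓜(ℂ, J)))
    (hA₁σ : IsSigmaUnital A₁) (hA₂σ : IsSigmaUnital A₂)
    (hA₁G : ∀ g : G, ∀ a ∈ A₁, mAct g a ∈ A₁)
    (hPA₁ : ∀ p : P, π.hom p ∈ A₁)
    (hPA₁d : (A₁ : Set 𝓜(ℂ, J)) ⊆
      closure (Submodule.span ℂ {y | ∃ p : P, ∃ a ∈ A₁, y = π.hom p * a} : Set 𝓜(ℂ, J)))
    (Δ Δ' : Set 𝓜(ℂ, J))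
    (hΔs : TopologicalSpace.IsSeparable Δ) (hΔ's : TopologicalSpace.IsSeparable Δ')
    (hΔ : ∀ x ∈ Δ, ∀ a ∈ A₁, gComm G x a ∈ A₁)
    (hΔ' : ∀ x ∈ Δ', ∀ a ∈ A₁, gComm G x a ∈ inIdeal J)
    (hA₁A₂ : ∀ a ∈ A₁, ∀ b ∈ A₂, a * b ∈ inIdeal J)
    (c : C(E, ℝ)) (hc : IsCutoff μ c) :
    ∃ M₁ M₂ : 𝓜(ℂ, J), M₁ + M₂ = 1 ∧
      (∀ x ∈ A₁, M₁ * x ∈ inIdeal J) ∧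
      (∀ x ∈ A₂, M₂ * x ∈ inIdeal J) ∧
      (∀ x ∈ Δ', ∀ φ : C₀(E, ℂ),
        MemC₀ fun g : G => M₂ * gComm G x (funRep Φ π (translate g φ))) ∧
      ∀ M ∈ ({M₁, M₂} : Set 𝓜(ℂ, J)),
        (∃ b, M = star b * b) ∧
        mGrading G M = M ∧
        (∀ g : G, mAct g M - M ∈ inIdeal J) ∧
        (∀ x ∈ Δ, gComm G M x ∈ inIdeal J) ∧
        (∀ φ : C₀(E, ℂ), MemC₀ fun g : G => gComm G M (funRep Φ π (translate g φ))) ∧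
        ∃ I : 𝓜(ℂ, J),
          HasStrictIntegral μ
            (fun g : G => funRep Φ π (translate g (toC₀ c hc.compactSupport)) * M *
              funRep Φ π (translate g (toC₀ c hc.compactSupport))) I ∧
          I - M ∈ inIdeal J := by
  have : SigmaCompactSpace E := sigmaCompactSpace_of_compact_quotient (G := G)
  have : SecondCountableTopology E := by
    let := TopologicalSpace.metrizableSpaceMetric E
    exact EMetric.secondCountable_of_sigmaCompact E
  have hχs : star (toC₀ c hc.compactSupport) = toC₀ c hc.compactSupport := by
    ext x
    exact Complex.conj_ofReal _
  have hχ : HasCompactSupport (toC₀ c hc.compactSupport) :=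
    hc.compactSupport.comp_left (g := fun r : ℝ => (r : ℂ)) Complex.ofReal_zero
  -- The cut-off function is placed at index 0, so that its commutators obey the integrable bound
  -- for every g.
  obtain ⟨φ, hφ, hφd, hφ0, hφs⟩ := exists_dense_sequence_star hχ hχs
  obtain ⟨l, hli, hl, hl1, hlK⟩ := exists_integrable_weight μ
  obtain ⟨v, hv, hvA⟩ := hA₁σ.exists_sequence
  obtain ⟨b, hb, hbA⟩ := hA₂σ.exists_sequence
  obtain ⟨x, hx, hxd⟩ := exists_sequence_dense_insert hΔs 0
  obtain ⟨x', hx', hxd'⟩ := exists_sequence_dense_insert hΔ's 0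
  have h0 : ∀ a : 𝓜(ℂ, J), gComm G 0 a = 0 := fun a => by
    rw [gComm_of_even_left (map_zero (mGradingHom G)), zero_mul, mul_zero, sub_zero]
  obtain ⟨M, hMsa, hM1, hM1', hMe, hMG, hMv, hMb, hMx, hMφ, hMx', hMl⟩ :=
    exists_quasicentral_multiplier Φ π hJ hA₁σ hPA₁ hPA₁d hφ (by rw [hφ0, hχs]) hφs hl hl1 hlK hv
      (fun k a ha => hA₁A₂ a ha _ (hb k)) (x := x) (x' := x')
      (fun k a ha => by
        rcases hx k with h | h
        · rw [h, h0]
          exact A₁.zero_mem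
        · exact hΔ _ h a ha)
      (fun k a ha => by
        rcases hx' k with h | h
        · rw [h, h0]
          exact inIdeal_zero
        · exact hΔ' _ h a ha)
  rw [hφ0] at hMl
  have hMC := memC₀_commutator_of_dense Φ π hφd (M := M) (by rintro _ ⟨k, rfl⟩; exact hMφ k)
  have hMΔ : ∀ y ∈ Δ, M * y - y * M ∈ inIdeal J := fun y hy =>
    commutator_mem_inIdeal_of_mem_closure (by rintro _ ⟨k, rfl⟩; exact hMx k) (hxd hy)
  have hone : ∀ y : 𝓜(ℂ, J), (1 - M) * y - y * (1 - M) = -(M * y - y * M) := fun y => by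
    noncomm_ring
  have hMe' : mGrading G (1 - M) = 1 - M := by
    rw [← mGradingHom_apply, map_sub, map_one, mGradingHom_apply, hMe]
  refine ⟨1 - M, M, sub_add_cancel 1 M, fun y hy => mul_mem_inIdeal_of_tendsto hMv (hvA y hy),
    fun y hy => mul_mem_inIdeal_of_tendsto hMb (hbA y hy), fun y hy ψ => ?_, ?_⟩
  · simp only [gComm_of_even_right y (funRep_even Φ π _)]
    refine memC₀_mul_commutator_of_mem_closure Φ π (s := Set.range x') ?_ (hxd' hy)
    rintro _ ⟨k, rfl⟩
    exact memC₀_mul_commutator_of_dense Φ π hφd (by rintro _ ⟨i, rfl⟩; exact hMx' k i) ψ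
  rintro N (rfl | rfl)
  · refine ⟨exists_eq_star_mul_self ((IsSelfAdjoint.one _).sub hMsa) hM1' (by rwa [sub_sub_cancel]),
      hMe', fun g => ?_, fun y hy => ?_, fun ψ => ?_, exists_hasStrictIntegral Φ π μ hc hli
      (fun g => ?_) (C := 4) fun g => ?_⟩
    · have h1 : mAct g (1 : 𝓜(ℂ, J)) = 1 := map_one (mActHom g)
      rw [mAct_sub, h1, sub_sub_sub_cancel_left, ← neg_sub]
      exact inIdeal_neg (hMG g)
    · rw [gComm_of_even_left hMe', hone]
      exact inIdeal_neg (hMΔ y hy)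
    · simp only [gComm_of_even_left hMe', hone]
      exact (hMC ψ).neg
    · rw [hone]
      exact inIdeal_neg ((memC₀_iff.1 (hMC _)).2.1 g)
    · rw [hone, norm_neg]
      exact hMl g
  · refine ⟨exists_eq_star_mul_self hMsa hM1 hM1', hMe, hMG, fun y hy => ?_, fun ψ => ?_,
      exists_hasStrictIntegral Φ π μ hc hli (fun g => (memC₀_iff.1 (hMC _)).2.1 g) (C := 4) hMl⟩
    · rw [gComm_of_even_left hMe]
      exact hMΔ y hy
    · simp only [gComm_of_even_left hMe]
      exact hMC ψ
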